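/- Let $\mathbf k$ be a field of characteristic $0$. **Notation.** Let $\hat{\mathfrak f}_2$ be the degree completion of the free Lie algebra over $\mathbf k$ on $x_1=x$, $x_2=y$, regarded inside $\mathbf k\langle\langle x,y\rangle\rangle$. Its group is $\exp(\hat{\mathfrak f}_2)$. Let $F_2(\mathbf k)$ be the pronipotent completion of the free group on $X,Y$, identified with $\exp(\hat{\mathfrak f}_2)$ by $X=e^x$, $Y=e^y$. Automorphisms of the pronipotent group $\exp(\hat{\mathfrak f}_2)$ are identified with automorphisms of the Lie algebra $\hat{\mathfrak f}_2$ by $\alpha(e^u)=e^{\alpha(u)}$. Write $g\sim h$ if $g=khk^{-1}$ for some $k\in\exp(\hat{\mathfrak f}_2)$, where $g,h$ lie both in $\exp(\hat{\mathfrak f}_2)$ or both in $\hat{\mathfrak f}_2$. Let $\hat{\mathfrak T}_2$ be the degree completion of the quotient of the free associative algebra $\mathbf k\langle x,y\rangle$ by the span of its commutators (series of cyclic words), and let $f\mapsto\langle f\rangle$ be the projection $\mathbf k\langle\langle x,y\rangle\rangle\to\hat{\mathfrak T}_2$. A tangential derivation is a derivation of the form $D=[\![u_1,u_2]\!]\colon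 x_i\mapsto[u_i,x_i]$ with $u_1,u_2\in\hat{\mathfrak f}_2$; the $u_i$ are unique if normalized so that $u_i$ has no linear term in $x_i$. Its divergence is then $j(D)=\langle\sum_i x_i\,\partial_i(u_i)\rangle$, where $f=\epsilon(f)1+\sum_i x_i\,\partial_i(f)$ and $\epsilon(f)$ is the constant term of $f$. An automorphism of $\hat{\mathfrak f}_2$ is tangential if it maps each $x_i$ to a conjugate of $x_i$ under $\exp(\hat{\mathfrak f}_2)$; the tangential automorphisms are exactly the $e^D$ for $D$ a tangential derivation, and $D$ is unique. The Jacobian $J$ is the group cocycle with values in $\hat{\mathfrak T}_2$ integrating $j$, determined by $J(\mathrm{id})=0$ and $\frac{d}{dt}J(e^{tD}g)|_{t=0}=j(D)+D\cdot J(g)$; explicitly, $J(e^D)=\sum_{m\ge 0}\frac{1}{(m+1)!}D^m\cdot j(D)$. For $r\in u^2\mathbf k[[u]]$ put $$\delta(r)=\langle r(x+y)-r(x)-r(y)\rangle,\qquad \tilde\delta(r)=\langle r(\log(e^xe^y))-r(x)-r(y)\rangle .$$ Define $$\mathrm{SolKV}(\mathbf k)=\{\mu\in\mathrm{Iso}(F_2(\mathbf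 k),\exp(\hat{\mathfrak f}_2)) : \mu(X)\sim e^x,\ \mu(Y)\sim e^y,\ \mu(XY)=e^{x+y},\ \exists r\in u^2\mathbf k[[u]]:\ J(\mu)=\delta(r)\},$$ $$\mathrm{KV}(\mathbf k)=\{\alpha\in\mathrm{Aut}(F_2(\mathbf k)) : \alpha(X)\sim X,\ \alpha(Y)\sim Y,\ \alpha(XY)=XY,\ \exists\sigma\in u^2\mathbf k[[u]]:\ J(\alpha)=\tilde\delta(\sigma)\},$$ $$\mathrm{KRV}(\mathbf k)=\{a\in\mathrm{Aut}(\hat{\mathfrak f}_2) : a(x)\sim x,\ a(y)\sim y,\ a(x+y)=x+y,\ \exists s\in u^2\mathbf k[[u]]:\ J(a)=\delta(s)\}.$$ **Proposition.** 1. For each element of one of these three sets, the series $r$ (respectively $\sigma$, $s$) is unique. It is called the Duflo series of the element and denoted $\mathrm{Duf}(\mu)$ (respectively $\mathrm{Duf}(\alpha)$, $\mathrm{Duf}(a)$). 2. $\mathrm{KV}(\mathbf k)$ and $\mathrm{KRV}(\mathbf k)$ are groups under composition. 3. $(\alpha,\mu)\mapsto\mu\circ\alpha^{-1}$ defines a left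 action of $\mathrm{KV}(\mathbf k)$ on $\mathrm{SolKV}(\mathbf k)$, and $(\mu,a)\mapsto a^{-1}\circ\mu$ defines a right action of $\mathrm{KRV}(\mathbf k)$ on $\mathrm{SolKV}(\mathbf k)$. These actions commute, and each of them is free and transitive: for all $\mu,\mu'\in\mathrm{SolKV}(\mathbf k)$ there is exactly one $\alpha\in\mathrm{KV}(\mathbf k)$ with $\mu\circ\alpha^{-1}=\mu'$ and exactly one $a\in\mathrm{KRV}(\mathbf k)$ with $a^{-1}\circ\mu=\mu'$. 4. $\mathrm{Duf}(\alpha\circ\beta)=\mathrm{Duf}(\alpha)+\mathrm{Duf}(\beta)$ for $\alpha,\beta\in\mathrm{KV}(\mathbf k)$, $\mathrm{Duf}(a\circ b)=\mathrm{Duf}(a)+\mathrm{Duf}(b)$ for $a,b\in\mathrm{KRV}(\mathbf k)$, and $$\mathrm{Duf}(\mu\circ\alpha^{-1})=\mathrm{Duf}(\mu)-\mathrm{Duf}(\alpha),\qquad \mathrm{Duf}(a^{-1}\circ\mu)=\mathrm{Duf}(\mu)-\mathrm{Duf}(a)$$ for $\mu\in\mathrm{SolKV}(\mathbf k)$, $\alpha\in\mathrm{KV}(\mathbf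 k)$, $a\in\mathrm{KRV}(\mathbf k)$. -/

import Mathlib

namespace KashiwaraVergne

noncomputable section

/-- `NCSeries k n` is the degree completion of the free associative algebra on `x_1, …, x_n`:
noncommutative formal power series, that is functions assigning a coefficient to every word. -/
@[ext] structure NCSeries (k : Type*) (n : ℕ) where
  /-- The coefficient of a word. -/
  coeff : List (Fin n) → k

namespace NCSeries

variable {k : Type*} [Field k] {n : ℕ}

instance : Zero (NCSeries k n) := ⟨⟨fun _ => 0⟩⟩

instance : Add (NCSeries k n) := ⟨fun f g => ⟨fun w => f.coeff w + g.coeff w⟩⟩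

instance : Neg (NCSeries k n) := ⟨fun f => ⟨fun w => -f.coeff w⟩⟩

instance : Sub (NCSeries k n) := ⟨fun f g => ⟨fun w => f.coeff w - g.coeff w⟩⟩

instance : SMul k (NCSeries k n) := ⟨fun c f => ⟨fun w => c * f.coeff w⟩⟩

@[simp] theorem coeff_zero (w : List (Fin n)) : (0 : NCSeries k n).coeff w = 0 := rfl

@[simp] theorem coeff_add (f g : NCSeries k n) (w : List (Fin n)) :
    (f + g).coeff w = f.coeff w + g.coeff w := rfl

@[simp] theorem coeff_neg (f : NCSeries k n) (w : List (Fin n)) :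
    (-f).coeff w = -f.coeff w := rfl

@[simp] theorem coeff_sub (f g : NCSeries k n) (w : List (Fin n)) :
    (f - g).coeff w = f.coeff w - g.coeff w := rfl

@[simp] theorem coeff_smul (c : k) (f : NCSeries k n) (w : List (Fin n)) :
    (c • f).coeff w = c * f.coeff w := rfl

theorem ext_coeff {k : Type*} {n : ℕ} {f g : NCSeries k n} (h : ∀ w, f.coeff w = g.coeff w) : f = g :=
  NCSeries.ext (funext h)

instance : AddCommGroup (NCSeries k n) where
  add_assoc _ _ _ := ext_coeff fun _ => add_assoc _ _ _
  zero_add _ := ext_coeff fun _ => zero_add _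
  add_zero _ := ext_coeff fun _ => add_zero _
  add_comm _ _ := ext_coeff fun _ => add_comm _ _
  neg_add_cancel _ := ext_coeff fun _ => neg_add_cancel _
  sub_eq_add_neg _ _ := ext_coeff fun _ => sub_eq_add_neg _ _
  nsmul := nsmulRec
  zsmul := zsmulRec

instance : Module k (NCSeries k n) where
  one_smul _ := ext_coeff fun _ => one_mul _
  mul_smul _ _ _ := ext_coeff fun _ => mul_assoc _ _ _
  smul_zero _ := ext_coeff fun _ => mul_zero _
  smul_add _ _ _ := ext_coeff fun _ => mul_add _ _ _
  add_smul _ _ _ := ext_coeff fun _ => add_mul _ _ _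
  zero_smul _ := ext_coeff fun _ => zero_mul _

@[simp] theorem coeff_sum {ι : Type*} (s : Finset ι) (f : ι → NCSeries k n)
    (w : List (Fin n)) : (∑ i ∈ s, f i).coeff w = ∑ i ∈ s, (f i).coeff w :=
  map_sum (⟨⟨fun g : NCSeries k n => g.coeff w, rfl⟩, fun _ _ => rfl⟩ : NCSeries k n →+ k) f s

/-- The series consisting of the single word `v`. -/
def word (v : List (Fin n)) : NCSeries k n := ⟨fun w => if w = v then 1 else 0⟩

theorem coeff_word (v w : List (Fin n)) :
    (word v : NCSeries k n).coeff w = if w = v then 1 else 0 := rfl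

instance : One (NCSeries k n) := ⟨word []⟩

theorem coeff_one (w : List (Fin n)) :
    (1 : NCSeries k n).coeff w = if w = [] then 1 else 0 := rfl

/-- The product induced by concatenation of words: the coefficient of `w` in `f * g` is the sum
over all factorisations `w = w' w''` of the products of the coefficient of `w'` in `f` and that of `w''` in `g`. -/
instance : Mul (NCSeries k n) :=
  ⟨fun f g => ⟨fun w =>
    ∑ i ∈ Finset.range (w.length + 1), f.coeff (w.take i) * g.coeff (w.drop i)⟩⟩

theorem coeff_mul (f g : NCSeries k n) (w : List (Fin n)) :
    (f * g).coeff w =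
      ∑ i ∈ Finset.range (w.length + 1), f.coeff (w.take i) * g.coeff (w.drop i) := rfl

/-- `∂_i`, determined by `f = ε(f) 1 + ∑ i, x_i ∂_i(f)`. -/
def partialD (i : Fin n) (f : NCSeries k n) : NCSeries k n := ⟨fun w => f.coeff (i :: w)⟩

theorem mul_nil (f g : NCSeries k n) : (f * g).coeff [] = f.coeff [] * g.coeff [] := by
  simp [coeff_mul]

theorem mul_cons (f g : NCSeries k n) (i : Fin n) (w : List (Fin n)) :
    (f * g).coeff (i :: w) =
      f.coeff [] * g.coeff (i :: w) + (partialD i f * g).coeff w := by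
  rw [coeff_mul, List.length_cons, Finset.sum_range_succ', coeff_mul, add_comm]
  simp [partialD]

theorem partialD_mul (f g : NCSeries k n) (i : Fin n) :
    partialD i (f * g) = f.coeff [] • partialD i g + partialD i f * g := by
  refine ext_coeff fun w => ?_
  exact mul_cons f g i w

protected theorem add_mul' (f g h : NCSeries k n) : (f + g) * h = f * h + g * h := by
  refine ext_coeff fun w => ?_
  simp [coeff_mul, add_mul, Finset.sum_add_distrib]

protected theorem mul_add' (f g h : NCSeries k n) : f * (g + h) = f * g + f * h := by
  refine ext_coeff fun w => ?_
  simp [coeff_mul, mul_add, Finset.sum_add_distrib]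

protected theorem smul_mul' (c : k) (f g : NCSeries k n) : (c • f) * g = c • (f * g) := by
  refine ext_coeff fun w => ?_
  simp [coeff_mul, mul_assoc, Finset.mul_sum]

protected theorem mul_smul' (c : k) (f g : NCSeries k n) : f * (c • g) = c • (f * g) := by
  refine ext_coeff fun w => ?_
  simp [coeff_mul, mul_left_comm, Finset.mul_sum]

protected theorem zero_mul' (f : NCSeries k n) : 0 * f = 0 := by
  refine ext_coeff fun w => ?_
  simp [coeff_mul]

protected theorem mul_zero' (f : NCSeries k n) : f * 0 = 0 := by
  refine ext_coeff fun w => ?_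
  simp [coeff_mul]

protected theorem one_mul' (f : NCSeries k n) : 1 * f = f := by
  refine ext_coeff fun w => ?_
  cases w with
  | nil => simp [mul_nil, coeff_one]
  | cons i w =>
    have h : partialD i (1 : NCSeries k n) = 0 := by
      refine ext_coeff fun v => ?_
      simp [partialD, coeff_one]
    rw [mul_cons, h, NCSeries.zero_mul']
    simp [coeff_one]

protected theorem mul_one' (f : NCSeries k n) : f * 1 = f := by
  refine ext_coeff fun w => ?_
  induction w generalizing f with
  | nil => simp [mul_nil, coeff_one]
  | cons i w ih =>
    rw [mul_cons, ih]
    simp [coeff_one, partialD]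

protected theorem mul_assoc' (f g h : NCSeries k n) : f * g * h = f * (g * h) := by
  refine ext_coeff fun w => ?_
  induction w generalizing f with
  | nil => simp [mul_nil, mul_assoc]
  | cons i w ih =>
    rw [mul_cons, mul_cons, partialD_mul, NCSeries.add_mul', coeff_add, ih, mul_nil, mul_cons,
      NCSeries.smul_mul', coeff_smul]
    ring

instance : Ring (NCSeries k n) :=
  { (inferInstance : AddCommGroup (NCSeries k n)) with
    mul := (· * ·)
    one := 1
    left_distrib := NCSeries.mul_add'
    right_distrib := NCSeries.add_mul'
    zero_mul := NCSeries.zero_mul'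
    mul_zero := NCSeries.mul_zero'
    mul_assoc := NCSeries.mul_assoc'
    one_mul := NCSeries.one_mul'
    mul_one := NCSeries.mul_one' }

instance : Algebra k (NCSeries k n) :=
  Algebra.ofModule NCSeries.smul_mul' NCSeries.mul_smul'

/-- The commutator bracket `⁅f, g⁆ = f * g - g * f`. -/
instance : LieRing (NCSeries k n) := LieRing.ofAssociativeRing

/-- The generator `x_i`. -/
def X (i : Fin n) : NCSeries k n := word [i]

/-- The homogeneous component of degree `d`. -/
def comp (d : ℕ) (f : NCSeries k n) : NCSeries k n :=
  ⟨fun w => if w.length = d then f.coeff w else 0⟩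

theorem coeff_comp (d : ℕ) (f : NCSeries k n) (w : List (Fin n)) :
    (comp d f).coeff w = if w.length = d then f.coeff w else 0 := rfl

theorem comp_mul (d : ℕ) (f g : NCSeries k n) :
    comp d (f * g) = ∑ p ∈ Finset.HasAntidiagonal.antidiagonal d, comp p.1 f * comp p.2 g := by
  refine ext_coeff fun w => ?_
  rw [coeff_comp, coeff_sum]
  split_ifs with hw
  · subst hw
    rw [coeff_mul, Finset.Nat.sum_antidiagonal_eq_sum_range_succ_mk]
    refine Finset.sum_congr rfl fun i hi => ?_
    have hi' : i ≤ w.length := Nat.lt_succ_iff.mp (Finset.mem_range.mp hi)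
    rw [coeff_mul, Finset.sum_eq_single i]
    · simp [coeff_comp, hi']
    · intro j hj hne
      have hj' : j ≤ w.length := Nat.lt_succ_iff.mp (Finset.mem_range.mp hj)
      simp [coeff_comp, hj', hne]
    · intro h
      exact absurd hi h
  · symm
    refine Finset.sum_eq_zero fun p hp => ?_
    rw [coeff_mul]
    refine Finset.sum_eq_zero fun j hj => ?_
    have hj' : j ≤ w.length := Nat.lt_succ_iff.mp (Finset.mem_range.mp hj)
    have hp' := Finset.HasAntidiagonal.mem_antidiagonal.mp hp
    simp only [coeff_comp, List.length_take, List.length_drop]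
    by_cases h1 : min j w.length = p.1
    · have h2 : ¬ (w.length - j = p.2) := by omega
      simp [h2]
    · simp [h1]

/-- The substitution `r(f) = ∑ m, r_m f ^ m` of a series `f` without constant term in a
one-variable power series `r`. (As `f` has no constant term, `f ^ m` does not contribute to the
coefficients of words of length `< m`.) -/
def evalSeries (r : PowerSeries k) (f : NCSeries k n) : NCSeries k n :=
  ⟨fun w => ∑ m ∈ Finset.range (w.length + 1), PowerSeries.coeff m r * (f ^ m).coeff w⟩

/-- `e ^ f` for `f` without constant term. -/
def exp (f : NCSeries k n) : NCSeries k n :=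
  evalSeries (PowerSeries.mk fun m => ((m.factorial : k))⁻¹) f

/-- `log g = ∑_{m ≥ 1} (-1)^(m+1) (g - 1)^m / m` for `g` with constant term `1`.
(The term `m = 0` vanishes as `0⁻¹ = 0`.) -/
def log (g : NCSeries k n) : NCSeries k n :=
  evalSeries (PowerSeries.mk fun m => (-1) ^ (m + 1) * ((m : k))⁻¹) (g - 1)

end NCSeries

open NCSeries

/-! ### The completed free Lie algebra and its automorphisms -/

/-- The free Lie algebra on `x_1, …, x_n`, realised inside the free associative algebra as the
Lie subalgebra (for the commutator bracket) generated by the `x_i`. -/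
def LiePoly (k : Type*) [Field k] (n : ℕ) : LieSubalgebra k (NCSeries k n) :=
  LieSubalgebra.lieSpan k (NCSeries k n) (Set.range X)

/-- The degree completion of the free Lie algebra on `x_1, …, x_n`: the Lie algebra of the series
all of whose homogeneous components are Lie polynomials. -/
def LieSeries (k : Type*) [Field k] (n : ℕ) : LieSubalgebra k (NCSeries k n) where
  carrier := {f | ∀ d, comp d f ∈ LiePoly k n}
  add_mem' := by
    intro f g hf hg d
    have h : comp d (f + g) = comp d f + comp d g := by
      refine ext_coeff fun w => ?_
      simp only [coeff_comp, coeff_add]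
      split_ifs <;> simp
    rw [h]
    exact add_mem (hf d) (hg d)
  zero_mem' := by
    intro d
    have h : comp d (0 : NCSeries k n) = 0 := by
      refine ext_coeff fun w => ?_
      simp [coeff_comp]
    rw [h]
    exact zero_mem _
  smul_mem' := by
    intro c f hf d
    have h : comp d (c • f) = c • comp d f := by
      refine ext_coeff fun w => ?_
      simp [coeff_comp]
    rw [h]
    exact (LiePoly k n).smul_mem c (hf d)
  lie_mem' := by
    intro f g hf hg d
    have h : comp d ⁅f, g⁆ = ∑ p ∈ Finset.HasAntidiagonal.antidiagonal d, ⁅comp p.1 f, comp p.2 g⁆ := by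
      have h1 : comp d ⁅f, g⁆ = comp d (f * g) - comp d (g * f) := by
        refine ext_coeff fun w => ?_
        simp only [LieRing.of_associative_ring_bracket, coeff_comp, coeff_sub]
        split_ifs <;> simp
      rw [h1, comp_mul, comp_mul, ← Finset.Nat.sum_antidiagonal_swap (f := fun p =>
        comp p.1 g * comp p.2 f), ← Finset.sum_sub_distrib]
      rfl
    rw [h]
    exact sum_mem fun p _ => (LiePoly k n).lie_mem (hf p.1) (hg p.2)

theorem X_mem_lieSeries (k : Type*) [Field k] {n : ℕ} (i : Fin n) :
    (X i : NCSeries k n) ∈ LieSeries k n := by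
  intro d
  have h : comp d (X i : NCSeries k n) = if d = 1 then X i else 0 := by
    refine ext_coeff fun w => ?_
    by_cases hd : d = 1
    · subst hd
      simp only [coeff_comp, X, coeff_word, if_true]
      by_cases hw : w = [i]
      · simp [hw]
      · simp [hw]
    · simp only [coeff_comp, X, coeff_word, hd, if_false, coeff_zero]
      by_cases hw : w = [i]
      · subst hw
        simp [Ne.symm hd]
      · simp [hw]
  rw [h]
  split_ifs
  · exact LieSubalgebra.subset_lieSpan ⟨i, rfl⟩
  · exact zero_mem _

/-- The generator `x_i` of the completed free Lie algebra. -/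
def gen (k : Type*) [Field k] {n : ℕ} (i : Fin n) : LieSeries k n := ⟨X i, X_mem_lieSeries k i⟩

/-- Automorphisms of the completed free Lie algebra. An automorphism `α` acts on the pronipotent
group `exp (LieSeries k n) = {e ^ u}` by `α (e ^ u) = e ^ (α u)`, and this identifies `LieAut k n`
with the group of automorphisms of this pronipotent group. -/
abbrev LieAut (k : Type*) [Field k] (n : ℕ) : Type _ := LieSeries k n ≃ₗ⁅k⁆ LieSeries k n

/-- The group structure of `LieAut k n`, given by composition: `α * β = α ∘ β`. -/
instance (k : Type*) [Field k] (n : ℕ) : Group (LieAut k n) where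
  mul α β := β.trans α
  one := LieEquiv.refl
  inv α := α.symm
  mul_assoc _ _ _ := rfl
  one_mul _ := rfl
  mul_one _ := rfl
  inv_mul_cancel α := DFunLike.ext _ _ fun f => α.symm_apply_apply f

/-- `e ^ a ∼ e ^ b`: conjugacy in the group `exp (LieSeries k n)`, that is
`e ^ a = e ^ u * e ^ b * e ^ (-u)` for some Lie series `u`. -/
def GroupConj {k : Type*} [Field k] {n : ℕ} (a b : LieSeries k n) : Prop :=
  ∃ u : LieSeries k n, exp (a : NCSeries k n) =
    exp (u : NCSeries k n) * exp (b : NCSeries k n) * exp (-u : NCSeries k n)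

/-- `a ∼ b`: conjugacy of Lie series under the group `exp (LieSeries k n)`, that is
`a = e ^ u * b * e ^ (-u)` for some Lie series `u`. -/
def LieConj {k : Type*} [Field k] {n : ℕ} (a b : LieSeries k n) : Prop :=
  ∃ u : LieSeries k n, (a : NCSeries k n) =
    exp (u : NCSeries k n) * (b : NCSeries k n) * exp (-u : NCSeries k n)

/-! ### Cyclic words -/

/-- The closure of the space of commutators: the series all of whose homogeneous components are
linear combinations of commutators of words. -/
def commutators (k : Type*) [Field k] (n : ℕ) : Submodule k (NCSeries k n) where
  carrier := {f | ∀ d, comp d f ∈ Submodule.span k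
    (Set.range fun p : List (Fin n) × List (Fin n) =>
      (word (p.1 ++ p.2) - word (p.2 ++ p.1) : NCSeries k n))}
  add_mem' := by
    intro f g hf hg d
    have h : comp d (f + g) = comp d f + comp d g := by
      refine ext_coeff fun w => ?_
      simp only [coeff_comp, coeff_add]
      split_ifs <;> simp
    rw [h]
    exact add_mem (hf d) (hg d)
  zero_mem' := by
    intro d
    have h : comp d (0 : NCSeries k n) = 0 := by
      refine ext_coeff fun w => ?_
      simp [coeff_comp]
    rw [h]
    exact zero_mem _
  smul_mem' := by
    intro c f hf d
    have h : comp d (c • f) = c • comp d f := by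
      refine ext_coeff fun w => ?_
      simp [coeff_comp]
    rw [h]
    exact Submodule.smul_mem _ c (hf d)

/-- The degree completion of `A_n / [A_n, A_n]`, where `A_n` is the free associative algebra:
formal series of cyclic words. -/
abbrev CyclicSeries (k : Type*) [Field k] (n : ℕ) : Type _ := NCSeries k n ⧸ commutators k n

/-- The projection `f ↦ ⟨f⟩` from series in words to series in cyclic words. -/
def cyc {k : Type*} [Field k] {n : ℕ} (f : NCSeries k n) : CyclicSeries k n :=
  (commutators k n).mkQ f

/-! ### Tangential derivations, divergence and Jacobian -/

/-- The value on the word `w = x_{i_1} ⋯ x_{i_m}` of the derivation of the associative algebra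
with `x_i ↦ [u_i, x_i]`, namely `∑ j, x_{i_1} ⋯ [u_{i_j}, x_{i_j}] ⋯ x_{i_m}`. -/
def tanDerWord {k : Type*} [Field k] {n : ℕ} (u : Fin n → LieSeries k n) :
    List (Fin n) → NCSeries k n
  | [] => 0
  | i :: v => ⁅(u i : NCSeries k n), X i⁆ * word v + X i * tanDerWord u v

/-- The tangential derivation `⟦u_1, …, u_n⟧`: the continuous derivation with `x_i ↦ [u_i, x_i]`,
on the completed free associative algebra (and hence, by restriction, on the completed free Lie
algebra). As the value on a word of length `d` only involves words of length `≥ d`, the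
coefficient of `w` in the image of `f` is a sum over words `v` of length at most that of `w`. -/
def tanDer {k : Type*} [Field k] {n : ℕ} (u : Fin n → LieSeries k n) :
    NCSeries k n →ₗ[k] NCSeries k n where
  toFun f := ⟨fun w => ∑ d ∈ Finset.range (w.length + 1), ∑ v : Fin d → Fin n,
    f.coeff (List.ofFn v) * (tanDerWord u (List.ofFn v)).coeff w⟩
  map_add' f g := by
    refine ext_coeff fun w => ?_
    simp [add_mul, Finset.sum_add_distrib]
  map_smul' c f := by
    refine ext_coeff fun w => ?_
    simp [mul_assoc, Finset.mul_sum]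

/-- The normalisation `p_i(u_i) = 0` which makes `(u_1, …, u_n)` unique among the tuples that
represent a given tangential derivation: `u_i` has no linear term in `x_i`. -/
def Normalized {k : Type*} [Field k] {n : ℕ} (u : Fin n → LieSeries k n) : Prop :=
  ∀ i, (u i : NCSeries k n).coeff [i] = 0

/-- A series representing the divergence `j(⟦u_1, …, u_n⟧) = ⟨∑ i, x_i ∂_i(u_i)⟩`
(for normalised `u`). -/
def divergence {k : Type*} [Field k] {n : ℕ} (u : Fin n → LieSeries k n) : NCSeries k n :=
  ∑ i, X i * partialD i (u i : NCSeries k n)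

/-- The operator `∑ m, c_m D ^ m` on series, for a linear operator `D` which strictly raises the
degree (so that `D ^ m f` does not contribute to the coefficients of words of length `< m`). -/
def evalOp {k : Type*} [Field k] {n : ℕ} (c : ℕ → k) (D : Module.End k (NCSeries k n))
    (f : NCSeries k n) : NCSeries k n :=
  ⟨fun w => ∑ m ∈ Finset.range (w.length + 1), c m * ((D ^ m) f).coeff w⟩

/-- `α = exp ⟦u_1, …, u_n⟧`. -/
def IsExpOf {k : Type*} [Field k] {n : ℕ} (α : LieAut k n) (u : Fin n → LieSeries k n) : Prop :=
  ∀ f : LieSeries k n, (α f : NCSeries k n) =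
    evalOp (fun m => ((m.factorial : k))⁻¹) (tanDer u) (f : NCSeries k n)

open Classical in
/-- The Jacobian `J` of a tangential automorphism, that is the group cocycle integrating the Lie
algebra cocycle `j`: `J (id) = 0` and `d/dt J (e^(t D) g) = j (D) + D · J (g)` at `t = 0`.
By the exponential, tangential automorphisms are in bijection with tangential derivations, and
for `g = e ^ D` integrating this equation along `t ↦ e ^ (t D)` gives
`J (e ^ D) = ((e ^ D - 1) / D) · j (D) = ∑ m, D ^ m · j (D) / (m + 1)!`,
which is the formula used here. (The value at automorphisms which are not tangential is
irrelevant.) -/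
def jacobian {k : Type*} [Field k] {n : ℕ} (α : LieAut k n) : CyclicSeries k n :=
  if h : ∃ u : Fin n → LieSeries k n, Normalized u ∧ IsExpOf α u then
    cyc (evalOp (fun m => (((m + 1).factorial : k))⁻¹) (tanDer h.choose) (divergence h.choose))
  else 0

/-! ### The Kashiwara–Vergne sets

The pronipotent completion `F_2(k)` of the free group on `X`, `Y` is identified with the group
`exp (LieSeries k 2)` through `X = e ^ x`, `Y = e ^ y`; hence the isomorphisms from `F_2(k)` to
`exp (LieSeries k 2)` and the automorphisms of `F_2(k)` are given by elements of `LieAut k 2`. -/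

/-- The generator `x` of the completed free Lie algebra on two generators. -/
abbrev x (k : Type*) [Field k] : LieSeries k 2 := gen k 0

/-- The generator `y` of the completed free Lie algebra on two generators. -/
abbrev y (k : Type*) [Field k] : LieSeries k 2 := gen k 1

/-- `⟨r(x + y) - r(x) - r(y)⟩`. -/
def delta {k : Type*} [Field k] (r : PowerSeries k) : CyclicSeries k 2 :=
  cyc (evalSeries r (X 0 + X 1) - evalSeries r (X 0) - evalSeries r (X 1))

/-- `⟨r(log (e ^ x e ^ y)) - r(x) - r(y)⟩`. -/
def deltaTilde {k : Type*} [Field k] (r : PowerSeries k) : CyclicSeries k 2 :=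
  cyc (evalSeries r (log (exp (X 0) * exp (X 1))) - evalSeries r (X 0) - evalSeries r (X 1))

/-- The Duflo series condition for solutions of the Kashiwara–Vergne equations and for `KRV`:
`r ∈ u² k[[u]]` and `J (μ) = ⟨r(x + y) - r(x) - r(y)⟩`. -/
def IsDuf {k : Type*} [Field k] (μ : LieAut k 2) (r : PowerSeries k) : Prop :=
  PowerSeries.X ^ 2 ∣ r ∧ jacobian μ = delta r

/-- The Duflo series condition for `KV`:
`σ ∈ u² k[[u]]` and `J (α) = ⟨σ(log (e ^ x e ^ y)) - σ(x) - σ(y)⟩`. -/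
def IsDufTilde {k : Type*} [Field k] (α : LieAut k 2) (σ : PowerSeries k) : Prop :=
  PowerSeries.X ^ 2 ∣ σ ∧ jacobian α = deltaTilde σ

/-- The set of solutions of the Kashiwara–Vergne equations:
`μ(X) ∼ e ^ x`, `μ(Y) ∼ e ^ y`, `μ(X Y) = e ^ (x + y)` and the Jacobian condition. -/
def SolKV (k : Type*) [Field k] : Set (LieAut k 2) :=
  {μ | GroupConj (μ (x k)) (x k) ∧ GroupConj (μ (y k)) (y k) ∧
    exp (μ (x k) : NCSeries k 2) * exp (μ (y k) : NCSeries k 2) = exp (X 0 + X 1) ∧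
    ∃ r, IsDuf μ r}

/-- The set `KV(k)`: `α(X) ∼ X`, `α(Y) ∼ Y`, `α(X Y) = X Y` and the Jacobian condition. -/
def KV (k : Type*) [Field k] : Set (LieAut k 2) :=
  {α | GroupConj (α (x k)) (x k) ∧ GroupConj (α (y k)) (y k) ∧
    exp (α (x k) : NCSeries k 2) * exp (α (y k) : NCSeries k 2) = exp (X 0) * exp (X 1) ∧
    ∃ σ, IsDufTilde α σ}

/-- The set `KRV(k)`: `a(x) ∼ x`, `a(y) ∼ y`, `a(x + y) = x + y` and the Jacobian condition. -/
def KRV (k : Type*) [Field k] : Set (LieAut k 2) :=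
  {a | LieConj (a (x k)) (x k) ∧ LieConj (a (y k)) (y k) ∧ a (x k + y k) = x k + y k ∧
    ∃ s, IsDuf a s}

open Classical in
/-- The Duflo series of an element of `SolKV k` or of `KRV k`. -/
def Duf {k : Type*} [Field k] (μ : LieAut k 2) : PowerSeries k :=
  if h : ∃ r, IsDuf μ r then h.choose else 0

open Classical in
/-- The Duflo series of an element of `KV k`. -/
def DufTilde {k : Type*} [Field k] (α : LieAut k 2) : PowerSeries k :=
  if h : ∃ σ, IsDufTilde α σ then h.choose else 0

end

end KashiwaraVergne

/-! Call a pair (α, r) an arrow f → g if α is a tangential automorphism with α f = g, X² divides r,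
and J(α) = ⟨r(g) - r(x) - r(y)⟩ (`IsSolution`). KV and KRV are the arrows from log(e^x e^y) to
itself and from x + y to itself, and SolKV consists of the arrows from the first object to the
second. Once arrows compose and invert, with r additive, the groups, the commuting free and
transitive actions and the Duflo formulas are formal properties of a groupoid (`IsSolution.mul`,
`IsSolution.inv`).

Composition rests on two facts. First, α⟨s(f)⟩ = ⟨s(α f)⟩, while ⟨s(x)⟩ and ⟨s(y)⟩ are fixed because
α x and α y are conjugate to x and y (`hat_deltaRep_sub_mem`). Second, J(αβ) = J(α) + α·J(β). This
is the main work, since J is defined by the formula ((e^D - 1)/D)·j(D). It is obtained by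
identifying J(α) with the class of Tr log of the matrix (∂_j(α x_i)), corrected by a linear term
(`jacobian_eq_cyc_jacRep`). The chain rule makes the matrix multiplicative up to the action of α,
and Tr log turns products into sums modulo commutators (`trLog_mul`).

Differentiation in t along e^(tD) is replaced by algebra: coefficients of α^N are polynomials in N,
and the linear coefficient in N plays the role of the derivative at 0 (`HasJet`). In characteristic
0 a polynomial is determined by its values at natural numbers, so identities valid for all N pass to
linear coefficients. A cocycle along the powers of α is thereby determined by its derivative
(`IsGraded.cocycle_mem`); the same principle shows that the logarithm of a tangential automorphism
is a tangential derivation (`exists_tanLog_X`).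

Two preliminaries are needed. Automorphisms of the completed Lie algebra are not assumed continuous,
but they are (`LieAut.map_mem_filt`), and so extend to noncommutative series. Exponentials of Lie
series form a group (`exists_exp_eq_mul`), proved with the degree derivation. Finally, r is unique
because the lowest term of ⟨r(f) - r(x) - r(y)⟩ is detected by counting cyclically invariant words
with a single y (`eq_zero_of_deltaRep_mem`). -/

namespace KashiwaraVergne

noncomputable section

open NCSeries

/-! ### The degree filtration -/

section Filtration

variable {k : Type*} [Field k] {n : ℕ}

/-- The series supported on words of length at least `m`. -/
def filt (k : Type*) [Field k] (n m : ℕ) : Submodule k (NCSeries k n) where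
  carrier := {f | ∀ w : List (Fin n), w.length < m → f.coeff w = 0}
  add_mem' hf hg w hw := by simp [hf w hw, hg w hw]
  zero_mem' _ _ := rfl
  smul_mem' c f hf w hw := by simp [hf w hw]

theorem filt_anti {a b : ℕ} (h : a ≤ b) : filt k n b ≤ filt k n a :=
  fun _ hf w hw => hf w (hw.trans_le h)

theorem mem_filt_zero (f : NCSeries k n) : f ∈ filt k n 0 := fun _ hw => absurd hw (Nat.not_lt_zero _)

theorem mem_filt_one {f : NCSeries k n} : f ∈ filt k n 1 ↔ f.coeff [] = 0 := by
  refine ⟨fun h => h [] (by simp), fun h w hw => ?_⟩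
  rw [List.length_eq_zero_iff.mp (Nat.lt_one_iff.mp hw)]
  exact h

theorem eq_zero_of_forall_mem_filt {f : NCSeries k n} (h : ∀ m, f ∈ filt k n m) : f = 0 :=
  ext_coeff fun w => h (w.length + 1) w (Nat.lt_succ_self _)

theorem eq_of_forall_sub_mem_filt {f g : NCSeries k n} (h : ∀ m, f - g ∈ filt k n m) : f = g :=
  sub_eq_zero.mp (eq_zero_of_forall_mem_filt h)

theorem mul_mem_filt {a b : ℕ} {f g : NCSeries k n} (hf : f ∈ filt k n a) (hg : g ∈ filt k n b) :
    f * g ∈ filt k n (a + b) := by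
  intro w hw
  rw [coeff_mul]
  refine Finset.sum_eq_zero fun i hi => ?_
  have hi' := Finset.mem_range.mp hi
  by_cases h : i < a
  · rw [hf _ (by rw [List.length_take]; omega), zero_mul]
  · rw [hg _ (by rw [List.length_drop]; omega), mul_zero]

theorem mul_mem_filt_left {b : ℕ} (f : NCSeries k n) {g : NCSeries k n} (hg : g ∈ filt k n b) :
    f * g ∈ filt k n b := by
  simpa using mul_mem_filt (mem_filt_zero f) hg

theorem mul_mem_filt_right {b : ℕ} {f : NCSeries k n} (g : NCSeries k n) (hf : f ∈ filt k n b) :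
    f * g ∈ filt k n b := by
  simpa using mul_mem_filt hf (mem_filt_zero g)

theorem lie_mem_filt {a b : ℕ} {f g : NCSeries k n} (hf : f ∈ filt k n a) (hg : g ∈ filt k n b) :
    ⁅f, g⁆ ∈ filt k n (a + b) := by
  rw [LieRing.of_associative_ring_bracket]
  exact sub_mem (mul_mem_filt hf hg) (add_comm b a ▸ mul_mem_filt hg hf)

theorem pow_mem_filt {f : NCSeries k n} (hf : f ∈ filt k n 1) (m : ℕ) : f ^ m ∈ filt k n m := by
  induction m with
  | zero => exact mem_filt_zero _
  | succ m ih => rw [pow_succ]; exact mul_mem_filt ih hf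

theorem word_mem_filt (v : List (Fin n)) : (word v : NCSeries k n) ∈ filt k n v.length := by
  intro w hw
  rw [coeff_word, if_neg]
  rintro rfl
  exact lt_irrefl _ hw

theorem X_mem_filt (i : Fin n) : (X i : NCSeries k n) ∈ filt k n 1 := word_mem_filt [i]

theorem one_eq_word : (1 : NCSeries k n) = word [] := rfl

theorem coeff_X_mul (i j : Fin n) (f : NCSeries k n) (w : List (Fin n)) :
    (X i * f).coeff (j :: w) = if j = i then f.coeff w else 0 := by
  rw [mul_cons]
  have h : partialD j (X i : NCSeries k n) = if j = i then 1 else 0 := by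
    refine ext_coeff fun v => ?_
    by_cases hji : j = i <;> simp [partialD, X, coeff_word, hji, coeff_one]
  rw [h]
  by_cases hji : j = i <;> simp [hji, X, coeff_word]

theorem coeff_X_mul_nil (i : Fin n) (f : NCSeries k n) : (X i * f).coeff [] = 0 := by
  simp [mul_nil, X, coeff_word]

theorem word_cons (i : Fin n) (v : List (Fin n)) :
    (word (i :: v) : NCSeries k n) = X i * word v := by
  refine ext_coeff fun w => ?_
  cases w with
  | nil => simp [coeff_X_mul_nil, coeff_word]
  | cons j w => rw [coeff_X_mul]; by_cases h : j = i <;> simp [coeff_word, h]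

theorem word_append (v w : List (Fin n)) :
    (word (v ++ w) : NCSeries k n) = word v * word w := by
  induction v with
  | nil => simp [← one_eq_word]
  | cons i v ih => rw [List.cons_append, word_cons, word_cons, ih, mul_assoc]

@[simp] theorem comp_add (d : ℕ) (f g : NCSeries k n) : comp d (f + g) = comp d f + comp d g := by
  refine ext_coeff fun w => ?_
  simp only [coeff_comp, coeff_add]
  split_ifs <;> simp

@[simp] theorem comp_smul (d : ℕ) (c : k) (f : NCSeries k n) : comp d (c • f) = c • comp d f := by
  refine ext_coeff fun w => ?_
  simp [coeff_comp]

/-- `comp d` as a linear map. -/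
def compL (k : Type*) [Field k] (n d : ℕ) : NCSeries k n →ₗ[k] NCSeries k n where
  toFun := comp d
  map_add' := comp_add d
  map_smul' := comp_smul d

theorem comp_sub (d : ℕ) (f g : NCSeries k n) : comp d (f - g) = comp d f - comp d g :=
  map_sub (compL k n d) f g

theorem comp_zero (d : ℕ) : comp d (0 : NCSeries k n) = 0 := map_zero (compL k n d)

theorem comp_comp (d e : ℕ) (f : NCSeries k n) :
    comp d (comp e f) = if d = e then comp d f else 0 := by
  refine ext_coeff fun w => ?_
  by_cases h : d = e
  · subst h; by_cases hw : w.length = d <;> simp [coeff_comp, hw]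
  · simp only [coeff_comp, h, if_false, coeff_zero, ite_eq_right_iff]
    rintro rfl h'
    exact absurd h' h

theorem comp_eq_zero {d m : ℕ} (h : d < m) {f : NCSeries k n} (hf : f ∈ filt k n m) :
    comp d f = 0 := by
  refine ext_coeff fun w => ?_
  rw [coeff_comp, coeff_zero]
  split_ifs with hw
  · exact hf w (hw ▸ h)
  · rfl

theorem comp_eq_of_sub_mem {d m : ℕ} (h : d < m) {f g : NCSeries k n} (hf : f - g ∈ filt k n m) :
    comp d f = comp d g := by
  have := comp_eq_zero h hf
  rwa [comp_sub, sub_eq_zero] at this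

theorem ext_comp {f g : NCSeries k n} (h : ∀ d, comp d f = comp d g) : f = g :=
  ext_coeff fun w => by
    have := congrArg (fun f => f.coeff w) (h w.length)
    simpa [coeff_comp] using this

theorem comp_eq_sum (d : ℕ) (f : NCSeries k n) :
    comp d f = ∑ v : Fin d → Fin n, f.coeff (List.ofFn v) • word (List.ofFn v) := by
  refine ext_coeff fun w => ?_
  rw [coeff_comp, coeff_sum]
  split_ifs with h
  · subst h
    rw [Finset.sum_eq_single w.get]
    · simp [coeff_word]
    · intro v _ hv
      rw [coeff_smul, coeff_word, if_neg, mul_zero]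
      intro hw
      apply hv
      apply List.ofFn_injective
      rw [← hw, List.ofFn_get]
    · simp
  · symm
    refine Finset.sum_eq_zero fun v _ => ?_
    rw [coeff_smul, coeff_word, if_neg, mul_zero]
    rintro rfl
    simp at h

theorem sub_sum_comp_mem_filt (M : ℕ) (f : NCSeries k n) :
    f - ∑ d ∈ Finset.range M, comp d f ∈ filt k n M := by
  intro w hw
  rw [coeff_sub, coeff_sum, Finset.sum_eq_single w.length]
  · simp [coeff_comp]
  · intro b _ hb
    rw [coeff_comp, if_neg (Ne.symm hb)]
  · intro h
    exact absurd (Finset.mem_range.mpr hw) h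

/-- A linear map that does not lower the degree. -/
def Filtered (Φ : NCSeries k n →ₗ[k] NCSeries k n) : Prop :=
  ∀ m, ∀ f ∈ filt k n m, Φ f ∈ filt k n m

/-- A linear map that strictly raises the degree. -/
def Raising (D : NCSeries k n →ₗ[k] NCSeries k n) : Prop :=
  ∀ m, ∀ f ∈ filt k n m, D f ∈ filt k n (m + 1)

theorem Raising.filtered {D : NCSeries k n →ₗ[k] NCSeries k n} (hD : Raising D) : Filtered D :=
  fun m f hf => filt_anti (Nat.le_succ m) (hD m f hf)

theorem Raising.pow_mem {D : Module.End k (NCSeries k n)} (hD : Raising D) (m a : ℕ)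
    {f : NCSeries k n} (hf : f ∈ filt k n a) : (D ^ m) f ∈ filt k n (a + m) := by
  induction m with
  | zero => exact hf
  | succ m ih =>
    rw [pow_succ', Module.End.mul_apply]
    exact hD _ _ ih

theorem Filtered.comp {Φ Ψ : NCSeries k n →ₗ[k] NCSeries k n} (hΦ : Filtered Φ)
    (hΨ : Filtered Ψ) : Filtered (Φ ∘ₗ Ψ) := fun m f hf => hΦ m _ (hΨ m f hf)

theorem Filtered.sub {Φ Ψ : NCSeries k n →ₗ[k] NCSeries k n} (hΦ : Filtered Φ)
    (hΨ : Filtered Ψ) : Filtered (Φ - Ψ) := fun m f hf => sub_mem (hΦ m f hf) (hΨ m f hf)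

theorem filtered_mulLeft (f : NCSeries k n) : Filtered (LinearMap.mulLeft k f) :=
  fun _ _ hg => mul_mem_filt_left f hg

theorem filtered_mulRight (f : NCSeries k n) : Filtered (LinearMap.mulRight k f) :=
  fun _ _ hg => mul_mem_filt_right f hg

theorem raising_mulLeft {f : NCSeries k n} (hf : f ∈ filt k n 1) :
    Raising (LinearMap.mulLeft k f) := fun m _ hg => add_comm 1 m ▸ mul_mem_filt hf hg

theorem Filtered.sub_mem {Φ : NCSeries k n →ₗ[k] NCSeries k n} (hΦ : Filtered Φ) {m : ℕ}
    {f g : NCSeries k n} (h : f - g ∈ filt k n m) : Φ f - Φ g ∈ filt k n m := by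
  rw [← map_sub]; exact hΦ m _ h

/-- Finite combinations of words are dense and filtered maps are continuous for the degree topology.
-/
theorem filtered_ext {Φ Ψ : NCSeries k n →ₗ[k] NCSeries k n} (hΦ : Filtered Φ)
    (hΨ : Filtered Ψ) (h : ∀ v, Φ (word v) = Ψ (word v)) : Φ = Ψ := by
  have hc : ∀ d f, Φ (NCSeries.comp d f) = Ψ (NCSeries.comp d f) := by
    intro d f
    rw [comp_eq_sum, map_sum, map_sum]
    simp only [map_smul, h]
  refine LinearMap.ext fun f => eq_of_forall_sub_mem_filt fun m => ?_
  have h1 := (hΦ.sub hΨ) m _ (sub_sum_comp_mem_filt m f)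
  rw [map_sub, map_sum, Finset.sum_eq_zero (fun d _ => by simp [hc]), sub_zero] at h1
  exact h1

/-- A filtered linear map which is multiplicative on words is multiplicative. -/
theorem Filtered.map_mul_of_word {Φ : NCSeries k n →ₗ[k] NCSeries k n} (hΦ : Filtered Φ)
    (h : ∀ v w, Φ (word (v ++ w)) = Φ (word v) * Φ (word w)) (f g : NCSeries k n) :
    Φ (f * g) = Φ f * Φ g := by
  have h1 : ∀ v g, Φ (word v * g) = Φ (word v) * Φ g := fun v =>
    LinearMap.congr_fun (filtered_ext (hΦ.comp (filtered_mulLeft (word v)))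
      ((filtered_mulLeft (Φ (word v))).comp hΦ) fun w => by
        simpa [word_append] using h v w)
  exact LinearMap.congr_fun (filtered_ext (hΦ.comp (filtered_mulRight g))
      ((filtered_mulRight (Φ g)).comp hΦ) fun v => by simpa using h1 v g) f

/-- The continuous linear extension of a map defined on words. -/
def wordExt (b : List (Fin n) → NCSeries k n) : NCSeries k n →ₗ[k] NCSeries k n where
  toFun f := ⟨fun w => ∑ d ∈ Finset.range (w.length + 1), ∑ v : Fin d → Fin n,
    f.coeff (List.ofFn v) * (b (List.ofFn v)).coeff w⟩
  map_add' f g := by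
    refine ext_coeff fun w => ?_
    simp [add_mul, Finset.sum_add_distrib]
  map_smul' c f := by
    refine ext_coeff fun w => ?_
    simp [mul_assoc, Finset.mul_sum]

theorem coeff_wordExt (b : List (Fin n) → NCSeries k n) (f : NCSeries k n) (w : List (Fin n)) :
    (wordExt b f).coeff w = ∑ d ∈ Finset.range (w.length + 1), ∑ v : Fin d → Fin n,
      f.coeff (List.ofFn v) * (b (List.ofFn v)).coeff w := rfl

theorem wordExt_filtered (b : List (Fin n) → NCSeries k n) : Filtered (wordExt b) := by
  intro m f hf w hw
  rw [coeff_wordExt]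
  refine Finset.sum_eq_zero fun d hd => Finset.sum_eq_zero fun v _ => ?_
  rw [hf _ (by have := Finset.mem_range.mp hd; simp; omega), zero_mul]

/-- The sum defining `wordExt` stops at the length of the word whose coefficient is read; the
hypothesis says that nothing of `b v` is cut off. -/
theorem wordExt_word {b : List (Fin n) → NCSeries k n} {v : List (Fin n)}
    (hb : b v ∈ filt k n v.length) : wordExt b (word v) = b v := by
  refine ext_coeff fun w => ?_
  rw [coeff_wordExt]
  have key : ∀ d, (∑ u : Fin d → Fin n, (word v : NCSeries k n).coeff (List.ofFn u) *
      (b (List.ofFn u)).coeff w) = if d = v.length then (b v).coeff w else 0 := by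
    intro d
    split_ifs with h
    · subst h
      rw [Finset.sum_eq_single v.get]
      · simp [coeff_word]
      · intro u _ hu
        rw [coeff_word, if_neg, zero_mul]
        intro hw
        apply hu
        apply List.ofFn_injective
        rw [hw, List.ofFn_get]
      · simp
    · refine Finset.sum_eq_zero fun u _ => ?_
      rw [coeff_word, if_neg, zero_mul]
      rintro rfl
      simp at h
  simp only [key, Finset.sum_ite_eq', Finset.mem_range]
  split_ifs with h
  · rfl
  · exact (hb w (by omega)).symm

end Filtration

/-! ### Power series in an operator -/

section EvalOp

variable {k : Type*} [Field k] {n : ℕ}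

/-- `evalOp` as a linear map. -/
def evalOpL (c : ℕ → k) (D : Module.End k (NCSeries k n)) : Module.End k (NCSeries k n) where
  toFun := evalOp c D
  map_add' f g := ext_coeff fun w => by simp [evalOp, mul_add, Finset.sum_add_distrib]
  map_smul' a f := ext_coeff fun w => by simp [evalOp, Finset.mul_sum, mul_left_comm]

theorem evalOpL_apply (c : ℕ → k) (D : Module.End k (NCSeries k n)) (f : NCSeries k n) :
    evalOpL c D f = evalOp c D f := rfl

theorem coeff_evalOp (c : ℕ → k) (D : Module.End k (NCSeries k n)) (f : NCSeries k n)
    (w : List (Fin n)) : (evalOp c D f).coeff w =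
      ∑ m ∈ Finset.range (w.length + 1), c m * ((D ^ m) f).coeff w := rfl

/-- Since D raises degree, the powers from `M` on contribute nothing in degrees below `M`. This is
the convergence statement behind all truncation arguments. -/
theorem evalOp_sub_sum_mem {D : Module.End k (NCSeries k n)} (hD : Raising D) (c : ℕ → k)
    (f : NCSeries k n) (M : ℕ) :
    evalOp c D f - ∑ m ∈ Finset.range M, c m • (D ^ m) f ∈ filt k n M := by
  intro w hw
  rw [coeff_sub, coeff_sum, coeff_evalOp, sub_eq_zero]
  simp only [coeff_smul]
  refine Finset.sum_subset (fun a ha => ?_) fun m _ hm => ?_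
  · rw [Finset.mem_range] at *; omega
  · rw [hD.pow_mem m 0 (mem_filt_zero f) w (by rw [Finset.mem_range] at hm; omega), mul_zero]

theorem filtered_evalOpL {D : Module.End k (NCSeries k n)} (hD : Raising D) (c : ℕ → k) :
    Filtered (evalOpL c D) := by
  intro a f hf w hw
  rw [evalOpL_apply, coeff_evalOp]
  refine Finset.sum_eq_zero fun m _ => ?_
  rw [hD.pow_mem m a hf w (by omega), mul_zero]

theorem evalOpL_mul {D : Module.End k (NCSeries k n)} (hD : Raising D) (r s : PowerSeries k) :
    evalOpL (fun m => PowerSeries.coeff m (r * s)) D =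
      evalOpL (fun m => PowerSeries.coeff m r) D * evalOpL (fun m => PowerSeries.coeff m s) D := by
  refine LinearMap.ext fun f => ext_coeff fun w => ?_
  set M := w.length + 1 with hM
  have h1 := filtered_evalOpL hD (fun m => PowerSeries.coeff m r) M _
    (evalOp_sub_sum_mem hD (fun m => PowerSeries.coeff m s) f M)
  have h1' := h1 w (Nat.lt_succ_self _)
  rw [map_sub, coeff_sub, sub_eq_zero] at h1'
  rw [Module.End.mul_apply, evalOpL_apply _ _ f, evalOpL_apply _ _ f, h1', map_sum, coeff_sum,
    coeff_evalOp]
  have e0 : ∀ i, (evalOpL (fun m => PowerSeries.coeff m r) D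
      (PowerSeries.coeff i s • (D ^ i) f)).coeff w =
      ∑ x ∈ Finset.range (w.length + 1), (PowerSeries.coeff i) s *
        ((PowerSeries.coeff x) r * ((D ^ (x + i)) f).coeff w) := by
    intro i
    rw [map_smul, coeff_smul, evalOpL_apply, coeff_evalOp, Finset.mul_sum]
    simp only [pow_add, Module.End.mul_apply]
  simp only [e0, PowerSeries.coeff_mul, Finset.sum_mul]
  -- Terms with x + i greater than the length of `w` vanish, so the square of indices shrinks to a
  -- triangle, which is then reindexed by antidiagonals.
  have e1 : ∀ i ∈ Finset.range M,
      (∑ x ∈ Finset.range (w.length + 1), (PowerSeries.coeff i) s *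
        ((PowerSeries.coeff x) r * ((D ^ (x + i)) f).coeff w)) =
      ∑ x ∈ Finset.range (M - i), (PowerSeries.coeff x) r * (PowerSeries.coeff i) s *
        ((D ^ (x + i)) f).coeff w := by
    intro i hi
    symm
    refine Finset.sum_subset_zero_on_sdiff (fun a ha => ?_) (fun x hx => ?_) (fun x _ => by ring)
    · rw [Finset.mem_range] at *; omega
    · rw [Finset.mem_sdiff, Finset.mem_range, Finset.mem_range] at hx
      rw [hD.pow_mem _ 0 (mem_filt_zero f) w (by omega), mul_zero, mul_zero]
  rw [Finset.sum_congr rfl e1]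
  have e2 := Finset.sum_sigma' (Finset.range M) (fun i => Finset.range (M - i))
    (fun i x => (PowerSeries.coeff x) r * (PowerSeries.coeff i) s * ((D ^ (x + i)) f).coeff w)
  rw [e2, Finset.sum_sigma']
  refine Finset.sum_nbij' (fun p => ⟨p.2.2, p.2.1⟩) (fun p => ⟨p.1 + p.2, (p.2, p.1)⟩) ?_ ?_ ?_ ?_ ?_
  · rintro ⟨a, b, c⟩ h
    simp at h ⊢; omega
  · rintro ⟨a, b⟩ h
    simp at h ⊢; omega
  · rintro ⟨a, b, c⟩ h
    simp at h ⊢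
    rw [← h.2]; simp [add_comm]
  · rintro ⟨a, b⟩ h
    simp
  · rintro ⟨a, b, c⟩ h
    rw [← Finset.HasAntidiagonal.mem_antidiagonal.mp (Finset.mem_sigma.mp h).2]

/-- Substitution of a degree raising operator into power series. -/
def ev {D : Module.End k (NCSeries k n)} (hD : Raising D) :
    PowerSeries k →ₐ[k] Module.End k (NCSeries k n) :=
  AlgHom.ofLinearMap
    { toFun := fun r => evalOpL (fun m => PowerSeries.coeff m r) D
      map_add' := fun r s => LinearMap.ext fun f => ext_coeff fun w => by
        simp [evalOpL_apply, coeff_evalOp, add_mul, Finset.sum_add_distrib]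
      map_smul' := fun a r => LinearMap.ext fun f => ext_coeff fun w => by
        simp [evalOpL_apply, coeff_evalOp, mul_assoc, Finset.mul_sum] }
    (LinearMap.ext fun f => ext_coeff fun w => by
      simp [evalOpL_apply, coeff_evalOp, PowerSeries.coeff_one])
    (evalOpL_mul hD)

theorem ev_apply {D : Module.End k (NCSeries k n)} (hD : Raising D) (r : PowerSeries k)
    (f : NCSeries k n) : ev hD r f = evalOp (fun m => PowerSeries.coeff m r) D f := rfl

theorem evalOp_eq_ev {D : Module.End k (NCSeries k n)} (hD : Raising D) (c : ℕ → k)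
    (f : NCSeries k n) : evalOp c D f = ev hD (PowerSeries.mk c) f := by
  rw [ev_apply]; simp

theorem ev_X {D : Module.End k (NCSeries k n)} (hD : Raising D) : ev hD PowerSeries.X = D := by
  refine LinearMap.ext fun f => ext_coeff fun w => ?_
  rw [ev_apply, coeff_evalOp]
  simp only [PowerSeries.coeff_X, ite_mul, one_mul, zero_mul, Finset.sum_ite_eq', pow_one,
    Finset.mem_range, Nat.lt_add_left_iff_pos]
  split_ifs with h
  · rfl
  · exact (hD 0 f (mem_filt_zero f) w (by omega)).symm

theorem ev_coe {D : Module.End k (NCSeries k n)} (hD : Raising D) (p : Polynomial k) :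
    ev hD (p : PowerSeries k) = Polynomial.aeval D p := by
  have : (ev hD).comp (Polynomial.coeToPowerSeries.algHom k) = Polynomial.aeval D := by
    refine Polynomial.algHom_ext ?_
    simp [ev_X]
  have h := DFunLike.congr_fun this p
  simpa using h

theorem ev_filtered {D : Module.End k (NCSeries k n)} (hD : Raising D) (r : PowerSeries k) :
    Filtered (ev hD r) := filtered_evalOpL hD _

theorem ev_mem_of_dvd {D : Module.End k (NCSeries k n)} (hD : Raising D) {r : PowerSeries k}
    {M : ℕ} (h : PowerSeries.X ^ M ∣ r) {a : ℕ} {f : NCSeries k n} (hf : f ∈ filt k n a) :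
    ev hD r f ∈ filt k n (a + M) := by
  obtain ⟨s, rfl⟩ := h
  rw [mul_comm, map_mul, Module.End.mul_apply]
  apply ev_filtered
  rw [map_pow, ev_X]
  exact hD.pow_mem M a hf

theorem ev_raising {D : Module.End k (NCSeries k n)} (hD : Raising D) {r : PowerSeries k}
    (h : PowerSeries.constantCoeff r = 0) : Raising (ev hD r) := fun m f hf =>
  ev_mem_of_dvd hD (by rw [pow_one]; exact PowerSeries.X_dvd_iff.mpr h) hf

/-- For polynomials this is functoriality of `aeval`. Writing r as its truncation plus X^M q, both
remainders raise degree by M because s has no constant term. -/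
theorem ev_subst {D : Module.End k (NCSeries k n)} (hD : Raising D) {s : PowerSeries k}
    (hs : PowerSeries.constantCoeff s = 0) (r : PowerSeries k) :
    ev (ev_raising hD hs) r = ev hD (r.subst s) := by
  have hs' : PowerSeries.HasSubst s := PowerSeries.HasSubst.of_constantCoeff_zero' hs
  refine LinearMap.ext fun f => eq_of_forall_sub_mem_filt fun M => ?_
  set p : Polynomial k := PowerSeries.trunc M r
  have hp : PowerSeries.X ^ M ∣ r - (p : PowerSeries k) := by
    rw [PowerSeries.X_pow_dvd_iff]
    intro m hm
    simp [p, PowerSeries.coeff_trunc, hm]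
  obtain ⟨q, hq⟩ := hp
  have hr : r = (p : PowerSeries k) + PowerSeries.X ^ M * q := by rw [← hq]; ring
  have e1 : r.subst s = (p : PowerSeries k).subst s + s ^ M * q.subst s := by
    conv_lhs => rw [hr]
    rw [PowerSeries.subst_add hs', PowerSeries.subst_mul hs', PowerSeries.subst_pow hs',
      PowerSeries.subst_X hs']
  have e2 : ev (ev_raising hD hs) (p : PowerSeries k) = ev hD ((p : PowerSeries k).subst s) := by
    rw [ev_coe, PowerSeries.subst_coe hs', Polynomial.aeval_algHom_apply]
  rw [e1, map_add, ← e2]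
  have e3 : ev (ev_raising hD hs) r f = ev (ev_raising hD hs) (p : PowerSeries k) f +
      ev (ev_raising hD hs) (PowerSeries.X ^ M * q) f := by
    conv_lhs => rw [hr]
    rw [map_add, LinearMap.add_apply]
  rw [e3, LinearMap.add_apply, add_sub_add_left_eq_sub]
  refine sub_mem ?_ ?_
  · simpa using ev_mem_of_dvd (ev_raising hD hs) (Dvd.intro _ rfl) (mem_filt_zero f)
  · have hd : PowerSeries.X ^ M ∣ s ^ M * PowerSeries.subst s q :=
      Dvd.dvd.mul_right (pow_dvd_pow_of_dvd (PowerSeries.X_dvd_iff.mpr hs) M) _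
    simpa using ev_mem_of_dvd hD hd (mem_filt_zero f)

end EvalOp

/-! ### Substitution of noncommutative series into power series -/

section EvalSeries

variable {k : Type*} [Field k] {n : ℕ}

theorem evalOp_intertwine {D D' Ψ : Module.End k (NCSeries k n)} (hD : Raising D)
    (hD' : Raising D') (hΨ : Filtered Ψ) (h : ∀ f, Ψ (D f) = D' (Ψ f)) (c : ℕ → k)
    (f : NCSeries k n) : Ψ (evalOp c D f) = evalOp c D' (Ψ f) := by
  have hm : ∀ m, Ψ ((D ^ m) f) = (D' ^ m) (Ψ f) := by
    intro m
    induction m with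
    | zero => rfl
    | succ m ih => rw [pow_succ', pow_succ', Module.End.mul_apply, Module.End.mul_apply, h, ih]
  refine eq_of_forall_sub_mem_filt fun M => ?_
  have h1 := hΨ M _ (evalOp_sub_sum_mem hD c f M)
  have h2 := evalOp_sub_sum_mem hD' c (Ψ f) M
  rw [map_sub, map_sum] at h1
  simp only [map_smul, hm] at h1
  simpa using sub_mem h1 h2

theorem evalSeries_eq_evalOp (r : PowerSeries k) (f : NCSeries k n) :
    evalSeries r f = evalOp (fun m => PowerSeries.coeff m r) (LinearMap.mulLeft k f) 1 := by
  refine ext_coeff fun w => ?_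
  simp [coeff_evalOp, evalSeries, LinearMap.pow_mulLeft]

/-- Left multiplication by f commutes with right multiplications, so a series in it is again a left
multiplication. Identities for `evalSeries` thus follow from those for `ev`. -/
theorem ev_mulLeft {f : NCSeries k n} (hf : f ∈ filt k n 1) (r : PowerSeries k) :
    ev (raising_mulLeft hf) r = LinearMap.mulLeft k (evalSeries r f) := by
  refine LinearMap.ext fun g => ?_
  rw [LinearMap.mulLeft_apply, evalSeries_eq_evalOp, ← LinearMap.mulRight_apply (R := k),
    evalOp_intertwine (raising_mulLeft hf) (raising_mulLeft hf) (filtered_mulRight g)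
      (fun f => by simp [mul_assoc])]
  simp [ev_apply]

theorem evalSeries_eq_ev {f : NCSeries k n} (hf : f ∈ filt k n 1) (r : PowerSeries k) :
    evalSeries r f = ev (raising_mulLeft hf) r 1 := by
  rw [ev_mulLeft hf, LinearMap.mulLeft_apply, mul_one]

theorem evalSeries_mul {f : NCSeries k n} (hf : f ∈ filt k n 1) (r s : PowerSeries k) :
    evalSeries (r * s) f = evalSeries r f * evalSeries s f := by
  rw [evalSeries_eq_ev hf, map_mul, Module.End.mul_apply, ev_mulLeft hf, LinearMap.mulLeft_apply,
    ← evalSeries_eq_ev hf]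

theorem evalSeries_one {f : NCSeries k n} (hf : f ∈ filt k n 1) :
    evalSeries 1 f = 1 := by
  rw [evalSeries_eq_ev hf, map_one (ev (raising_mulLeft hf)), Module.End.one_apply]

theorem evalSeries_X {f : NCSeries k n} (hf : f ∈ filt k n 1) :
    evalSeries PowerSeries.X f = f := by
  rw [evalSeries_eq_ev hf, ev_X, LinearMap.mulLeft_apply, mul_one]

theorem evalSeries_pow {f : NCSeries k n} (hf : f ∈ filt k n 1) (r : PowerSeries k) (N : ℕ) :
    evalSeries (r ^ N) f = evalSeries r f ^ N := by
  induction N with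
  | zero => rw [pow_zero, pow_zero, evalSeries_one hf]
  | succ N ih => rw [pow_succ, pow_succ, evalSeries_mul hf, ih]

theorem evalSeries_add (r s : PowerSeries k) (f : NCSeries k n) :
    evalSeries (r + s) f = evalSeries r f + evalSeries s f := by
  refine ext_coeff fun w => ?_
  simp [evalSeries, add_mul, Finset.sum_add_distrib]

theorem evalSeries_sub (r s : PowerSeries k) (f : NCSeries k n) :
    evalSeries (r - s) f = evalSeries r f - evalSeries s f := by
  refine ext_coeff fun w => ?_
  simp [evalSeries, sub_mul, Finset.sum_sub_distrib]

theorem evalSeries_mem_filt {f : NCSeries k n} (hf : f ∈ filt k n 1) {r : PowerSeries k} {M : ℕ}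
    (h : PowerSeries.X ^ M ∣ r) : evalSeries r f ∈ filt k n M := by
  rw [evalSeries_eq_ev hf]
  simpa using ev_mem_of_dvd (raising_mulLeft hf) h (mem_filt_zero 1)

theorem evalSeries_mem_filt_one {f : NCSeries k n} (hf : f ∈ filt k n 1) {r : PowerSeries k}
    (h : PowerSeries.constantCoeff r = 0) : evalSeries r f ∈ filt k n 1 :=
  evalSeries_mem_filt hf (by rw [pow_one]; exact PowerSeries.X_dvd_iff.mpr h)

/-- The proof of `Raising` is an argument of `ev` and its type depends on the operator, so equal
operators are exchanged through this lemma. -/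
theorem ev_congr {D D' : Module.End k (NCSeries k n)} (h : D = D') (hD : Raising D)
    (hD' : Raising D') (r : PowerSeries k) : ev hD r = ev hD' r := by
  subst h; rfl

theorem evalSeries_subst {f : NCSeries k n} (hf : f ∈ filt k n 1) {s : PowerSeries k}
    (hs : PowerSeries.constantCoeff s = 0) (r : PowerSeries k) :
    evalSeries r (evalSeries s f) = evalSeries (r.subst s) f := by
  rw [evalSeries_eq_ev (evalSeries_mem_filt_one hf hs), evalSeries_eq_ev hf (r.subst s),
    ← ev_subst (raising_mulLeft hf) hs]
  exact LinearMap.congr_fun (ev_congr (ev_mulLeft hf s).symm _ _ r) 1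

/-- A filtered linear map that is multiplicative and preserves the unit commutes with the
substitution in power series. -/
theorem map_evalSeries {Φ : NCSeries k n →ₗ[k] NCSeries k n} (hΦ : Filtered Φ) (h1 : Φ 1 = 1)
    (hmul : ∀ f g, Φ (f * g) = Φ f * Φ g) (r : PowerSeries k) {f : NCSeries k n}
    (hf : f ∈ filt k n 1) : Φ (evalSeries r f) = evalSeries r (Φ f) := by
  rw [evalSeries_eq_evalOp, evalSeries_eq_evalOp, evalOp_intertwine (raising_mulLeft hf)
    (raising_mulLeft (hΦ 1 f hf)) hΦ (fun g => hmul f g), h1]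

theorem evalSeries_conj {f g h : NCSeries k n} (hf : f ∈ filt k n 1) (hgh : g * h = 1)
    (hhg : h * g = 1) (r : PowerSeries k) : evalSeries r (g * f * h) = g * evalSeries r f * h := by
  have := map_evalSeries (Φ := LinearMap.mulRight k h ∘ₗ LinearMap.mulLeft k g)
    ((filtered_mulRight h).comp (filtered_mulLeft g)) (by simp [hgh])
    (fun a b => by
      simp only [LinearMap.comp_apply, LinearMap.mulLeft_apply, LinearMap.mulRight_apply]
      calc g * (a * b) * h = g * a * 1 * b * h := by simp [mul_assoc]
        _ = _ := by rw [← hhg]; simp [mul_assoc]) r hf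
  simpa using this.symm

end EvalSeries

/-! ### Exponential and logarithm -/

section ExpLog

/-- Both sides have constant term 0 and derivative 1, as log'(e^t - 1) = e^(-t). -/
theorem PowerSeries_log_subst_exp (k : Type*) [Field k] [CharZero k] :
    (PowerSeries.log k).subst (PowerSeries.exp k - 1) = PowerSeries.X := by
  have hs : PowerSeries.HasSubst (PowerSeries.exp k - 1) := PowerSeries.HasSubst.exp_sub_one
  apply PowerSeries.derivative.ext
  · rw [PowerSeries.derivative_subst hs, PowerSeries.deriv_log]
    have h1 : (PowerSeries.mk fun n => algebraMap ℚ k ((-1 : ℚ) ^ n)) * (1 + PowerSeries.X) = 1 := by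
      ext m
      rw [mul_add, mul_one, map_add]
      cases m with
      | zero => simp
      | succ m => simp [PowerSeries.coeff_succ_mul_X, pow_succ, PowerSeries.coeff_one]
    have h2 := congrArg (PowerSeries.subst (PowerSeries.exp k - 1)) h1
    rw [PowerSeries.subst_mul hs, PowerSeries.subst_add hs, PowerSeries.subst_X hs] at h2
    have h3 : (1 : PowerSeries k).subst (PowerSeries.exp k - 1) = (1 : PowerSeries k) := by
      rw [← PowerSeries.coe_substAlgHom hs, map_one]
    rw [h3] at h2
    rw [map_sub, PowerSeries.derivative_exp]
    simpa using h2
  · have h0 : PowerSeries.constantCoeff (PowerSeries.exp k - 1) = 0 := by simp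
    have h1 : PowerSeries.constantCoeff
        ((PowerSeries.log k).subst (PowerSeries.exp k - 1)) = 0 :=
      PowerSeries.constantCoeff_subst_eq_zero h0 _ PowerSeries.constantCoeff_log
    rw [h1, PowerSeries.constantCoeff_X]

/-- The series e^t - 1 has a compositional inverse, and log(1 + t), already known to be inverse on
one side, must coincide with it. -/
theorem PowerSeries_exp_subst_log (k : Type*) [Field k] [CharZero k] :
    (PowerSeries.exp k).subst (PowerSeries.log k) = 1 + PowerSeries.X := by
  set P : PowerSeries k := PowerSeries.exp k - 1 with hP
  have hs : PowerSeries.HasSubst P := PowerSeries.HasSubst.exp_sub_one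
  have hP0 : PowerSeries.constantCoeff P = 0 := by simp [hP]
  have hP1 : IsUnit (P.coeff 1) := by simp [hP, PowerSeries.coeff_exp, PowerSeries.coeff_one]
  have h1 := PowerSeries.subst_substInvOfIsUnit_right P hP0 hP1
  have hI : PowerSeries.HasSubst (PowerSeries.substInvOfIsUnit P hP1) :=
    PowerSeries.HasSubst.substInvOfIsUnit P hP1
  have h2 : PowerSeries.log k = PowerSeries.substInvOfIsUnit P hP1 := by
    have h3 := PowerSeries.subst_comp_subst_apply hs hI (PowerSeries.log k)
    rw [PowerSeries_log_subst_exp, h1, PowerSeries.subst_X hI, PowerSeries.X_subst] at h3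
    exact h3.symm
  rw [← h2] at h1 hI
  rw [hP, PowerSeries.subst_sub hI, sub_eq_iff_eq_add] at h1
  rw [h1, add_comm]
  congr 1
  rw [← PowerSeries.coe_substAlgHom hI, map_one]

variable {k : Type*} [Field k] [CharZero k] {n : ℕ}

theorem coeff_exp_eq : (fun m => PowerSeries.coeff m (PowerSeries.exp k)) =
    fun m => ((m.factorial : k))⁻¹ := by
  funext m; simp [PowerSeries.coeff_exp]

theorem exp_eq (f : NCSeries k n) : exp f = evalSeries (PowerSeries.exp k) f := by
  rw [NCSeries.exp]; congr 1; ext m; simp [PowerSeries.coeff_exp]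

theorem log_eq (g : NCSeries k n) : log g = evalSeries (PowerSeries.log k) (g - 1) := by
  rw [NCSeries.log]; congr 1; ext m
  by_cases h : m = 0
  · simp [h]
  · simp [PowerSeries.coeff_log, h, div_eq_mul_inv]

theorem exp_sub_one_eq {f : NCSeries k n} (hf : f ∈ filt k n 1) :
    exp f - 1 = evalSeries (PowerSeries.exp k - 1) f := by
  rw [exp_eq, evalSeries_sub, evalSeries_one hf]

theorem log_exp {f : NCSeries k n} (hf : f ∈ filt k n 1) : log (exp f) = f := by
  rw [log_eq, exp_sub_one_eq hf, evalSeries_subst hf (by simp), PowerSeries_log_subst_exp,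
    evalSeries_X hf]

theorem exp_log {g : NCSeries k n} (hg : g - 1 ∈ filt k n 1) : exp (log g) = g := by
  rw [log_eq, exp_eq, evalSeries_subst hg (by simp), PowerSeries_exp_subst_log,
    evalSeries_add, evalSeries_one hg, evalSeries_X hg]
  abel

theorem exp_injOn {f g : NCSeries k n} (hf : f ∈ filt k n 1) (hg : g ∈ filt k n 1)
    (h : exp f = exp g) : f = g := by
  rw [← log_exp hf, h, log_exp hg]

theorem exp_sub_one_mem {f : NCSeries k n} (hf : f ∈ filt k n 1) : exp f - 1 ∈ filt k n 1 := by
  rw [exp_sub_one_eq hf]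
  exact evalSeries_mem_filt_one hf (by simp)

theorem log_mem_filt {g : NCSeries k n} (hg : g - 1 ∈ filt k n 1) : log g ∈ filt k n 1 := by
  rw [log_eq]
  exact evalSeries_mem_filt_one hg (by simp)

theorem exp_neg_eq (f : NCSeries k n) :
    exp (-f) = evalSeries (PowerSeries.evalNegHom (PowerSeries.exp k)) f := by
  rw [exp_eq]
  refine ext_coeff fun w => ?_
  simp only [evalSeries]
  refine Finset.sum_congr rfl fun m _ => ?_
  rw [PowerSeries.evalNegHom, PowerSeries.coeff_rescale, neg_pow f]
  have : ((-1 : NCSeries k n) ^ m) = algebraMap k (NCSeries k n) ((-1) ^ m) := by simp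
  rw [this, ← Algebra.smul_def, coeff_smul]
  ring

theorem exp_mul_exp_neg {f : NCSeries k n} (hf : f ∈ filt k n 1) : exp f * exp (-f) = 1 := by
  rw [exp_neg_eq, exp_eq, ← evalSeries_mul hf, PowerSeries.exp_mul_exp_neg_eq_one,
    evalSeries_one hf]

theorem exp_neg_mul_exp {f : NCSeries k n} (hf : f ∈ filt k n 1) : exp (-f) * exp f = 1 := by
  simpa using exp_mul_exp_neg (neg_mem hf)

theorem exp_conj {f g h : NCSeries k n} (hf : f ∈ filt k n 1) (hgh : g * h = 1)
    (hhg : h * g = 1) : exp (g * f * h) = g * exp f * h := by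
  rw [exp_eq, exp_eq, evalSeries_conj hf hgh hhg]

end ExpLog

/-! ### Subspaces defined degree by degree -/

section Graded

variable {k : Type*} [Field k] {n : ℕ}

/-- Subspaces that are defined by conditions on the homogeneous components. -/
def IsGraded (K : Submodule k (NCSeries k n)) : Prop :=
  ∃ S : Submodule k (NCSeries k n), ∀ f, f ∈ K ↔ ∀ d, comp d f ∈ S

theorem IsGraded.comp_mem {K : Submodule k (NCSeries k n)} (hK : IsGraded K) {f : NCSeries k n}
    (hf : f ∈ K) (d : ℕ) : comp d f ∈ K := by
  obtain ⟨S, hS⟩ := hK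
  rw [hS] at hf ⊢
  intro e
  rw [comp_comp]
  split_ifs
  · exact hf e
  · exact zero_mem _

theorem IsGraded.mem_of_comp {K : Submodule k (NCSeries k n)} (hK : IsGraded K) {f : NCSeries k n}
    (hf : ∀ d, comp d f ∈ K) : f ∈ K := by
  obtain ⟨S, hS⟩ := hK
  rw [hS]
  intro d
  have := (hS _).mp (hf d) d
  rwa [comp_comp, if_pos rfl] at this

/-- Graded subspaces are closed: each component of f is that of a sufficiently good approximation.
-/
theorem IsGraded.mem_of_approx {K : Submodule k (NCSeries k n)} (hK : IsGraded K)
    {f : NCSeries k n} (hf : ∀ M, ∃ g ∈ K, f - g ∈ filt k n M) : f ∈ K := by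
  refine hK.mem_of_comp fun d => ?_
  obtain ⟨g, hg, h⟩ := hf (d + 1)
  rw [comp_eq_of_sub_mem (Nat.lt_succ_self d) h]
  exact hK.comp_mem hg d

theorem IsGraded.evalOp_mem {K : Submodule k (NCSeries k n)} (hK : IsGraded K)
    {D : Module.End k (NCSeries k n)} (hD : Raising D) (hDK : ∀ f ∈ K, D f ∈ K) (c : ℕ → k)
    {f : NCSeries k n} (hf : f ∈ K) : evalOp c D f ∈ K := by
  refine hK.mem_of_approx fun M => ⟨_, ?_, evalOp_sub_sum_mem hD c f M⟩
  refine sum_mem fun m _ => K.smul_mem _ ?_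
  clear * - hf hDK
  induction m with
  | zero => exact hf
  | succ m ih => rw [pow_succ', Module.End.mul_apply]; exact hDK _ ih

end Graded

/-! ### First order jets of polynomial sequences -/

section Jets

variable {k : Type*} [Field k] {n : ℕ}

/-- `p N` is a polynomial in `N` with constant coefficient `b` and linear coefficient `a`. -/
def PolyJet (p : ℕ → k) (b a : k) : Prop :=
  ∃ P : Polynomial k, (∀ N : ℕ, p N = P.eval (N : k)) ∧ P.coeff 0 = b ∧ P.coeff 1 = a

theorem PolyJet.add {p q : ℕ → k} {b a b' a' : k} (hp : PolyJet p b a) (hq : PolyJet q b' a') :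
    PolyJet (fun N => p N + q N) (b + b') (a + a') := by
  obtain ⟨P, hP, rfl, rfl⟩ := hp
  obtain ⟨Q, hQ, rfl, rfl⟩ := hq
  exact ⟨P + Q, fun N => by simp [hP, hQ], by simp, by simp⟩

theorem PolyJet.mul {p q : ℕ → k} {b a b' a' : k} (hp : PolyJet p b a) (hq : PolyJet q b' a') :
    PolyJet (fun N => p N * q N) (b * b') (a * b' + b * a') := by
  obtain ⟨P, hP, rfl, rfl⟩ := hp
  obtain ⟨Q, hQ, rfl, rfl⟩ := hq
  refine ⟨P * Q, fun N => by simp [hP, hQ], by simp [Polynomial.mul_coeff_zero], ?_⟩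
  rw [Polynomial.mul_coeff_one]; ring

theorem polyJet_const (c : k) : PolyJet (fun _ => c) c 0 :=
  ⟨Polynomial.C c, fun N => by simp, by simp, by simp⟩

theorem polyJet_pow_mul (m : ℕ) (c : k) : PolyJet (fun N => (N : k) ^ m * c)
    (if m = 0 then c else 0) (if m = 1 then c else 0) :=
  ⟨Polynomial.C c * Polynomial.X ^ m, fun N => by
      rw [Polynomial.eval_mul, Polynomial.eval_C, Polynomial.eval_pow, Polynomial.eval_X, mul_comm],
    by rw [Polynomial.coeff_C_mul_X_pow]; exact if_congr eq_comm rfl rfl,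
    by rw [Polynomial.coeff_C_mul_X_pow]; exact if_congr eq_comm rfl rfl⟩

theorem PolyJet.sum {ι : Type*} (s : Finset ι) {p : ι → ℕ → k} {b a : ι → k}
    (h : ∀ i ∈ s, PolyJet (p i) (b i) (a i)) :
    PolyJet (fun N => ∑ i ∈ s, p i N) (∑ i ∈ s, b i) (∑ i ∈ s, a i) := by
  classical
  induction s using Finset.induction_on with
  | empty => simpa using polyJet_const (0 : k)
  | insert i s hi ih =>
    simp only [Finset.sum_insert hi]
    exact (h i (Finset.mem_insert_self i s)).add
      (ih fun j hj => h j (Finset.mem_insert_of_mem hj))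

/-- All coefficients of `p N` are polynomials in `N`, with constant coefficients given by `b` and
linear coefficients given by `a`. -/
def HasJet (p : ℕ → NCSeries k n) (b a : NCSeries k n) : Prop :=
  ∀ w, PolyJet (fun N => (p N).coeff w) (b.coeff w) (a.coeff w)

theorem hasJet_const (f : NCSeries k n) : HasJet (fun _ => f) f 0 := fun _ => polyJet_const _

theorem HasJet.add {p q : ℕ → NCSeries k n} {b a b' a' : NCSeries k n} (hp : HasJet p b a)
    (hq : HasJet q b' a') : HasJet (fun N => p N + q N) (b + b') (a + a') :=
  fun w => (hp w).add (hq w)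

theorem HasJet.smul {p : ℕ → NCSeries k n} {b a : NCSeries k n} (c : k) (hp : HasJet p b a) :
    HasJet (fun N => c • p N) (c • b) (c • a) := fun w => by
  simpa using (polyJet_const c).mul (hp w)

theorem HasJet.sub {p q : ℕ → NCSeries k n} {b a b' a' : NCSeries k n} (hp : HasJet p b a)
    (hq : HasJet q b' a') : HasJet (fun N => p N - q N) (b - b') (a - a') := by
  simpa [sub_eq_add_neg] using hp.add (hq.smul (-1))

theorem HasJet.sum {ι : Type*} (s : Finset ι) {p : ι → ℕ → NCSeries k n} {b a : ι → NCSeries k n}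
    (h : ∀ i ∈ s, HasJet (p i) (b i) (a i)) :
    HasJet (fun N => ∑ i ∈ s, p i N) (∑ i ∈ s, b i) (∑ i ∈ s, a i) := fun w => by
  simp only [coeff_sum]
  exact PolyJet.sum s fun i hi => h i hi w

theorem HasJet.mul {p q : ℕ → NCSeries k n} {b a b' a' : NCSeries k n} (hp : HasJet p b a)
    (hq : HasJet q b' a') : HasJet (fun N => p N * q N) (b * b') (a * b' + b * a') := fun w => by
  simp only [coeff_mul, coeff_add, ← Finset.sum_add_distrib]
  exact PolyJet.sum _ fun i _ => (hp _).mul (hq _)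

theorem HasJet.partialD {p : ℕ → NCSeries k n} {b a : NCSeries k n} (i : Fin n)
    (hp : HasJet p b a) : HasJet (fun N => partialD i (p N)) (partialD i b) (partialD i a) :=
  fun w => hp (i :: w)

theorem coeff_map_eq_sum {Φ : NCSeries k n →ₗ[k] NCSeries k n} (hΦ : Filtered Φ)
    (f : NCSeries k n) (w : List (Fin n)) : (Φ f).coeff w =
      ∑ d ∈ Finset.range (w.length + 1), ∑ v : Fin d → Fin n,
        f.coeff (List.ofFn v) * (Φ (word (List.ofFn v))).coeff w := by
  have h : Φ = wordExt fun v => Φ (word v) := filtered_ext hΦ (wordExt_filtered _) fun v =>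
    (wordExt_word (b := fun v => Φ (word v)) (hΦ _ _ (word_mem_filt v))).symm
  conv_lhs => rw [h]
  rfl

theorem HasJet.map {p : ℕ → NCSeries k n} {b a : NCSeries k n} {Φ : NCSeries k n →ₗ[k] NCSeries k n}
    (hΦ : Filtered Φ) (hp : HasJet p b a) : HasJet (fun N => Φ (p N)) (Φ b) (Φ a) := fun w => by
  rw [coeff_map_eq_sum hΦ b w, coeff_map_eq_sum hΦ a w]
  have e := fun N => coeff_map_eq_sum hΦ (p N) w
  rw [funext e]
  refine PolyJet.sum _ fun d _ => PolyJet.sum _ fun v _ => ?_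
  simpa using (hp (List.ofFn v)).mul (polyJet_const ((Φ (word (List.ofFn v))).coeff w))

theorem HasJet.pow {p : ℕ → NCSeries k n} {a : NCSeries k n} (hp : HasJet p 0 a) (m : ℕ) :
    HasJet (fun N => p N ^ m) (if m = 0 then 1 else 0) (if m = 1 then a else 0) := by
  match m with
  | 0 => simpa using hasJet_const (1 : NCSeries k n)
  | 1 => simpa using hp
  | m + 2 =>
    have : ∀ m, ∃ c, HasJet (fun N => p N ^ (m + 1)) 0 c := by
      intro m
      induction m with
      | zero => exact ⟨a, by simpa using hp⟩
      | succ m ih =>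
        obtain ⟨c, hc⟩ := ih
        exact ⟨_, by simpa [pow_succ _ (m + 1)] using hc.mul hp⟩
    obtain ⟨c, hc⟩ := this m
    simpa [pow_succ _ (m + 1)] using hc.mul hp

theorem HasJet.evalSeries {p : ℕ → NCSeries k n} {a : NCSeries k n} (hp : HasJet p 0 a)
    (ha : a ∈ filt k n 1) (r : PowerSeries k) :
    HasJet (fun N => evalSeries r (p N)) (algebraMap k _ (PowerSeries.coeff 0 r))
      (PowerSeries.coeff 1 r • a) := fun w => by
  have h := PolyJet.sum (Finset.range (w.length + 1)) fun m _ =>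
    (polyJet_const (PowerSeries.coeff m r)).mul (hp.pow m w)
  convert! h using 1
  · rw [Finset.sum_eq_single 0]
    · rw [Algebra.algebraMap_eq_smul_one]; simp
    · intro m _ hm; simp [hm]
    · simp
  · simp only [zero_mul, zero_add]
    -- For the empty word the sum contains only m = 0 and misses the linear term; the hypothesis
    -- that `a` has no constant term covers this case.
    by_cases hw : w = []
    · subst hw
      simp [mem_filt_one.mp ha]
    · rw [Finset.sum_eq_single 1]
      · simp
      · intro m _ hm; simp [hm]
      · intro h
        exact absurd (List.length_eq_zero_iff.mp (by simpa using h)) hw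

theorem hasJet_evalOp (D : Module.End k (NCSeries k n)) (f : NCSeries k n) {c : ℕ → ℕ → k}
    {b a : ℕ → k} (h : ∀ m, PolyJet (fun N => c N m) (b m) (a m)) :
    HasJet (fun N => evalOp (c N) D f) (evalOp b D f) (evalOp a D f) := fun w => by
  simp only [coeff_evalOp]
  refine PolyJet.sum _ fun m _ => ?_
  simpa using (h m).mul (polyJet_const (((D ^ m) f).coeff w))

variable [CharZero k]

theorem eq_of_eval_natCast_eq {P Q : Polynomial k} (h : ∀ N : ℕ, P.eval (N : k) = Q.eval (N : k)) :
    P = Q :=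
  Polynomial.eq_of_infinite_eval_eq P Q
    ((Set.infinite_range_of_injective Nat.cast_injective).mono (by rintro _ ⟨N, rfl⟩; exact h N))

theorem PolyJet.unique {p : ℕ → k} {b a b' a' : k} (h : PolyJet p b a) (h' : PolyJet p b' a') :
    b = b' ∧ a = a' := by
  obtain ⟨P, hP, rfl, rfl⟩ := h
  obtain ⟨Q, hQ, rfl, rfl⟩ := h'
  have : P = Q := eq_of_eval_natCast_eq fun N => by rw [← hP, hQ]
  subst this
  exact ⟨rfl, rfl⟩

theorem HasJet.unique {p : ℕ → NCSeries k n} {b a b' a' : NCSeries k n} (h : HasJet p b a)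
    (h' : HasJet p b' a') : a = a' := ext_coeff fun w => ((h w).unique (h' w)).2

/-- Each coefficient of e^(ND) f = ∑ N^m D^m f / m! is a finite sum, hence a polynomial in N. The
integer N replaces the time t of the flow. -/
theorem hasJet_ev_exp_pow {D : Module.End k (NCSeries k n)} (hD : Raising D) (f : NCSeries k n) :
    HasJet (fun N => ev hD (PowerSeries.exp k ^ N) f) f (D f) := by
  have h := hasJet_evalOp D f fun m => polyJet_pow_mul m ((m.factorial : k))⁻¹
  have e0 : evalOp (fun m => if m = 0 then ((m.factorial : k))⁻¹ else 0) D f = f := by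
    rw [evalOp_eq_ev hD]
    have : (PowerSeries.mk fun m => if m = 0 then ((m.factorial : k))⁻¹ else 0) = 1 := by
      ext m; by_cases h : m = 0 <;> simp [PowerSeries.coeff_one, h]
    rw [this, map_one (ev hD), Module.End.one_apply]
  have e1 : evalOp (fun m => if m = 1 then ((m.factorial : k))⁻¹ else 0) D f = D f := by
    rw [evalOp_eq_ev hD]
    have : (PowerSeries.mk fun m => if m = 1 then ((m.factorial : k))⁻¹ else 0) =
        PowerSeries.X := by
      ext m; by_cases h : m = 1 <;> simp [PowerSeries.coeff_X, h]
    rw [this, ev_X]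
  rw [e0, e1] at h
  convert h using 2 with N
  rw [PowerSeries.exp_pow_eq_rescale_exp, ev_apply]
  congr 1
  funext m
  simp [PowerSeries.coeff_exp]

/-- If a component of `a` were outside the subspace, some linear functional would vanish on the
subspace but not on that component. Applied to `p N` it gives a polynomial in N with all natural
numbers as zeros, so its linear coefficient vanishes, a contradiction. -/
theorem IsGraded.jet_mem {K : Submodule k (NCSeries k n)} (hK : IsGraded K)
    {p : ℕ → NCSeries k n} {b a : NCSeries k n} (hj : HasJet p b a) (hp : ∀ N, p N ∈ K) :
    a ∈ K := by
  obtain ⟨S, hS⟩ := hK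
  simp only [hS] at hp ⊢
  intro d
  by_contra ha
  obtain ⟨φ, hφ, hφS⟩ := Submodule.exists_le_ker_of_notMem ha
  choose P hP hP0 hP1 using hj
  have hQ : (∑ v : Fin d → Fin n, φ (word (List.ofFn v)) • P (List.ofFn v)) = 0 := by
    refine eq_of_eval_natCast_eq fun N => ?_
    have h1 : φ (comp d (p N)) = 0 := hφS (hp N d)
    rw [comp_eq_sum, map_sum] at h1
    rw [Polynomial.eval_zero, ← h1, Polynomial.eval_finsetSum]
    refine Finset.sum_congr rfl fun v _ => ?_
    rw [Polynomial.eval_smul, ← hP, map_smul, smul_eq_mul, smul_eq_mul, mul_comm]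
  apply hφ
  rw [comp_eq_sum, map_sum]
  have h2 := congrArg (fun q => Polynomial.coeff q 1) hQ
  simp only [Polynomial.finsetSum_coeff, Polynomial.coeff_smul, hP1, Polynomial.coeff_zero] at h2
  rw [← h2]
  refine Finset.sum_congr rfl fun v _ => ?_
  rw [map_smul, smul_eq_mul, smul_eq_mul, mul_comm]

/-- `(e ^ t - 1) / t`. -/
def phiSeries (k : Type*) [Field k] : PowerSeries k :=
  PowerSeries.mk fun m => (((m + 1).factorial : k))⁻¹

theorem X_mul_phi_rescale (N : ℕ) :
    PowerSeries.X * (PowerSeries.mk fun m => (N : k) ^ (m + 1) * (((m + 1).factorial : k))⁻¹) =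
      PowerSeries.exp k ^ N - 1 := by
  rw [PowerSeries.exp_pow_eq_rescale_exp]
  ext m
  cases m with
  | zero =>
    rw [PowerSeries.coeff_zero_X_mul, map_sub, PowerSeries.coeff_rescale]
    simp [PowerSeries.coeff_exp]
  | succ m =>
    rw [PowerSeries.coeff_succ_X_mul]
    simp [PowerSeries.coeff_exp, PowerSeries.coeff_one]

/-- After multiplication by t this reads e^((N+1)t) - 1 = (e^t - 1) + e^t (e^(Nt) - 1). -/
theorem phi_rescale_succ (N : ℕ) :
    (PowerSeries.mk fun m => ((N + 1 : ℕ) : k) ^ (m + 1) * (((m + 1).factorial : k))⁻¹) =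
      phiSeries k + PowerSeries.exp k *
        PowerSeries.mk fun m => (N : k) ^ (m + 1) * (((m + 1).factorial : k))⁻¹ := by
  have h1 := X_mul_phi_rescale (k := k) 1
  simp only [Nat.cast_one, one_pow, one_mul, pow_one] at h1
  refine mul_left_cancel₀ (PowerSeries.X_ne_zero (R := k)) ?_
  rw [X_mul_phi_rescale, mul_add, mul_left_comm, X_mul_phi_rescale, phiSeries, h1, pow_succ]
  ring

theorem phi_mul_inv : phiSeries k * (phiSeries k)⁻¹ = 1 :=
  PowerSeries.mul_inv_cancel _ (by simp [phiSeries])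

/-- A sequence that satisfies the cocycle condition `U (N + 1) = U 1 + e ^ D (U N)` modulo `K` is
determined modulo `K` by its derivative at `0`. -/
theorem IsGraded.cocycle_mem {K : Submodule k (NCSeries k n)} (hK : IsGraded K)
    {D : Module.End k (NCSeries k n)} (hD : Raising D) (hDK : ∀ f ∈ K, D f ∈ K)
    {U : ℕ → NCSeries k n} {b a : NCSeries k n} (h0 : U 0 ∈ K)
    (h : ∀ N, U (N + 1) - U 1 - ev hD (PowerSeries.exp k) (U N) ∈ K) (hj : HasJet U b a) :
    U 1 - ev hD (phiSeries k) a ∈ K := by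
  -- The constant term of φ(t) = (e^t - 1)/t is 1, so b' with φ(D) b' = U 1 exists. With ψ_N(t) =
  -- (e^(Nt) - 1)/t, the sequence ψ_N(D) b' satisfies the same recursion as U, hence agrees with it
  -- modulo K; its linear coefficient in N is b', whence a ≡ b'.
  set b' := ev hD (phiSeries k)⁻¹ (U 1) with hb'
  set ψ : ℕ → PowerSeries k := fun N =>
    PowerSeries.mk fun m => (N : k) ^ (m + 1) * (((m + 1).factorial : k))⁻¹ with hψ
  have hφb : ev hD (phiSeries k) b' = U 1 := by
    rw [hb', ← Module.End.mul_apply, ← map_mul, phi_mul_inv, map_one (ev hD),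
      Module.End.one_apply]
  have hmem : ∀ r, ∀ f ∈ K, ev hD r f ∈ K := fun r f hf => hK.evalOp_mem hD hDK _ hf
  have hUV : ∀ N, U N - ev hD (ψ N) b' ∈ K := by
    intro N
    induction N with
    | zero =>
      have : ψ 0 = 0 := by ext m; simp [hψ]
      rw [this, map_zero, LinearMap.zero_apply, sub_zero]
      exact h0
    | succ N ih =>
      have e : ψ (N + 1) = phiSeries k + PowerSeries.exp k * ψ N := phi_rescale_succ N
      rw [e, map_add, map_mul, LinearMap.add_apply, hφb, Module.End.mul_apply]
      have h1 := add_mem (h N) (hmem (PowerSeries.exp k) _ ih)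
      rw [map_sub] at h1
      convert h1 using 1
      abel
  have hV : HasJet (fun N => ev hD (ψ N) b') (evalOp 0 D b') b' := by
    have h2 := hasJet_evalOp D b' fun m => polyJet_pow_mul (m + 1) (((m + 1).factorial : k))⁻¹
    have e0 : (fun m => if m + 1 = 0 then (((m + 1).factorial : k))⁻¹ else 0) = 0 := by
      funext m; simp
    have e1 : evalOp (fun m => if m + 1 = 1 then (((m + 1).factorial : k))⁻¹ else 0) D b' = b' := by
      rw [evalOp_eq_ev hD]
      have : (PowerSeries.mk fun m => if m + 1 = 1 then (((m + 1).factorial : k))⁻¹ else 0) =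
          1 := by
        ext m; by_cases h : m = 0 <;> simp [PowerSeries.coeff_one, h]
      rw [this, map_one (ev hD), Module.End.one_apply]
    rw [e0, e1] at h2
    convert h2 using 2 with N
    rw [evalOp_eq_ev hD]
  have h3 := hmem (phiSeries k) _ (hK.jet_mem (hj.sub hV) hUV)
  rw [map_sub, hφb] at h3
  simpa using neg_mem h3

/-! ### The logarithm of a unipotent operator -/

/-- `log Φ` for an operator `Φ` such that `Φ - 1` raises the degree. -/
def logOp {Φ : Module.End k (NCSeries k n)} (h : Raising (Φ - 1)) : Module.End k (NCSeries k n) :=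
  ev h (PowerSeries.log k)

theorem logOp_raising {Φ : Module.End k (NCSeries k n)} (h : Raising (Φ - 1)) :
    Raising (logOp h) := ev_raising h PowerSeries.constantCoeff_log

theorem ev_exp_logOp {Φ : Module.End k (NCSeries k n)} (h : Raising (Φ - 1)) :
    ev (logOp_raising h) (PowerSeries.exp k) = Φ := by
  have h1 := ev_subst h PowerSeries.constantCoeff_log (PowerSeries.exp k)
  rw [PowerSeries_exp_subst_log, map_add, map_one (ev h), ev_X] at h1
  exact h1.trans (by abel)

/-- Identifies logarithms without computing a series: log Φ is the derivative of Φ^N at N = 0,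
because Φ^N = e^(N log Φ). -/
theorem hasJet_pow {Φ : Module.End k (NCSeries k n)} (h : Raising (Φ - 1)) (f : NCSeries k n) :
    HasJet (fun N => (Φ ^ N) f) f (logOp h f) := by
  have := hasJet_ev_exp_pow (logOp_raising h) f
  simpa only [map_pow, ev_exp_logOp] using this

end Jets

/-! ### The Baker–Campbell–Hausdorff theorem -/

section LieSeriesBasic

variable {k : Type*} [Field k] {n : ℕ}

theorem mem_lieSeries {f : NCSeries k n} : f ∈ LieSeries k n ↔ ∀ d, comp d f ∈ LiePoly k n :=
  Iff.rfl

theorem isGraded_lieSeries : IsGraded (LieSeries k n).toSubmodule :=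
  ⟨(LiePoly k n).toSubmodule, fun _ => Iff.rfl⟩

theorem isGraded_bot : IsGraded (⊥ : Submodule k (NCSeries k n)) := by
  refine ⟨⊥, fun f => ?_⟩
  simp only [Submodule.mem_bot]
  refine ⟨fun h d => by rw [h, comp_zero], fun h => ext_comp fun d => by rw [h, comp_zero]⟩

theorem liePoly_le_lieSeries : LiePoly k n ≤ LieSeries k n :=
  LieSubalgebra.lieSpan_le.mpr (by rintro _ ⟨i, rfl⟩; exact X_mem_lieSeries k i)

theorem lie_coeff_nil (f g : NCSeries k n) : ⁅f, g⁆.coeff [] = 0 := by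
  rw [LieRing.of_associative_ring_bracket, coeff_sub, mul_nil, mul_nil, mul_comm, sub_self]

theorem liePoly_coeff_nil {f : NCSeries k n} (hf : f ∈ LiePoly k n) : f.coeff [] = 0 := by
  induction hf using LieSubalgebra.lieSpan_induction with
  | mem _ h => obtain ⟨i, rfl⟩ := h; simp [X, coeff_word]
  | zero => rfl
  | add _ _ _ _ hf hg => rw [coeff_add, hf, hg, add_zero]
  | smul c _ _ hf => rw [coeff_smul, hf, mul_zero]
  | lie f g _ _ _ _ => exact lie_coeff_nil f g

theorem lieSeries_le_filt_one {f : NCSeries k n} (hf : f ∈ LieSeries k n) : f ∈ filt k n 1 := by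
  rw [mem_filt_one]
  simpa [coeff_comp] using liePoly_coeff_nil (hf 0)

theorem LieSeries.mem_filt_one (f : LieSeries k n) : (f : NCSeries k n) ∈ filt k n 1 :=
  lieSeries_le_filt_one f.2

/-- The operator `f ↦ ⁅z, f⁆`. -/
def adOp (z : NCSeries k n) : Module.End k (NCSeries k n) :=
  LinearMap.mulLeft k z - LinearMap.mulRight k z

theorem adOp_apply (z f : NCSeries k n) : adOp z f = ⁅z, f⁆ := rfl

theorem adOp_raising {z : NCSeries k n} (hz : z ∈ filt k n 1) : Raising (adOp z) :=
  fun m _ hf => add_comm 1 m ▸ lie_mem_filt hz hf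

/-- The degree derivation `w ↦ |w| w`. -/
def degDer (k : Type*) [Field k] (n : ℕ) : NCSeries k n →ₗ[k] NCSeries k n where
  toFun f := ⟨fun w => (w.length : k) * f.coeff w⟩
  map_add' f g := ext_coeff fun w => by simp [mul_add]
  map_smul' c f := ext_coeff fun w => by simp [mul_left_comm]

theorem coeff_degDer (f : NCSeries k n) (w : List (Fin n)) :
    (degDer k n f).coeff w = (w.length : k) * f.coeff w := rfl

theorem degDer_filtered : Filtered (degDer k n) := fun m f hf w hw => by
  rw [coeff_degDer, hf w hw, mul_zero]

theorem degDer_mul (f g : NCSeries k n) :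
    degDer k n (f * g) = degDer k n f * g + f * degDer k n g := by
  refine ext_coeff fun w => ?_
  rw [coeff_degDer, coeff_add, coeff_mul, coeff_mul, coeff_mul, Finset.mul_sum,
    ← Finset.sum_add_distrib]
  refine Finset.sum_congr rfl fun i hi => ?_
  have hi' : i ≤ w.length := Nat.lt_succ_iff.mp (Finset.mem_range.mp hi)
  have : (w.length : k) = ((w.take i).length : k) + ((w.drop i).length : k) := by
    rw [← Nat.cast_add, List.length_take, List.length_drop]
    congr 1; omega
  rw [coeff_degDer, coeff_degDer, this]
  ring

theorem degDer_one : degDer k n 1 = 0 := by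
  refine ext_coeff fun w => ?_
  rw [coeff_degDer, coeff_one]
  split_ifs with h
  · simp [h]
  · simp

theorem comp_degDer (d : ℕ) (f : NCSeries k n) : comp d (degDer k n f) = (d : k) • comp d f := by
  refine ext_coeff fun w => ?_
  rw [coeff_comp, coeff_smul, coeff_comp]
  split_ifs with h
  · rw [coeff_degDer, h]
  · simp

theorem IsGraded.degDer_mem {K : Submodule k (NCSeries k n)} (hK : IsGraded K) {f : NCSeries k n}
    (hf : f ∈ K) : degDer k n f ∈ K := by
  refine hK.mem_of_comp fun d => ?_
  rw [comp_degDer]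
  exact K.smul_mem _ (hK.comp_mem hf d)

theorem conj_pow {g h f : NCSeries k n} (N : ℕ) :
    ((LinearMap.mulRight k h ∘ₗ LinearMap.mulLeft k g : Module.End k (NCSeries k n)) ^ N) f =
      g ^ N * f * h ^ N := by
  induction N with
  | zero => simp
  | succ N ih =>
    rw [pow_succ', Module.End.mul_apply, ih, pow_succ' g, pow_succ h]
    simp [mul_assoc]

theorem conj_sub_one_raising {g h : NCSeries k n} (hg : g - 1 ∈ filt k n 1)
    (hh : h - 1 ∈ filt k n 1) : Raising
      ((LinearMap.mulRight k h ∘ₗ LinearMap.mulLeft k g : Module.End k (NCSeries k n)) - 1) := by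
  intro m f hf
  have : ((LinearMap.mulRight k h ∘ₗ LinearMap.mulLeft k g : Module.End k (NCSeries k n)) - 1) f =
      (g - 1) * f * h + f * (h - 1) := by
    simp [sub_mul, mul_sub]
  rw [this]
  exact add_mem (mul_mem_filt_right _ (add_comm 1 m ▸ mul_mem_filt hg hf)) (mul_mem_filt hf hh)

theorem adOp_mem_lieSeries {z : NCSeries k n} (hz : z ∈ LieSeries k n) {f : NCSeries k n}
    (hf : f ∈ (LieSeries k n).toSubmodule) : adOp z f ∈ (LieSeries k n).toSubmodule :=
  (LieSeries k n).lie_mem hz hf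

theorem ev_adOp_mem_lieSeries {z : NCSeries k n} (hz : z ∈ LieSeries k n) (r : PowerSeries k)
    {f : NCSeries k n} (hf : f ∈ LieSeries k n) :
    ev (adOp_raising (lieSeries_le_filt_one hz)) r f ∈ LieSeries k n :=
  isGraded_lieSeries.evalOp_mem (adOp_raising (lieSeries_le_filt_one hz))
    (fun _ => adOp_mem_lieSeries hz) _ hf

end LieSeriesBasic

section BCH

variable {k : Type*} [Field k] [CharZero k] {n : ℕ}

/-- In degree d > 0 the degree derivation is multiplication by d, which is invertible. -/
theorem IsGraded.mem_of_degDer_mem {K : Submodule k (NCSeries k n)} (hK : IsGraded K)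
    {f : NCSeries k n} (h0 : f ∈ filt k n 1) (hf : degDer k n f ∈ K) : f ∈ K := by
  refine hK.mem_of_comp fun d => ?_
  rcases Nat.eq_zero_or_pos d with rfl | hd
  · rw [comp_eq_zero Nat.zero_lt_one h0]
    exact zero_mem _
  · have h := hK.comp_mem hf d
    rw [comp_degDer] at h
    exact (Submodule.smul_mem_iff K (Nat.cast_ne_zero.mpr hd.ne')).mp h

theorem hasJet_exp_pow {z : NCSeries k n} (hz : z ∈ filt k n 1) :
    HasJet (fun N => exp z ^ N) 1 z := by
  have := hasJet_ev_exp_pow (raising_mulLeft hz) 1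
  simpa only [← evalSeries_eq_ev hz, evalSeries_pow hz, ← exp_eq, LinearMap.mulLeft_apply,
    mul_one] using this

/-- The N-th power of conjugation by e^z is conjugation by e^(Nz), whose linear coefficient in N is
⁅z, f⁆. So its logarithm is ad z. -/
theorem ev_exp_adOp {z : NCSeries k n} (hz : z ∈ filt k n 1) (f : NCSeries k n) :
    ev (adOp_raising hz) (PowerSeries.exp k) f = exp z * f * exp (-z) := by
  have hr := conj_sub_one_raising (exp_sub_one_mem hz) (exp_sub_one_mem (neg_mem hz))
  have h1 : logOp hr = adOp z := by
    refine LinearMap.ext fun f => ?_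
    have hj := hasJet_pow hr f
    simp only [conj_pow] at hj
    rw [hj.unique (((hasJet_exp_pow hz).mul (hasJet_const f)).mul (hasJet_exp_pow (neg_mem hz))),
      adOp_apply, LieRing.of_associative_ring_bracket]
    simp [sub_eq_add_neg]
  have h2 := LinearMap.congr_fun (ev_exp_logOp hr) f
  rw [ev_congr h1 _ (adOp_raising hz)] at h2
  simpa using h2

/-- Let E be the degree derivation. Then U_N = E(e^(Nz)) e^(-Nz) satisfies U_(N+1) = U_1 + e^(ad z)
U_N by the Leibniz rule and has linear coefficient E(z), so `IsGraded.cocycle_mem` applies with the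
zero subspace. -/
theorem degDer_exp_mul_exp_neg {z : NCSeries k n} (hz : z ∈ filt k n 1) :
    degDer k n (exp z) * exp (-z) = ev (adOp_raising hz) (phiSeries k) (degDer k n z) := by
  have hj := ((hasJet_exp_pow hz).map degDer_filtered).mul (hasJet_exp_pow (neg_mem hz))
  have h := isGraded_bot.cocycle_mem (adOp_raising hz) (fun f hf => by
    rw [Submodule.mem_bot] at hf ⊢; rw [hf, map_zero]) (by simp [degDer_one]) (fun N => ?_) hj
  · simpa [degDer_one, sub_eq_zero] using h
  · have e : exp z ^ N * exp (-z) ^ N = 1 := by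
      induction N with
      | zero => simp
      | succ N ih =>
        rw [pow_succ, pow_succ', mul_assoc, ← mul_assoc (exp z), exp_mul_exp_neg hz, one_mul, ih]
    rw [Submodule.mem_bot, ev_exp_adOp hz, sub_sub, sub_eq_zero, pow_succ', pow_succ _ N, degDer_mul,
      pow_one, pow_one, add_mul]
    congr 1
    · rw [mul_assoc, ← mul_assoc (exp z ^ N), e, one_mul]
    · simp only [mul_assoc]

theorem conj_mem_lieSeries {z : NCSeries k n} (hz : z ∈ LieSeries k n)
    {f : NCSeries k n} (hf : f ∈ LieSeries k n) : exp z * f * exp (-z) ∈ LieSeries k n := by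
  rw [← ev_exp_adOp (lieSeries_le_filt_one hz)]
  exact ev_adOp_mem_lieSeries hz _ hf

/-- The given Lie series is φ(ad z)(E z), with E the degree derivation: E z plus iterated brackets.
In degree d the brackets only involve components of z of degree below d, which are Lie by induction;
so d times the component of z is Lie, and d is invertible. -/
theorem mem_lieSeries_of_degDer_exp {z : NCSeries k n} (hz : z ∈ filt k n 1)
    (h : degDer k n (exp z) * exp (-z) ∈ LieSeries k n) : z ∈ LieSeries k n := by
  rw [degDer_exp_mul_exp_neg hz] at h
  rw [mem_lieSeries]
  intro d
  induction d using Nat.strong_induction_on with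
  | _ d ih =>
  rcases Nat.eq_zero_or_pos d with rfl | hd
  · rw [comp_eq_zero Nat.zero_lt_one hz]
    exact zero_mem _
  set z' := ∑ e ∈ Finset.range d, comp e z with hz'
  have hzL : z' ∈ LieSeries k n := sum_mem fun e he => liePoly_le_lieSeries
    (ih e (Finset.mem_range.mp he))
  have hz1 := lieSeries_le_filt_one hzL
  have hsub : z - z' ∈ filt k n d := sub_sum_comp_mem_filt d z
  -- Replacing z by its truncation z' changes terms with at least one bracket only above degree d,
  -- since every bracket adds at least one degree. For m = 0 the degree d part does change, and it
  -- is the part to be isolated.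
  have key : ∀ m, ((adOp z) ^ m) (degDer k n z) - ((adOp z') ^ m) (degDer k n z') ∈
      filt k n (if m = 0 then d else d + 1) := by
    intro m
    induction m with
    | zero => exact degDer_filtered.sub_mem hsub
    | succ m ihm =>
      rw [if_neg (Nat.succ_ne_zero m), pow_succ', pow_succ', Module.End.mul_apply,
        Module.End.mul_apply, adOp_apply, adOp_apply]
      set a := ((adOp z) ^ m) (degDer k n z)
      set b := ((adOp z') ^ m) (degDer k n z')
      have e : ⁅z, a⁆ - ⁅z', b⁆ = ⁅z - z', a⁆ + ⁅z', a - b⁆ := by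
        rw [sub_lie, lie_sub]; abel
      have ha : a ∈ filt k n 1 := filt_anti (by omega)
        ((adOp_raising hz).pow_mem m 1 (degDer_filtered 1 z hz))
      have hab : a - b ∈ filt k n d := filt_anti (by split_ifs <;> omega) ihm
      rw [e]
      exact add_mem (lie_mem_filt hsub ha) (add_comm 1 d ▸ lie_mem_filt hz1 hab)
  have hdiff : (ev (adOp_raising hz) (phiSeries k) (degDer k n z) - degDer k n z) -
      (ev (adOp_raising hz1) (phiSeries k) (degDer k n z') - degDer k n z') ∈
        filt k n (d + 1) := by
    have h1 := evalOp_sub_sum_mem (adOp_raising hz) (fun m => PowerSeries.coeff m (phiSeries k))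
      (degDer k n z) (d + 1)
    have h2 := evalOp_sub_sum_mem (adOp_raising hz1) (fun m => PowerSeries.coeff m (phiSeries k))
      (degDer k n z') (d + 1)
    rw [Finset.sum_range_succ'] at h1 h2
    have h3 := add_mem (sub_mem h1 h2) (sum_mem (t := Finset.range d)
      fun m _ => (filt k n (d + 1)).smul_mem
      (PowerSeries.coeff (m + 1) (phiSeries k)) (by simpa using key (m + 1)))
    simp only [smul_sub, Finset.sum_sub_distrib] at h3
    have h0 : PowerSeries.coeff 0 (phiSeries k) = 1 := by simp [phiSeries]
    rw [h0, one_smul, one_smul, pow_zero, pow_zero, Module.End.one_apply,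
      Module.End.one_apply] at h3
    rw [ev_apply, ev_apply]
    convert h3 using 1
    abel
  have h4 := comp_eq_of_sub_mem (Nat.lt_succ_self d) hdiff
  rw [comp_sub, comp_degDer] at h4
  have h5 : comp d (ev (adOp_raising hz1) (phiSeries k) (degDer k n z') - degDer k n z') ∈
      LiePoly k n :=
    sub_mem (ev_adOp_mem_lieSeries hzL _ (isGraded_lieSeries.degDer_mem hzL))
      (isGraded_lieSeries.degDer_mem hzL) d
  rw [← h4] at h5
  have h6 : (d : k) • comp d z ∈ (LiePoly k n).toSubmodule := by
    have := sub_mem (h d) h5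
    rwa [sub_sub_cancel] at this
  exact (Submodule.smul_mem_iff _ (Nat.cast_ne_zero.mpr hd.ne')).mp h6

/-- The Baker–Campbell–Hausdorff theorem: the exponentials of Lie series form a group. -/
theorem exists_exp_eq_mul {u v : NCSeries k n} (hu : u ∈ LieSeries k n) (hv : v ∈ LieSeries k n) :
    ∃ w ∈ LieSeries k n, exp w = exp u * exp v := by
  have hu1 := lieSeries_le_filt_one hu
  have hv1 := lieSeries_le_filt_one hv
  have hg : exp u * exp v - 1 ∈ filt k n 1 := by
    have : exp u * exp v - 1 = (exp u - 1) * exp v + (exp v - 1) := by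
      rw [sub_mul, one_mul]; abel
    rw [this]
    exact add_mem (mul_mem_filt_right _ (exp_sub_one_mem hu1)) (exp_sub_one_mem hv1)
  have hw1 := log_mem_filt hg
  refine ⟨log (exp u * exp v), mem_lieSeries_of_degDer_exp hw1 ?_, exp_log hg⟩
  have hinv : exp (-log (exp u * exp v)) = exp (-v) * exp (-u) := by
    have h1 := exp_neg_mul_exp hw1
    rw [exp_log hg] at h1
    calc exp (-log (exp u * exp v)) = exp (-log (exp u * exp v)) *
          (exp u * (exp v * exp (-v)) * exp (-u)) := by
            rw [exp_mul_exp_neg hv1, mul_one, exp_mul_exp_neg hu1, mul_one]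
      _ = exp (-log (exp u * exp v)) * (exp u * exp v) * (exp (-v) * exp (-u)) := by
            simp only [mul_assoc]
      _ = _ := by rw [h1, one_mul]
  rw [hinv, exp_log hg, degDer_mul]
  -- The logarithmic derivative of a product is that of e^u plus the conjugate by e^u of that of
  -- e^v; both are Lie series.
  have : (degDer k n (exp u) * exp v + exp u * degDer k n (exp v)) * (exp (-v) * exp (-u)) =
      degDer k n (exp u) * exp (-u) +
        exp u * (degDer k n (exp v) * exp (-v)) * exp (-u) := by
    rw [add_mul]
    congr 1
    · rw [mul_assoc, ← mul_assoc (exp v), exp_mul_exp_neg hv1, one_mul]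
    · simp only [mul_assoc]
  rw [this, degDer_exp_mul_exp_neg hu1, degDer_exp_mul_exp_neg hv1]
  exact add_mem (ev_adOp_mem_lieSeries hu _ (isGraded_lieSeries.degDer_mem hu))
    (conj_mem_lieSeries hu (ev_adOp_mem_lieSeries hv _ (isGraded_lieSeries.degDer_mem hv)))

end BCH

/-! ### Continuity of Lie algebra automorphisms -/

section Continuity

variable {k : Type*} [Field k] {n : ℕ}

theorem comp_X (d : ℕ) (i : Fin n) : comp d (X i : NCSeries k n) = if d = 1 then X i else 0 := by
  refine ext_coeff fun w => ?_
  by_cases hd : d = 1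
  · subst hd
    rw [if_pos rfl, coeff_comp, X, coeff_word]
    by_cases hw : w = [i]
    · simp [hw]
    · simp [hw]
  · rw [if_neg hd, coeff_comp, X, coeff_word, coeff_zero]
    by_cases hw : w = [i]
    · subst hw
      simp [Ne.symm hd]
    · simp [hw]

theorem comp_X_lie (e : ℕ) (i : Fin n) (f : NCSeries k n) :
    comp (e + 1) ⁅(X i : NCSeries k n), f⁆ = ⁅(X i : NCSeries k n), comp e f⁆ := by
  rw [LieRing.of_associative_ring_bracket, LieRing.of_associative_ring_bracket, comp_sub, comp_mul,
    comp_mul, Finset.sum_eq_single (1, e), Finset.sum_eq_single (e, 1)]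
  · simp [comp_X]
  · rintro ⟨a, b⟩ h hne
    have := Finset.HasAntidiagonal.mem_antidiagonal.mp h
    simp only [comp_X]
    rw [if_neg, mul_zero]
    rintro rfl
    exact hne (by simp at this ⊢; exact this)
  · intro h; exact (h (Finset.HasAntidiagonal.mem_antidiagonal.mpr (by simp))).elim
  · rintro ⟨a, b⟩ h hne
    have := Finset.HasAntidiagonal.mem_antidiagonal.mp h
    simp only [comp_X]
    rw [if_neg, zero_mul]
    rintro rfl
    exact hne (by simp at this ⊢; omega)
  · intro h; exact (h (Finset.HasAntidiagonal.mem_antidiagonal.mpr (by simp [add_comm]))).elim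

/-- The map `(f_1, …, f_n) ↦ ∑ i, ⁅x_i, f_i⁆` on tuples of Lie polynomials. -/
def sumAdX (k : Type*) [Field k] (n : ℕ) :
    (Fin n → (LiePoly k n).toSubmodule) →ₗ[k] NCSeries k n :=
  LinearMap.lsum k _ k fun i => adOp (X i) ∘ₗ (LiePoly k n).toSubmodule.subtype

theorem sumAdX_apply (f : Fin n → (LiePoly k n).toSubmodule) :
    sumAdX k n f = ∑ i, ⁅(X i : NCSeries k n), (f i : NCSeries k n)⁆ := by
  simp [sumAdX, LinearMap.lsum_apply, adOp_apply]

/-- The Jacobi identity ⁅⁅f, f'⁆, g⁆ = ⁅f, ⁅f', g⁆⁆ - ⁅f', ⁅f, g⁆⁆ reduces to f a generator; the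
induction needs g arbitrary. -/
theorem lie_mem_range_sumAdX {f : NCSeries k n} (hf : f ∈ LiePoly k n) :
    ∀ g ∈ LiePoly k n, ⁅f, g⁆ ∈ LinearMap.range (sumAdX k n) := by
  induction hf using LieSubalgebra.lieSpan_induction with
  | mem f h =>
    obtain ⟨i, rfl⟩ := h
    intro g hg
    refine ⟨Pi.single i ⟨g, hg⟩, ?_⟩
    rw [sumAdX_apply, Finset.sum_eq_single i]
    · simp
    · intro j _ hj
      simp [hj]
    · simp
  | zero => intro g _; rw [zero_lie]; exact zero_mem _
  | add f f' _ _ ih ih' => intro g hg; rw [add_lie]; exact add_mem (ih g hg) (ih' g hg)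
  | smul c f _ ih => intro g hg; rw [smul_lie]; exact Submodule.smul_mem _ c (ih g hg)
  | lie f f' hf hf' ih ih' =>
    intro g hg
    rw [lie_lie]
    exact sub_mem (ih _ ((LiePoly k n).lie_mem hf' hg)) (ih' _ ((LiePoly k n).lie_mem hf hg))

theorem liePoly_decomposition {f : NCSeries k n} (hf : f ∈ LiePoly k n) :
    ∃ l ∈ Submodule.span k (Set.range (X : Fin n → NCSeries k n)),
      ∃ g : Fin n → NCSeries k n, (∀ i, g i ∈ LiePoly k n) ∧ f = l + ∑ i, ⁅(X i : NCSeries k n), g i⁆ := by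
  have h : f ∈ Submodule.span k (Set.range (X : Fin n → NCSeries k n)) ⊔
      LinearMap.range (sumAdX k n) := by
    induction hf using LieSubalgebra.lieSpan_induction with
    | mem f h => exact Submodule.mem_sup_left (Submodule.subset_span h)
    | zero => exact zero_mem _
    | add f f' _ _ ih ih' => exact add_mem ih ih'
    | smul c f _ ih => exact Submodule.smul_mem _ c ih
    | lie f f' hf hf' _ _ => exact Submodule.mem_sup_right (lie_mem_range_sumAdX hf f' hf')
  obtain ⟨l, hl, r, ⟨g, rfl⟩, rfl⟩ := Submodule.mem_sup.mp h
  exact ⟨l, hl, fun i => g i, fun i => (g i).2, by rw [sumAdX_apply]⟩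

theorem comp_span_X {l : NCSeries k n} (hl : l ∈ Submodule.span k (Set.range X)) {d : ℕ}
    (hd : d ≠ 1) : comp d l = 0 := by
  have : Submodule.span k (Set.range X) ≤ LinearMap.ker (compL k n d) := by
    rw [Submodule.span_le]
    rintro _ ⟨i, rfl⟩
    exact (comp_X d i).trans (if_neg hd)
  exact this hl

/-- A Lie series without terms of degree `≤ m`, where `m ≥ 1`, is of the form `∑ i, ⁅x_i, g_i⁆`
for Lie series `g_i` without terms of degree `< m`. -/
theorem lieSeries_decomposition {f : NCSeries k n} (hf : f ∈ LieSeries k n) {m : ℕ} (hm : 1 ≤ m)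
    (hfm : f ∈ filt k n (m + 1)) : ∃ g : Fin n → LieSeries k n,
      (∀ i, (g i : NCSeries k n) ∈ filt k n m) ∧ f = ∑ i, ⁅(X i : NCSeries k n), (g i : NCSeries k n)⁆ := by
  choose l hl g hg hfg using fun d => liePoly_decomposition (hf d)
  -- The degree e component of g_i comes from the decomposition of the degree e + 1 component of f.
  -- Components with e < m may be discarded, as f has none in degree e + 1 ≤ m.
  let G : Fin n → NCSeries k n := fun i =>
    ⟨fun w => if w.length < m then 0 else (g (w.length + 1) i).coeff w⟩
  have hG : ∀ i e, comp e (G i) = if e < m then 0 else comp e (g (e + 1) i) := by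
    intro i e
    refine ext_coeff fun w => ?_
    rw [coeff_comp]
    by_cases hw : w.length = e
    · subst hw
      simp only [G, if_true]
      split_ifs
      · rfl
      · simp [coeff_comp]
    · rw [if_neg hw]
      split_ifs
      · rfl
      · simp [coeff_comp, hw]
  have hGL : ∀ i, G i ∈ LieSeries k n := by
    intro i e
    rw [hG]
    split_ifs
    · exact zero_mem _
    · exact liePoly_le_lieSeries (hg _ i) e
  refine ⟨fun i => ⟨G i, hGL i⟩, fun i w hw => if_pos hw, ext_comp fun d => ?_⟩
  have hs : comp d (∑ i, ⁅(X i : NCSeries k n), G i⁆) = ∑ i, comp d ⁅(X i : NCSeries k n), G i⁆ := map_sum (compL k n d) _ _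
  rw [hs]
  cases d with
  | zero =>
    rw [comp_eq_zero (Nat.succ_pos m) hfm]
    exact (Finset.sum_eq_zero fun i _ => comp_eq_zero Nat.zero_lt_one
      (mem_filt_one.mpr (lie_coeff_nil _ _))).symm
  | succ e =>
    simp only [comp_X_lie, hG]
    by_cases he : e < m
    · rw [comp_eq_zero (Nat.succ_lt_succ he) hfm]
      simp [he]
    · simp only [he, if_false]
      have h1 := congrArg (comp (e + 1)) (hfg (e + 1))
      rw [comp_comp, if_pos rfl, comp_add, comp_span_X (hl _) (by omega), zero_add] at h1
      rw [h1]
      have hs' : comp (e + 1) (∑ i, ⁅(X i : NCSeries k n), g (e + 1) i⁆) = ∑ i, comp (e + 1) ⁅(X i : NCSeries k n), g (e + 1) i⁆ :=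
        map_sum (compL k n (e + 1)) _ _
      rw [hs']
      simp only [comp_X_lie]

/-- Automatic continuity. A Lie series starting in degree m + 1 ≥ 2 is a finite sum of brackets
⁅x_i, g_i⁆ with g_i starting in degree m, and α respects brackets. -/
theorem LieAut.map_mem_filt (α : LieAut k n) (m : ℕ) : ∀ f : LieSeries k n,
    (f : NCSeries k n) ∈ filt k n m → (α f : NCSeries k n) ∈ filt k n m := by
  induction m with
  | zero => exact fun f _ => mem_filt_zero _
  | succ m ih =>
    intro f hf
    rcases Nat.eq_zero_or_pos m with rfl | hm
    · exact LieSeries.mem_filt_one _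
    · obtain ⟨g, hg, hfg⟩ := lieSeries_decomposition f.2 hm hf
      have e : f = ∑ i, ⁅gen k i, g i⁆ := by
        apply Subtype.ext
        rw [hfg, AddSubmonoidClass.coe_finsetSum]
        rfl
      rw [e, map_sum, AddSubmonoidClass.coe_finsetSum]
      refine sum_mem fun i _ => ?_
      rw [LieEquiv.map_lie, LieSubalgebra.coe_bracket, add_comm]
      exact lie_mem_filt (LieSeries.mem_filt_one _) (ih _ (hg i))

end Continuity

/-! ### Continuous algebra endomorphisms -/

section ContHom

variable {k : Type*} [Field k] {n : ℕ}

/-- Unital multiplicative linear maps which do not lower the degree. -/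
structure IsContHom (Φ : NCSeries k n →ₗ[k] NCSeries k n) : Prop where
  filtered : Filtered Φ
  map_one : Φ 1 = 1
  map_mul : ∀ f g, Φ (f * g) = Φ f * Φ g

theorem IsContHom.ext {Φ Ψ : NCSeries k n →ₗ[k] NCSeries k n} (hΦ : IsContHom Φ)
    (hΨ : IsContHom Ψ) (h : ∀ i, Φ (X i) = Ψ (X i)) : Φ = Ψ := by
  refine filtered_ext hΦ.filtered hΨ.filtered fun v => ?_
  induction v with
  | nil => rw [← one_eq_word, hΦ.map_one, hΨ.map_one]
  | cons i v ih => rw [word_cons, hΦ.map_mul, hΨ.map_mul, h, ih]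

theorem IsContHom.comp {Φ Ψ : NCSeries k n →ₗ[k] NCSeries k n} (hΦ : IsContHom Φ)
    (hΨ : IsContHom Ψ) : IsContHom (Φ ∘ₗ Ψ) where
  filtered := hΦ.filtered.comp hΨ.filtered
  map_one := by rw [LinearMap.comp_apply, hΨ.map_one, hΦ.map_one]
  map_mul f g := by simp only [LinearMap.comp_apply, hΨ.map_mul, hΦ.map_mul]

theorem isContHom_id : IsContHom (LinearMap.id : NCSeries k n →ₗ[k] NCSeries k n) where
  filtered := fun _ _ h => h
  map_one := rfl
  map_mul _ _ := rfl

theorem IsContHom.map_lie {Φ : NCSeries k n →ₗ[k] NCSeries k n} (hΦ : IsContHom Φ)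
    (f g : NCSeries k n) : Φ ⁅f, g⁆ = ⁅Φ f, Φ g⁆ := by
  rw [LieRing.of_associative_ring_bracket, LieRing.of_associative_ring_bracket, map_sub,
    hΦ.map_mul, hΦ.map_mul]

theorem IsContHom.map_evalSeries {Φ : NCSeries k n →ₗ[k] NCSeries k n} (hΦ : IsContHom Φ)
    (r : PowerSeries k) {f : NCSeries k n} (hf : f ∈ filt k n 1) :
    Φ (evalSeries r f) = evalSeries r (Φ f) :=
  KashiwaraVergne.map_evalSeries hΦ.filtered hΦ.map_one hΦ.map_mul r hf

theorem raising_of_word {D : NCSeries k n →ₗ[k] NCSeries k n} (hD : Filtered D)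
    (h : ∀ v, D (word v) ∈ filt k n (v.length + 1)) : Raising D := by
  have hw : D = wordExt fun v => D (word v) := filtered_ext hD (wordExt_filtered _) fun v =>
    (wordExt_word (b := fun v => D (word v)) (hD _ _ (word_mem_filt v))).symm
  intro m f hf w hw'
  rw [hw, coeff_wordExt]
  refine Finset.sum_eq_zero fun d hd => Finset.sum_eq_zero fun v _ => ?_
  by_cases hdm : d < m
  · rw [hf _ (by simpa using hdm), zero_mul]
  · rw [h _ w (by rw [List.length_ofFn]; omega), mul_zero]

theorem IsContHom.sub_one_raising {Φ : Module.End k (NCSeries k n)} (hΦ : IsContHom Φ)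
    (h : ∀ i, Φ (X i) - X i ∈ filt k n 2) : Raising (Φ - 1) := by
  refine raising_of_word (hΦ.filtered.sub isContHom_id.filtered) fun v => ?_
  rw [LinearMap.sub_apply, Module.End.one_apply]
  induction v with
  | nil => rw [← one_eq_word, hΦ.map_one, sub_self]; exact zero_mem _
  | cons i v ih =>
    rw [word_cons, hΦ.map_mul]
    have e : Φ (X i) * Φ (word v) - X i * word v =
        (Φ (X i) - X i) * Φ (word v) + X i * (Φ (word v) - word v) := by
      rw [sub_mul, mul_sub]; abel
    rw [e, List.length_cons]
    refine add_mem ?_ ?_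
    · have := mul_mem_filt (h i) (hΦ.filtered _ _ (word_mem_filt v))
      exact filt_anti (by omega) this
    · have := mul_mem_filt (X_mem_filt i) ih
      exact filt_anti (by omega) this

/-- The continuous algebra endomorphism `x_i ↦ a_i`. -/
def substHom (a : Fin n → NCSeries k n) : Module.End k (NCSeries k n) :=
  wordExt fun v => (v.map a).prod

theorem prod_map_mem_filt {a : Fin n → NCSeries k n} (ha : ∀ i, a i ∈ filt k n 1)
    (v : List (Fin n)) : (v.map a).prod ∈ filt k n v.length := by
  induction v with
  | nil => exact mem_filt_zero _
  | cons i v ih =>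
    rw [List.map_cons, List.prod_cons, List.length_cons, add_comm]
    exact mul_mem_filt (ha i) ih

theorem substHom_word {a : Fin n → NCSeries k n} (ha : ∀ i, a i ∈ filt k n 1)
    (v : List (Fin n)) : substHom a (word v) = (v.map a).prod :=
  wordExt_word (prod_map_mem_filt ha v)

theorem isContHom_substHom {a : Fin n → NCSeries k n} (ha : ∀ i, a i ∈ filt k n 1) :
    IsContHom (substHom a) where
  filtered := wordExt_filtered _
  map_one := by rw [one_eq_word, substHom_word ha, List.map_nil, List.prod_nil]; rfl
  map_mul := (wordExt_filtered _).map_mul_of_word fun v w => by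
    have h := substHom_word ha
    rw [substHom] at h
    rw [h, h, h, List.map_append, List.prod_append]

theorem substHom_X {a : Fin n → NCSeries k n} (ha : ∀ i, a i ∈ filt k n 1) (i : Fin n) :
    substHom a (X i) = a i := by
  rw [X, substHom_word ha]; simp

/-- The extension of an automorphism of the completed free Lie algebra to a continuous
endomorphism of the completed free associative algebra. -/
def LieAut.hat (α : LieAut k n) : Module.End k (NCSeries k n) :=
  substHom fun i => (α (gen k i) : NCSeries k n)

theorem LieAut.isContHom_hat (α : LieAut k n) : IsContHom (LieAut.hat α) :=
  isContHom_substHom fun _ => LieSeries.mem_filt_one _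

theorem LieAut.hat_X (α : LieAut k n) (i : Fin n) :
    LieAut.hat α (X i) = (α (gen k i) : NCSeries k n) :=
  substHom_X (fun _ => LieSeries.mem_filt_one _) i

/-- The two maps agree on Lie polynomials, which the x_i generate; continuity of α extends this to
Lie series. -/
theorem LieAut.hat_coe (α : LieAut k n) (f : LieSeries k n) :
    LieAut.hat α (f : NCSeries k n) = (α f : NCSeries k n) := by
  have hp : ∀ g (hg : g ∈ LiePoly k n), LieAut.hat α g = (α ⟨g, liePoly_le_lieSeries hg⟩ :
      NCSeries k n) := by
    intro g hg
    induction hg using LieSubalgebra.lieSpan_induction with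
    | mem g h => obtain ⟨i, rfl⟩ := h; exact LieAut.hat_X α i
    | zero =>
      rw [map_zero]
      exact (congrArg Subtype.val (map_zero α)).symm
    | add f g hf hg ihf ihg =>
      rw [map_add, ihf, ihg]
      exact (congrArg Subtype.val (map_add α ⟨f, liePoly_le_lieSeries hf⟩
        ⟨g, liePoly_le_lieSeries hg⟩)).symm
    | smul c f hf ihf =>
      rw [map_smul, ihf]
      exact (congrArg Subtype.val (map_smul α c ⟨f, liePoly_le_lieSeries hf⟩)).symm
    | lie f g hf hg ihf ihg =>
      rw [(LieAut.isContHom_hat α).map_lie, ihf, ihg]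
      exact (congrArg Subtype.val (LieEquiv.map_lie α ⟨f, liePoly_le_lieSeries hf⟩
        ⟨g, liePoly_le_lieSeries hg⟩)).symm
  refine eq_of_forall_sub_mem_filt fun M => ?_
  have hg : ∑ d ∈ Finset.range M, comp d (f : NCSeries k n) ∈ LiePoly k n :=
    sum_mem fun d _ => f.2 d
  have hs := sub_sum_comp_mem_filt M (f : NCSeries k n)
  have h1 := (LieAut.isContHom_hat α).filtered.sub_mem hs
  rw [hp _ hg] at h1
  have h2 := LieAut.map_mem_filt α M (f - ⟨_, liePoly_le_lieSeries hg⟩) hs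
  rw [map_sub] at h2
  simpa using sub_mem h1 h2

theorem LieAut.hat_mul (α β : LieAut k n) :
    LieAut.hat (α * β) = LieAut.hat α * LieAut.hat β :=
  (LieAut.isContHom_hat _).ext ((LieAut.isContHom_hat α).comp (LieAut.isContHom_hat β)) fun i => by
    rw [LieAut.hat_X, Module.End.mul_apply, LieAut.hat_X, LieAut.hat_coe]
    rfl

theorem LieAut.hat_refl : LieAut.hat (LieEquiv.refl : LieAut k n) = 1 :=
  (LieAut.isContHom_hat _).ext isContHom_id fun i => LieAut.hat_X _ i

theorem LieAut.hat_pow_zero (α : LieAut k n) : LieAut.hat (α ^ 0) = 1 := by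
  rw [pow_zero]; exact LieAut.hat_refl

theorem LieAut.hat_pow (α : LieAut k n) (N : ℕ) : LieAut.hat (α ^ N) = LieAut.hat α ^ N := by
  induction N with
  | zero => rw [LieAut.hat_pow_zero, pow_zero]
  | succ N ih => rw [pow_succ, pow_succ, LieAut.hat_mul, ih]

theorem LieAut.hat_hat_inv (α : LieAut k n) (f : NCSeries k n) :
    LieAut.hat α (LieAut.hat α⁻¹ f) = f := by
  rw [← Module.End.mul_apply, ← LieAut.hat_mul, mul_inv_cancel]
  exact LinearMap.congr_fun LieAut.hat_refl f

theorem LieAut.hat_inv_hat (α : LieAut k n) (f : NCSeries k n) :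
    LieAut.hat α⁻¹ (LieAut.hat α f) = f := by
  rw [← Module.End.mul_apply, ← LieAut.hat_mul, inv_mul_cancel]
  exact LinearMap.congr_fun LieAut.hat_refl f

theorem tanDerWord_mem_filt (u : Fin n → LieSeries k n) (v : List (Fin n)) :
    tanDerWord u v ∈ filt k n (v.length + 1) := by
  induction v with
  | nil => exact zero_mem _
  | cons i v ih =>
    rw [tanDerWord, List.length_cons]
    refine add_mem ?_ ?_
    · have := mul_mem_filt (lie_mem_filt (LieSeries.mem_filt_one (u i)) (X_mem_filt i))
        (word_mem_filt (k := k) v)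
      exact filt_anti (by omega) this
    · have := mul_mem_filt (X_mem_filt i) ih
      exact filt_anti (by omega) this

theorem tanDer_word (u : Fin n → LieSeries k n) (v : List (Fin n)) :
    tanDer u (word v) = tanDerWord u v :=
  wordExt_word (filt_anti (Nat.le_succ _) (tanDerWord_mem_filt u v))

theorem tanDer_raising (u : Fin n → LieSeries k n) : Raising (tanDer u) :=
  raising_of_word (wordExt_filtered _) fun v => by
    rw [tanDer_word]; exact tanDerWord_mem_filt u v

theorem tanDer_X (u : Fin n → LieSeries k n) (i : Fin n) :
    tanDer u (X i) = ⁅(u i : NCSeries k n), X i⁆ := by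
  rw [X, tanDer_word, tanDerWord, tanDerWord, ← one_eq_word, mul_one, mul_zero, add_zero]
  rfl

end ContHom

/-! ### Logarithms of tangential automorphisms -/

section Tangential

variable {k : Type*} [Field k] [CharZero k] {n : ℕ}

theorem exp_zero : exp (0 : NCSeries k n) = 1 := by
  refine ext_coeff fun w => ?_
  rw [exp_eq]
  simp only [evalSeries]
  rw [Finset.sum_range_succ']
  simp

theorem LieAut.hat_exp (α : LieAut k n) (f : LieSeries k n) :
    LieAut.hat α (exp (f : NCSeries k n)) = exp (α f : NCSeries k n) := by
  rw [exp_eq, exp_eq, (LieAut.isContHom_hat α).map_evalSeries _ (LieSeries.mem_filt_one f),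
    LieAut.hat_coe]

theorem LieAut.hat_exp_neg (α : LieAut k n) (f : LieSeries k n) :
    LieAut.hat α (exp (-f : NCSeries k n)) = exp (-α f : NCSeries k n) := by
  have := LieAut.hat_exp α (-f)
  rw [map_neg] at this
  exact this

theorem exp_neg_eq_of_mul_eq_one {w g : NCSeries k n} (hw : w ∈ filt k n 1) (h : exp w * g = 1) :
    exp (-w) = g := by
  calc exp (-w) = exp (-w) * (exp w * g) := by rw [h, mul_one]
    _ = g := by rw [← mul_assoc, exp_neg_mul_exp hw, one_mul]

/-- The conjugating element is e^(α v) e^u, a single exponential by Baker–Campbell–Hausdorff. -/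
theorem LieConj.map_mul {α β : LieAut k n} {a b c : LieSeries k n} (h : LieConj (β a) b)
    (h' : LieConj (α b) c) : LieConj ((α * β) a) c := by
  obtain ⟨v, hv⟩ := h
  obtain ⟨u, hu⟩ := h'
  obtain ⟨w, hwL, hw⟩ := exists_exp_eq_mul (α v).2 u.2
  have hu1 := LieSeries.mem_filt_one u
  have hv1 := LieSeries.mem_filt_one (α v)
  refine ⟨⟨w, hwL⟩, ?_⟩
  have hneg : exp (-w) = exp (-u : NCSeries k n) * exp (-α v : NCSeries k n) := by
    refine exp_neg_eq_of_mul_eq_one (lieSeries_le_filt_one hwL) ?_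
    rw [hw, mul_assoc, ← mul_assoc (exp (u : NCSeries k n)), exp_mul_exp_neg hu1, one_mul,
      exp_mul_exp_neg hv1]
  have e : ((α * β) a : NCSeries k n) = LieAut.hat α (β a : NCSeries k n) :=
    (LieAut.hat_coe α (β a)).symm
  rw [e, hv, (LieAut.isContHom_hat α).map_mul, (LieAut.isContHom_hat α).map_mul, LieAut.hat_exp,
    LieAut.hat_exp_neg, LieAut.hat_coe, hu, hw, hneg]
  simp only [mul_assoc]

theorem LieConj.map_inv {α : LieAut k n} {a b : LieSeries k n} (h : LieConj (α a) b) :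
    LieConj (α⁻¹ b) a := by
  obtain ⟨u, hu⟩ := h
  have h1 := congrArg (LieAut.hat α⁻¹) hu
  rw [LieAut.hat_coe, (LieAut.isContHom_hat _).map_mul, (LieAut.isContHom_hat _).map_mul,
    LieAut.hat_exp, LieAut.hat_exp_neg, LieAut.hat_coe] at h1
  have h2 : α⁻¹ (α a) = a := α.symm_apply_apply a
  rw [h2] at h1
  have hv := LieSeries.mem_filt_one (α⁻¹ u)
  refine ⟨-α⁻¹ u, ?_⟩
  have e1 : ((-α⁻¹ u : LieSeries k n) : NCSeries k n) = -(α⁻¹ u : NCSeries k n) := rfl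
  rw [e1, neg_neg, h1]
  set U := exp (α⁻¹ u : NCSeries k n)
  set V := exp (-α⁻¹ u : NCSeries k n)
  have hVU : V * U = 1 := exp_neg_mul_exp hv
  calc _ = (V * U) * (α⁻¹ b : NCSeries k n) * (V * U) := by rw [hVU, one_mul, mul_one]
    _ = _ := by simp only [mul_assoc]

/-- The exponential commutes with conjugation and is injective. -/
theorem groupConj_iff_lieConj {a b : LieSeries k n} : GroupConj a b ↔ LieConj a b := by
  refine exists_congr fun u => ?_
  have hu := LieSeries.mem_filt_one u
  have hb := LieSeries.mem_filt_one b
  have h := exp_conj hb (exp_mul_exp_neg hu) (exp_neg_mul_exp hu)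
  refine ⟨fun h' => ?_, fun h' => by rw [h', h]⟩
  rw [← h] at h'
  exact exp_injOn (LieSeries.mem_filt_one a)
    (mul_mem_filt_right _ (mul_mem_filt_left _ hb)) h'

/-- The group of tangential automorphisms. -/
def tangential (k : Type*) [Field k] [CharZero k] (n : ℕ) : Subgroup (LieAut k n) where
  carrier := {α | ∀ i, LieConj (α (gen k i)) (gen k i)}
  mul_mem' hα hβ i := (hβ i).map_mul (hα i)
  one_mem' i := ⟨0, by
    rw [ZeroMemClass.coe_zero, neg_zero, exp_zero, one_mul, mul_one]
    rfl⟩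
  inv_mem' hα i := (hα i).map_inv

theorem mem_tangential {α : LieAut k n} :
    α ∈ tangential k n ↔ ∀ i, LieConj (α (gen k i)) (gen k i) := Iff.rfl

theorem hat_X_sub_X_mem {α : LieAut k n} (hα : α ∈ tangential k n) (i : Fin n) :
    LieAut.hat α (X i) - X i ∈ filt k n 2 := by
  obtain ⟨u, hu⟩ := hα i
  have hu1 := LieSeries.mem_filt_one u
  rw [LieAut.hat_X, hu]
  have := conj_sub_one_raising (exp_sub_one_mem hu1) (exp_sub_one_mem (neg_mem hu1)) 1 _
    (X_mem_filt (k := k) i)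
  simpa [gen] using this

theorem hat_sub_one_raising {α : LieAut k n} (hα : α ∈ tangential k n) :
    Raising (LieAut.hat α - 1) :=
  (LieAut.isContHom_hat α).sub_one_raising (hat_X_sub_X_mem hα)

/-- The logarithm of a tangential automorphism. -/
def tanLog {α : LieAut k n} (hα : α ∈ tangential k n) : Module.End k (NCSeries k n) :=
  logOp (hat_sub_one_raising hα)

theorem tanLog_raising {α : LieAut k n} (hα : α ∈ tangential k n) : Raising (tanLog hα) :=
  logOp_raising _

theorem ev_exp_tanLog {α : LieAut k n} (hα : α ∈ tangential k n) :
    ev (tanLog_raising hα) (PowerSeries.exp k) = LieAut.hat α := ev_exp_logOp _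

theorem hasJet_hat_pow {α : LieAut k n} (hα : α ∈ tangential k n) (f : NCSeries k n) :
    HasJet (fun N => LieAut.hat (α ^ N) f) f (tanLog hα f) := by
  simp only [LieAut.hat_pow]
  exact hasJet_pow (hat_sub_one_raising hα) f

/-- Every power of α is multiplicative; taking linear coefficients in N turns this into the Leibniz
rule. -/
theorem tanLog_mul {α : LieAut k n} (hα : α ∈ tangential k n) (f g : NCSeries k n) :
    tanLog hα (f * g) = tanLog hα f * g + f * tanLog hα g := by
  have h := hasJet_hat_pow hα (f * g)
  simp only [(LieAut.isContHom_hat _).map_mul] at h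
  exact h.unique ((hasJet_hat_pow hα f).mul (hasJet_hat_pow hα g))

theorem tanLog_one {α : LieAut k n} (hα : α ∈ tangential k n) : tanLog hα 1 = 0 := by
  have h := hasJet_hat_pow hα 1
  simp only [(LieAut.isContHom_hat _).map_one] at h
  exact h.unique (hasJet_const 1)

/-- If α x_i = g x_i g⁻¹, then α^N x_i is the conjugate of x_i by c_N, where c_0 = 1 and c_(N+1) =
α(c_N) g. Each c_N is the exponential of a Lie series. Comparing linear coefficients in α^N(x_i) c_N
= c_N x_i gives D x_i = ⁅c, x_i⁆, with c the linear coefficient of c_N. -/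
theorem exists_tanLog_X {α : LieAut k n} (hα : α ∈ tangential k n) (i : Fin n) :
    ∃ u : LieSeries k n, tanLog hα (X i) = ⁅(u : NCSeries k n), X i⁆ := by
  obtain ⟨u, hu⟩ := hα i
  have hu1 := LieSeries.mem_filt_one u
  set g := exp (u : NCSeries k n) with hg
  have hα' := LieAut.isContHom_hat α
  -- The powers of this operator applied to 1 are the conjugators c_N, which shows that they are
  -- polynomial in N.
  let T : Module.End k (NCSeries k n) := LinearMap.mulRight k g ∘ₗ LieAut.hat α
  have hTa : ∀ f, T f = LieAut.hat α f * g := fun f => rfl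
  have hT : Raising (T - 1) := by
    intro m f hf
    have : (T - 1) f = (LieAut.hat α - 1) f * g + f * (g - 1) := by
      rw [LinearMap.sub_apply, LinearMap.sub_apply, hTa]
      simp [sub_mul, mul_sub]
    rw [this]
    exact add_mem (mul_mem_filt_right _ (hat_sub_one_raising hα m f hf))
      (mul_mem_filt hf (exp_sub_one_mem hu1))
  have hj := hasJet_pow hT 1
  set c := logOp hT 1
  have hc1 : c ∈ filt k n 1 := logOp_raising hT 0 1 (mem_filt_zero 1)
  have hexp : ∀ N, ∃ w ∈ LieSeries k n, (T ^ N) 1 = exp w := by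
    intro N
    induction N with
    | zero =>
      refine ⟨0, zero_mem _, ?_⟩
      rw [exp_zero, pow_zero, Module.End.one_apply]
    | succ N ih =>
      obtain ⟨w, hw, hTw⟩ := ih
      obtain ⟨w', hw', h⟩ := exists_exp_eq_mul (α ⟨w, hw⟩).2 u.2
      refine ⟨w', hw', ?_⟩
      rw [pow_succ', Module.End.mul_apply, hTw, hTa, h, ← LieAut.hat_exp]
  -- As log(1 + t) = t + ⋯, the sequences c_N and log c_N have the same linear coefficient, and log
  -- c_N is Lie for every N.
  have hcL : c ∈ LieSeries k n := by
    have hl := ((hj.sub (hasJet_const 1)).sub (hasJet_const 0))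
    simp only [sub_self, sub_zero] at hl
    have h1 := hl.evalSeries hc1 (PowerSeries.log k)
    rw [PowerSeries.coeff_one_log, one_smul] at h1
    refine isGraded_lieSeries.jet_mem h1 fun N => ?_
    obtain ⟨w, hw, h⟩ := hexp N
    rw [h, ← log_eq, log_exp (lieSeries_le_filt_one hw)]
    exact hw
  refine ⟨⟨c, hcL⟩, ?_⟩
  have hcomm : ∀ N, LieAut.hat (α ^ N) (X i) * (T ^ N) 1 = (T ^ N) 1 * X i := by
    intro N
    induction N with
    | zero => rw [LieAut.hat_pow_zero]; simp
    | succ N ih =>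
      have e1 : LieAut.hat (α ^ (N + 1)) (X i) = LieAut.hat α (LieAut.hat (α ^ N) (X i)) := by
        rw [pow_succ', LieAut.hat_mul, Module.End.mul_apply]
      rw [e1, pow_succ', Module.End.mul_apply, hTa, ← mul_assoc, ← hα'.map_mul, ih, hα'.map_mul,
        LieAut.hat_X, hu]
      have e2 : exp (-u : NCSeries k n) * g = 1 := exp_neg_mul_exp hu1
      simp only [mul_assoc, e2, mul_one]
      rfl
  have h1 := (hasJet_hat_pow hα (X i)).mul hj
  simp only [hcomm] at h1
  have h2 := h1.unique (hj.mul (hasJet_const (X i)))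
  rw [mul_one, mul_zero, add_zero] at h2
  rw [LieRing.of_associative_ring_bracket]
  exact eq_sub_of_add_eq h2

theorem tanLog_eq_tanDer {α : LieAut k n} (hα : α ∈ tangential k n) {u : Fin n → LieSeries k n}
    (h : ∀ i, tanLog hα (X i) = ⁅(u i : NCSeries k n), X i⁆) : tanLog hα = tanDer u := by
  refine filtered_ext (tanLog_raising hα).filtered (tanDer_raising u).filtered fun v => ?_
  rw [tanDer_word]
  induction v with
  | nil => exact tanLog_one hα
  | cons i v ih => rw [word_cons, tanLog_mul, h, ih, tanDerWord]

theorem evalOp_exp_eq_ev {D : Module.End k (NCSeries k n)} (hD : Raising D) (f : NCSeries k n) :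
    evalOp (fun m => ((m.factorial : k))⁻¹) D f = ev hD (PowerSeries.exp k) f := by
  rw [ev_apply, coeff_exp_eq]

theorem exists_isExpOf {α : LieAut k n} (hα : α ∈ tangential k n) :
    ∃ u : Fin n → LieSeries k n, Normalized u ∧ IsExpOf α u := by
  choose v hv using exists_tanLog_X hα
  -- Removing the x_i term normalizes u_i without changing ⁅u_i, x_i⁆.
  let u : Fin n → LieSeries k n := fun i => v i - (v i : NCSeries k n).coeff [i] • gen k i
  have hu : ∀ i, (u i : NCSeries k n) =
      (v i : NCSeries k n) - (v i : NCSeries k n).coeff [i] • X i := fun i => rfl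
  refine ⟨u, fun i => ?_, fun f => ?_⟩
  · rw [hu, coeff_sub, coeff_smul, X, coeff_word]
    simp
  · have h : tanLog hα = tanDer u := tanLog_eq_tanDer hα fun i => by
      rw [hv, hu, sub_lie, smul_lie, lie_self, smul_zero, sub_zero]
    rw [← LieAut.hat_coe, ← ev_exp_tanLog hα, evalOp_exp_eq_ev (tanDer_raising u)]
    exact LinearMap.congr_fun (ev_congr h _ _ _) _

/-- The definition of `jacobian` picks an arbitrary u. Iterating α = e^D gives α^N = e^(ND) on Lie
series, so D is forced to be the logarithm. -/
theorem tanLog_eq_of_isExpOf {α : LieAut k n} (hα : α ∈ tangential k n)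
    {u : Fin n → LieSeries k n} (hu : IsExpOf α u) : tanLog hα = tanDer u := by
  refine tanLog_eq_tanDer hα fun i => ?_
  have h : ∀ N, ∀ f : LieSeries k n, LieAut.hat (α ^ N) (f : NCSeries k n) =
      ev (tanDer_raising u) (PowerSeries.exp k ^ N) (f : NCSeries k n) := by
    intro N
    induction N with
    | zero => intro f; rw [LieAut.hat_pow_zero, pow_zero, map_one (ev _)]
    | succ N ih =>
      intro f
      have e := hu f
      rw [evalOp_exp_eq_ev (tanDer_raising u)] at e
      rw [pow_succ, pow_succ, LieAut.hat_mul, map_mul, Module.End.mul_apply, Module.End.mul_apply,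
        LieAut.hat_coe, ih, e]
  have h1 := hasJet_hat_pow hα (gen k i : NCSeries k n)
  simp only [h] at h1
  have h2 := h1.unique (hasJet_ev_exp_pow (tanDer_raising u) _)
  exact h2.trans (tanDer_X u i)

end Tangential

/-! ### Cyclic words -/

section Commutators

variable {k : Type*} [Field k] {n : ℕ}

theorem isGraded_commutators : IsGraded (commutators k n) := ⟨_, fun _ => Iff.rfl⟩

theorem IsGraded.mem_of_word {K : Submodule k (NCSeries k n)} (hK : IsGraded K)
    {Φ : NCSeries k n →ₗ[k] NCSeries k n} (hΦ : Filtered Φ) (h : ∀ v, Φ (word v) ∈ K)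
    (f : NCSeries k n) : Φ f ∈ K := by
  refine hK.mem_of_approx fun M => ⟨Φ (∑ d ∈ Finset.range M, comp d f), ?_,
    hΦ.sub_mem (sub_sum_comp_mem_filt M f)⟩
  rw [map_sum]
  refine sum_mem fun d _ => ?_
  rw [comp_eq_sum, map_sum]
  refine sum_mem fun v _ => ?_
  rw [map_smul]
  exact K.smul_mem _ (h _)

theorem comp_word (d : ℕ) (v : List (Fin n)) :
    comp d (word v : NCSeries k n) = if v.length = d then word v else 0 := by
  refine ext_coeff fun w => ?_
  rw [coeff_comp, coeff_word]
  by_cases hw : w = v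
  · subst hw; by_cases h : w.length = d <;> simp [h, coeff_word]
  · split_ifs <;> simp [coeff_word, hw]

/-- The closed subspace contains the brackets of words by definition; density extends this in one
argument at a time. -/
theorem lie_mem_commutators (f g : NCSeries k n) : ⁅f, g⁆ ∈ commutators k n := by
  have hw : ∀ v w : List (Fin n), ⁅(word v : NCSeries k n), word w⁆ ∈ commutators k n := by
    intro v w d
    rw [LieRing.of_associative_ring_bracket, ← word_append, ← word_append, comp_sub, comp_word,
      comp_word, List.length_append, List.length_append, add_comm w.length]
    split_ifs
    · exact Submodule.subset_span ⟨(v, w), rfl⟩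
    · rw [sub_self]; exact zero_mem _
  have had : ∀ z : NCSeries k n, Filtered (adOp z) := fun z =>
    (filtered_mulLeft z).sub (filtered_mulRight z)
  have h1 : ∀ v (g : NCSeries k n), ⁅(word v : NCSeries k n), g⁆ ∈ commutators k n := fun v =>
    isGraded_commutators.mem_of_word (had (word v)) (hw v)
  rw [← lie_skew]
  refine neg_mem (isGraded_commutators.mem_of_word (had g) (fun v => ?_) f)
  rw [adOp_apply, ← lie_skew]
  exact neg_mem (h1 v g)

theorem mul_sub_mul_mem_commutators (f g : NCSeries k n) : f * g - g * f ∈ commutators k n :=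
  lie_mem_commutators f g

theorem IsContHom.map_commutators {Φ : NCSeries k n →ₗ[k] NCSeries k n} (hΦ : IsContHom Φ)
    {f : NCSeries k n} (hf : f ∈ commutators k n) : Φ f ∈ commutators k n := by
  refine isGraded_commutators.mem_of_approx fun M => ⟨Φ (∑ d ∈ Finset.range M, NCSeries.comp d f), ?_,
    hΦ.filtered.sub_mem (sub_sum_comp_mem_filt M f)⟩
  rw [map_sum]
  refine sum_mem fun d _ => ?_
  have hle : Submodule.span k (Set.range fun p : List (Fin n) × List (Fin n) =>
      (word (p.1 ++ p.2) - word (p.2 ++ p.1) : NCSeries k n)) ≤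
        (commutators k n).comap Φ := by
    rw [Submodule.span_le]
    rintro _ ⟨⟨v, w⟩, rfl⟩
    simp only [SetLike.mem_coe, Submodule.mem_comap, word_append, map_sub, hΦ.map_mul]
    exact mul_sub_mul_mem_commutators _ _
  exact hle (hf d)

theorem conj_sub_mem_commutators {g h : NCSeries k n} (hhg : h * g = 1) (f : NCSeries k n) :
    g * f * h - f ∈ commutators k n := by
  have := mul_sub_mul_mem_commutators (g * f) h
  rwa [← mul_assoc h, hhg, one_mul] at this

/-- The linear part of a series. -/
def linPart (k : Type*) [Field k] (n : ℕ) : NCSeries k n →ₗ[k] NCSeries k n where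
  toFun f := ∑ j, f.coeff [j] • X j
  map_add' f g := by simp [add_smul, Finset.sum_add_distrib]
  map_smul' c f := by simp [mul_smul, Finset.smul_sum]

theorem linPart_apply (f : NCSeries k n) : linPart k n f = ∑ j, f.coeff [j] • X j := rfl

theorem linPart_filtered : Filtered (linPart k n) := by
  intro m f hf
  rw [linPart_apply]
  refine sum_mem fun j _ => ?_
  rcases Nat.lt_or_ge 1 m with h | h
  · rw [hf [j] (by simpa using h), zero_smul]; exact zero_mem _
  · exact Submodule.smul_mem _ _ (filt_anti h (X_mem_filt j))

theorem linPart_X (i : Fin n) : linPart k n (X i) = X i := by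
  rw [linPart_apply, Finset.sum_eq_single i]
  · simp [X, coeff_word]
  · intro j _ hj
    simp [X, coeff_word, hj]
  · simp

theorem linPart_lie (f g : NCSeries k n) : linPart k n ⁅f, g⁆ = 0 := by
  rw [linPart_apply]
  refine Finset.sum_eq_zero fun j _ => ?_
  have : ⁅f, g⁆.coeff [j] = 0 := by
    rw [LieRing.of_associative_ring_bracket, coeff_sub, mul_cons, mul_cons, mul_nil, mul_nil]
    simp only [partialD]
    ring
  rw [this, zero_smul]

/-- Brackets vanish as cyclic words and have no linear part, so only the generators survive. -/
theorem sub_linPart_mem_commutators {f : NCSeries k n} (hf : f ∈ LieSeries k n) :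
    f - linPart k n f ∈ commutators k n := by
  have hp : ∀ g ∈ LiePoly k n, g - linPart k n g ∈ commutators k n := by
    intro g hg
    induction hg using LieSubalgebra.lieSpan_induction with
    | mem g h => obtain ⟨i, rfl⟩ := h; rw [linPart_X, sub_self]; exact zero_mem _
    | zero => rw [map_zero, sub_zero]; exact zero_mem _
    | add f g _ _ hf hg => rw [map_add, add_sub_add_comm]; exact add_mem hf hg
    | smul c f _ hf => rw [map_smul, ← smul_sub]; exact Submodule.smul_mem _ c hf
    | lie f g _ _ _ _ => rw [linPart_lie, sub_zero]; exact lie_mem_commutators f g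
  refine isGraded_commutators.mem_of_approx fun M =>
    ⟨_, hp _ (sum_mem fun d (_ : d ∈ Finset.range M) => hf d), ?_⟩
  have h := sub_sum_comp_mem_filt M f
  have := sub_mem h (linPart_filtered.sub_mem h)
  convert this using 1
  abel

theorem cyc_eq_iff {f g : NCSeries k n} : cyc f = cyc g ↔ f - g ∈ commutators k n :=
  Submodule.Quotient.eq _

end Commutators

/-! ### The trace of the logarithm of a matrix -/

section TraceLog

variable {k : Type*} [Field k] {n : ℕ} {ι : Type*}

/-- The degree derivation on matrices. -/
def matDer (A : Matrix ι ι (NCSeries k n)) : Matrix ι ι (NCSeries k n) := A.map (degDer k n)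

theorem matDer_add (A B : Matrix ι ι (NCSeries k n)) :
    matDer (A + B) = matDer A + matDer B := by
  ext1 i j
  simp [matDer]

theorem matDer_one [DecidableEq ι] : matDer (1 : Matrix ι ι (NCSeries k n)) = 0 := by
  ext1 i j
  by_cases h : i = j
  · subst h; simp [matDer, degDer_one]
  · simp [matDer, h]

theorem matDer_mul [Fintype ι] (A B : Matrix ι ι (NCSeries k n)) :
    matDer (A * B) = matDer A * B + A * matDer B := by
  ext1 i j
  simp only [matDer, Matrix.map_apply, Matrix.add_apply, Matrix.mul_apply, map_sum, degDer_mul,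
    Finset.sum_add_distrib]

theorem trace_matDer [Fintype ι] (A : Matrix ι ι (NCSeries k n)) :
    (matDer A).trace = degDer k n A.trace := by
  simp [Matrix.trace, matDer]

theorem trace_mem_filt [Fintype ι] {A : Matrix ι ι (NCSeries k n)} {m : ℕ} (hA : ∀ i j, A i j ∈ filt k n m) :
    A.trace ∈ filt k n m := sum_mem fun i _ => hA i i

theorem trace_mul_sub_mem_commutators [Fintype ι] (A B : Matrix ι ι (NCSeries k n)) :
    (A * B).trace - (B * A).trace ∈ commutators k n := by
  simp only [Matrix.trace, Matrix.diag_apply, Matrix.mul_apply]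
  rw [Finset.sum_comm (f := fun i j => B i j * A j i), ← Finset.sum_sub_distrib]
  refine sum_mem fun i _ => ?_
  rw [← Finset.sum_sub_distrib]
  exact sum_mem fun j _ => mul_sub_mul_mem_commutators _ _

variable [Fintype ι] [DecidableEq ι]

theorem Matrix_pow_mem_filt {M : Matrix ι ι (NCSeries k n)} (hM : ∀ i j, M i j ∈ filt k n 1)
    (m : ℕ) : ∀ i j, (M ^ m) i j ∈ filt k n m := by
  induction m with
  | zero => exact fun _ _ => mem_filt_zero _
  | succ m ih =>
    intro i j
    rw [pow_succ, Matrix.mul_apply]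
    exact sum_mem fun l _ => mul_mem_filt (ih i l) (hM l j)

/-- Modulo commutators the trace is cyclic, so all m terms of the Leibniz expansion of A^m agree.
The extra factor A^(j+1) absorbs the powers released by the induction and keeps the exponent m + j
free of subtraction. -/
theorem trace_matDer_pow_mul (A : Matrix ι ι (NCSeries k n)) (m : ℕ) : ∀ j,
    (matDer (A ^ m) * A ^ (j + 1)).trace - m • (A ^ (m + j) * matDer A).trace ∈
      commutators k n := by
  induction m with
  | zero => intro j; rw [pow_zero, matDer_one]; simp
  | succ m ih =>
    intro j
    have e : matDer (A ^ (m + 1)) * A ^ (j + 1) =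
        matDer (A ^ m) * A ^ (j + 1 + 1) + A ^ m * matDer A * A ^ (j + 1) := by
      rw [pow_succ A m, matDer_mul, add_mul, pow_succ' A (j + 1)]
      simp only [mul_assoc]
    have h1 := ih (j + 1)
    have h2 := trace_mul_sub_mem_commutators (A ^ m * matDer A) (A ^ (j + 1))
    rw [← mul_assoc (A ^ (j + 1)), ← pow_add] at h2
    have h3 := add_mem h1 h2
    rw [e, Matrix.trace_add, succ_nsmul]
    have e1 : j + 1 + m = m + (j + 1) := by omega
    have e2 : m + 1 + j = m + (j + 1) := by omega
    rw [e1] at h3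
    rw [e2]
    convert h3 using 1
    abel

theorem degDer_trace_pow (A : Matrix ι ι (NCSeries k n)) (m : ℕ) :
    degDer k n (A ^ (m + 1)).trace - (m + 1) • (A ^ m * matDer A).trace ∈ commutators k n := by
  have h := trace_matDer_pow_mul A m 0
  rw [← trace_matDer, pow_succ A m, matDer_mul, Matrix.trace_add, succ_nsmul]
  simp only [zero_add, pow_one, add_zero] at h
  convert h using 1
  abel

variable [CharZero k]

/-- `Tr (log (1 + A))` for a matrix `A` whose entries have no constant term. -/
def trLog (A : Matrix ι ι (NCSeries k n)) : NCSeries k n :=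
  ⟨fun w => ∑ m ∈ Finset.range (w.length + 1),
    PowerSeries.coeff m (PowerSeries.log k) * ((A ^ m).trace).coeff w⟩

theorem coeff_trLog (A : Matrix ι ι (NCSeries k n)) (w : List (Fin n)) :
    (trLog A).coeff w = ∑ m ∈ Finset.range (w.length + 1),
      PowerSeries.coeff m (PowerSeries.log k) * ((A ^ m).trace).coeff w := rfl

theorem trLog_sub_sum_mem {A : Matrix ι ι (NCSeries k n)} (hA : ∀ i j, A i j ∈ filt k n 1)
    (M : ℕ) : trLog A - ∑ m ∈ Finset.range M, PowerSeries.coeff m (PowerSeries.log k) •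
      (A ^ m).trace ∈ filt k n M := by
  intro w hw
  rw [coeff_sub, coeff_sum, coeff_trLog, sub_eq_zero]
  simp only [coeff_smul]
  refine Finset.sum_subset (fun a ha => ?_) fun m _ hm => ?_
  · rw [Finset.mem_range] at *; omega
  · rw [trace_mem_filt (Matrix_pow_mem_filt hA m) w (by rw [Finset.mem_range] at hm; omega),
      mul_zero]

theorem trLog_mem_filt_one (A : Matrix ι ι (NCSeries k n)) : trLog A ∈ filt k n 1 := by
  rw [mem_filt_one, coeff_trLog]
  simp

theorem trLog_zero : trLog (0 : Matrix ι ι (NCSeries k n)) = 0 := by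
  refine ext_coeff fun w => ?_
  rw [coeff_trLog, Finset.sum_range_succ']
  simp

theorem coeff_log_succ_mul (m : ℕ) :
    PowerSeries.coeff (m + 1) (PowerSeries.log k) * ((m + 1 : ℕ) : k) = (-1) ^ m := by
  have h : ((m + 1 : ℕ) : k) ≠ 0 := Nat.cast_ne_zero.mpr (Nat.succ_ne_zero m)
  rw [PowerSeries.coeff_log, if_neg (Nat.succ_ne_zero m)]
  simp only [map_div₀, map_pow, map_neg, map_one, map_natCast]
  rw [div_mul_cancel₀ _ h, pow_add]
  ring

/-- The derivative of Tr log(1 + A) is Tr((1 + A)⁻¹ A') up to commutators: cyclicity turns the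
logarithm series into the geometric series ∑ (-A)^m, whose sum is Y. -/
theorem degDer_trLog {A Y : Matrix ι ι (NCSeries k n)} (hA : ∀ i j, A i j ∈ filt k n 1)
    (hY : Y * (1 + A) = 1) :
    degDer k n (trLog A) - (Y * matDer A).trace ∈ commutators k n := by
  refine isGraded_commutators.mem_of_approx fun M =>
    ⟨∑ m ∈ Finset.range M, PowerSeries.coeff (m + 1) (PowerSeries.log k) •
      (degDer k n (A ^ (m + 1)).trace - (m + 1) • (A ^ m * matDer A).trace),
      sum_mem fun m _ => Submodule.smul_mem _ _ (degDer_trace_pow A m), ?_⟩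
  have h1 := degDer_filtered.sub_mem (trLog_sub_sum_mem hA (M + 1))
  rw [Finset.sum_range_succ', map_add, map_sum] at h1
  simp only [map_smul, PowerSeries.coeff_zero_eq_constantCoeff, PowerSeries.constantCoeff_log,
    zero_smul, map_zero, add_zero] at h1
  have hgeo : Y - ∑ m ∈ Finset.range M, (-A) ^ m = Y * (-A) ^ M := by
    have h := mul_neg_geom_sum (-A) M
    rw [sub_neg_eq_add] at h
    calc Y - ∑ m ∈ Finset.range M, (-A) ^ m =
          Y - (Y * (1 + A)) * ∑ m ∈ Finset.range M, (-A) ^ m := by rw [hY, one_mul]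
      _ = _ := by rw [mul_assoc, h, mul_sub, mul_one, sub_sub_cancel]
  have h2 : (Y * matDer A).trace - ∑ m ∈ Finset.range M, (-1 : k) ^ m • (A ^ m * matDer A).trace ∈
      filt k n M := by
    have e : (Y * matDer A).trace - ∑ m ∈ Finset.range M, (-1 : k) ^ m • (A ^ m * matDer A).trace =
        (Y * (-A) ^ M * matDer A).trace := by
      rw [← hgeo, sub_mul, Matrix.trace_sub, Finset.sum_mul, Matrix.trace_sum]
      congr 1
      refine Finset.sum_congr rfl fun m _ => ?_
      rw [neg_pow A]
      rcases Nat.even_or_odd m with h | h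
      · simp [h.neg_one_pow]
      · simp [h.neg_one_pow]
    rw [e]
    refine trace_mem_filt fun i j => ?_
    rw [Matrix.mul_apply]
    refine sum_mem fun l _ => mul_mem_filt_right _ ?_
    rw [Matrix.mul_apply]
    exact sum_mem fun l' _ => mul_mem_filt_left _
      (Matrix_pow_mem_filt (fun i j => neg_mem (hA i j)) M _ _)
  have h3 := sub_mem (filt_anti (Nat.le_succ M) h1) h2
  have e : ∑ m ∈ Finset.range M, PowerSeries.coeff (m + 1) (PowerSeries.log k) •
      (degDer k n (A ^ (m + 1)).trace - (m + 1) • (A ^ m * matDer A).trace) =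
      ∑ m ∈ Finset.range M, PowerSeries.coeff (m + 1) (PowerSeries.log k) •
        degDer k n (A ^ (m + 1)).trace -
      ∑ m ∈ Finset.range M, (-1 : k) ^ m • (A ^ m * matDer A).trace := by
    rw [← Finset.sum_sub_distrib]
    refine Finset.sum_congr rfl fun m _ => ?_
    rw [smul_sub, ← coeff_log_succ_mul, mul_smul, Nat.cast_smul_eq_nsmul]
  rw [e]
  convert h3 using 1
  abel

/-- The degree derivation detects membership in the commutators for series without constant term, so
derivatives may be compared. With 1 + C = (1 + A)(1 + B) one has (1 + C)⁻¹ C' = Z (Y A') (1 + B) + Z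
B', and cyclicity removes the conjugation by Z. -/
theorem trLog_mul {A B Y Z : Matrix ι ι (NCSeries k n)} (hA : ∀ i j, A i j ∈ filt k n 1)
    (hB : ∀ i j, B i j ∈ filt k n 1) (hYA : Y * (1 + A) = 1) (hZB : Z * (1 + B) = 1)
    (hBZ : (1 + B) * Z = 1) :
    trLog ((1 + A) * (1 + B) - 1) - trLog A - trLog B ∈ commutators k n := by
  set C := (1 + A) * (1 + B) - 1 with hC
  have hC1 : 1 + C = (1 + A) * (1 + B) := by rw [hC]; abel
  have hCf : ∀ i j, C i j ∈ filt k n 1 := by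
    have : C = A + B + A * B := by rw [hC]; noncomm_ring
    intro i j
    rw [this]
    exact add_mem (add_mem (hA i j) (hB i j))
      (by rw [Matrix.mul_apply]; exact sum_mem fun l _ => mul_mem_filt_right _ (hA i l))
  have hZY : (Z * Y) * (1 + C) = 1 := by
    rw [hC1, mul_assoc, ← mul_assoc Y, hYA, one_mul, hZB]
  have hder : ∀ D : Matrix ι ι (NCSeries k n), matDer D = matDer (1 + D) := fun D => by
    rw [matDer_add, matDer_one, zero_add]
  refine isGraded_commutators.mem_of_degDer_mem
    (sub_mem (sub_mem (trLog_mem_filt_one _) (trLog_mem_filt_one _)) (trLog_mem_filt_one _)) ?_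
  rw [map_sub, map_sub]
  have h1 := degDer_trLog hCf hZY
  have h2 := degDer_trLog hA hYA
  have h3 := degDer_trLog hB hZB
  have e : Z * Y * matDer C = Z * (Y * matDer A * (1 + B)) + Z * matDer B := by
    rw [hder C, hC1, matDer_mul, ← hder, ← hder, mul_add]
    congr 1
    · simp only [mul_assoc]
    · rw [mul_assoc, ← mul_assoc Y, hYA, one_mul]
  have h4 := trace_mul_sub_mem_commutators Z (Y * matDer A * (1 + B))
  rw [mul_assoc _ (1 + B) Z, hBZ, mul_one] at h4
  rw [e, Matrix.trace_add] at h1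
  have h5 := add_mem (sub_mem (sub_mem h1 h2) h3) h4
  convert h5 using 1
  abel

theorem IsContHom.map_trLog {Φ : NCSeries k n →ₗ[k] NCSeries k n} (hΦ : IsContHom Φ)
    {A : Matrix ι ι (NCSeries k n)} (hA : ∀ i j, A i j ∈ filt k n 1) :
    Φ (trLog A) = trLog (A.map Φ) := by
  have hpow : ∀ m, (A ^ m).map Φ = (A.map Φ) ^ m := by
    intro m
    induction m with
    | zero =>
      ext1 i j
      by_cases h : i = j
      · subst h; simp [hΦ.map_one]
      · simp [h]
    | succ m ih =>
      rw [pow_succ, pow_succ, ← ih]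
      ext1 i j
      simp only [Matrix.map_apply, Matrix.mul_apply, map_sum, hΦ.map_mul]
  have htr : ∀ m, Φ (A ^ m).trace = ((A.map Φ) ^ m).trace := by
    intro m
    rw [← hpow]
    simp [Matrix.trace]
  refine eq_of_forall_sub_mem_filt fun M => ?_
  have h1 := hΦ.filtered.sub_mem (trLog_sub_sum_mem hA M)
  have h2 := trLog_sub_sum_mem (A := A.map Φ) (fun i j => hΦ.filtered 1 _ (hA i j)) M
  rw [map_sum] at h1
  simp only [map_smul, htr] at h1
  simpa using sub_mem h1 h2

/-- The entries of A vanish at N = 0, so powers of A from the second on have no linear term in N. -/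
theorem hasJet_trLog {A : ℕ → Matrix ι ι (NCSeries k n)} {B : Matrix ι ι (NCSeries k n)}
    (h : ∀ i j, HasJet (fun N => A N i j) 0 (B i j)) (hB : ∀ i j, B i j ∈ filt k n 1) :
    HasJet (fun N => trLog (A N)) 0 B.trace := by
  have hp2 : ∀ m i j, ∃ c, HasJet (fun N => (A N ^ (m + 1)) i j) 0 c := by
    intro m
    induction m with
    | zero => exact fun i j => ⟨B i j, by simpa using h i j⟩
    | succ m ih =>
      intro i j
      choose c hc using ih
      have := HasJet.sum Finset.univ fun l _ => (hc i l).mul (h l j)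
      simp only [← Matrix.mul_apply, ← pow_succ] at this
      exact ⟨_, by simpa using this⟩
  have hp : ∀ m i j, HasJet (fun N => (A N ^ (m + 1 + 1)) i j) 0 0 := by
    intro m i j
    choose c hc using hp2
    have := HasJet.sum Finset.univ fun l _ => (hc m i l).mul (h l j)
    simp only [← Matrix.mul_apply, ← pow_succ] at this
    simpa using this
  have htr : ∀ m, HasJet (fun N => PowerSeries.coeff m (PowerSeries.log k) • (A N ^ m).trace) 0
      (if m = 1 then B.trace else 0) := by
    intro m
    match m with
    | 0 => simpa using hasJet_const (0 : NCSeries k n)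
    | 1 => simpa [Matrix.trace] using HasJet.sum Finset.univ fun i _ => h i i
    | m + 2 =>
      have h0 := (HasJet.sum Finset.univ fun i _ => hp m i i).smul
        (PowerSeries.coeff (m + 2) (PowerSeries.log k))
      simp only [Finset.sum_const_zero, smul_zero] at h0
      simpa [Matrix.trace] using h0
  intro w
  have h1 := PolyJet.sum (Finset.range (w.length + 1)) fun m _ => htr m w
  simp only [coeff_smul] at h1
  convert! h1 using 1
  · simp
  · by_cases hw : w = []
    · subst hw
      simp [mem_filt_one.mp (trace_mem_filt hB)]
    · rw [Finset.sum_eq_single 1]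
      · simp
      · intro m _ hm; simp [hm]
      · intro h
        exact absurd (List.length_eq_zero_iff.mp (by simpa using h)) hw

end TraceLog

/-! ### The Jacobian cocycle -/

section PartialDerivatives

variable {k : Type*} [Field k] {n : ℕ}

/-- `∂_i` as a linear map. -/
def partialDL (k : Type*) [Field k] {n : ℕ} (i : Fin n) : NCSeries k n →ₗ[k] NCSeries k n where
  toFun := partialD i
  map_add' _ _ := rfl
  map_smul' _ _ := rfl

theorem partialD_add (i : Fin n) (f g : NCSeries k n) :
    partialD i (f + g) = partialD i f + partialD i g := rfl

theorem partialD_sub (i : Fin n) (f g : NCSeries k n) :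
    partialD i (f - g) = partialD i f - partialD i g := rfl

theorem partialD_sum {ι : Type*} (s : Finset ι) (i : Fin n) (f : ι → NCSeries k n) :
    partialD i (∑ j ∈ s, f j) = ∑ j ∈ s, partialD i (f j) := map_sum (partialDL k i) f s

theorem partialD_mem_filt (i : Fin n) {m : ℕ} {f : NCSeries k n} (hf : f ∈ filt k n (m + 1)) :
    partialD i f ∈ filt k n m := fun w hw => hf (i :: w) (Nat.succ_lt_succ hw)

theorem partialD_X (i j : Fin n) :
    partialD j (X i : NCSeries k n) = if j = i then 1 else 0 := by
  refine ext_coeff fun v => ?_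
  by_cases hji : j = i <;> simp [partialD, X, coeff_word, hji, coeff_one]

theorem partialD_smul_one (i : Fin n) (c : k) : partialD i (c • (1 : NCSeries k n)) = 0 :=
  ext_coeff fun v => by simp [partialD, coeff_one]

theorem eq_add_sum_X_mul_partialD (f : NCSeries k n) :
    f = f.coeff [] • (1 : NCSeries k n) + ∑ i, X i * partialD i f := by
  refine ext_coeff fun w => ?_
  rw [coeff_add, coeff_sum]
  cases w with
  | nil => simp [coeff_X_mul_nil, coeff_one]
  | cons j w =>
    simp only [coeff_X_mul, coeff_smul, coeff_one]
    simp [partialD]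

/-- The chain rule. -/
theorem IsContHom.partialD_map {Φ : NCSeries k n →ₗ[k] NCSeries k n} (hΦ : IsContHom Φ)
    (j : Fin n) (f : NCSeries k n) :
    partialD j (Φ f) = ∑ i, partialD j (Φ (X i)) * Φ (partialD i f) := by
  conv_lhs => rw [eq_add_sum_X_mul_partialD f]
  rw [map_add, map_smul, hΦ.map_one, map_sum, partialD_add, partialD_smul_one, zero_add,
    partialD_sum]
  refine Finset.sum_congr rfl fun i _ => ?_
  rw [hΦ.map_mul, partialD_mul, mem_filt_one.mp (hΦ.filtered 1 _ (X_mem_filt i)), zero_smul,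
    zero_add]

theorem IsContHom.map_matrix_mul {Φ : NCSeries k n →ₗ[k] NCSeries k n} (hΦ : IsContHom Φ)
    {ι : Type*} [Fintype ι] (A B : Matrix ι ι (NCSeries k n)) :
    (A * B).map Φ = A.map Φ * B.map Φ := by
  ext1 i j
  simp only [Matrix.map_apply, Matrix.mul_apply, map_sum, hΦ.map_mul]

theorem IsContHom.map_matrix_one {Φ : NCSeries k n →ₗ[k] NCSeries k n} (hΦ : IsContHom Φ)
    {ι : Type*} [DecidableEq ι] : (1 : Matrix ι ι (NCSeries k n)).map Φ = 1 :=
  Matrix.map_one Φ (map_zero Φ) hΦ.map_one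

/-- The Jacobian matrix `(∂_j (α x_i))`. -/
def jacMat (α : LieAut k n) : Matrix (Fin n) (Fin n) (NCSeries k n) :=
  Matrix.of fun j i => partialD j (LieAut.hat α (X i))

theorem jacMat_apply (α : LieAut k n) (j i : Fin n) :
    jacMat α j i = partialD j (LieAut.hat α (X i)) := rfl

theorem jacMat_mul (α β : LieAut k n) :
    jacMat (α * β) = jacMat α * (jacMat β).map (LieAut.hat α) := by
  ext1 j i
  rw [jacMat_apply, LieAut.hat_mul, Module.End.mul_apply, (LieAut.isContHom_hat α).partialD_map,
    Matrix.mul_apply]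
  rfl

theorem jacMat_eq_one {α : LieAut k n} (h : LieAut.hat α = 1) : jacMat α = 1 := by
  ext1 j i
  rw [jacMat_apply, h, Module.End.one_apply, partialD_X, Matrix.one_apply]

theorem jacMat_mul_inv (α : LieAut k n) :
    jacMat α * (jacMat α⁻¹).map (LieAut.hat α) = 1 := by
  rw [← jacMat_mul, mul_inv_cancel]
  exact jacMat_eq_one LieAut.hat_refl

theorem jacMat_inv_mul (α : LieAut k n) :
    (jacMat α⁻¹).map (LieAut.hat α) * jacMat α = 1 := by
  have h := jacMat_mul_inv α⁻¹
  rw [inv_inv] at h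
  have h1 := congrArg (fun A => A.map (LieAut.hat α)) h
  simp only [(LieAut.isContHom_hat α).map_matrix_mul, (LieAut.isContHom_hat α).map_matrix_one,
    Matrix.map_map] at h1
  have e : (LieAut.hat α : NCSeries k n → NCSeries k n) ∘ LieAut.hat α⁻¹ = id :=
    funext fun f => LieAut.hat_hat_inv α f
  rwa [e, Matrix.map_id] at h1

/-- Since φ(t) = 1 + q(t) t, the difference is q(D)(D f). -/
theorem ev_phi_sub_mem {K : Submodule k (NCSeries k n)} (hK : IsGraded K)
    {D : Module.End k (NCSeries k n)} (hD : Raising D) (hDK : ∀ f ∈ K, D f ∈ K)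
    {f : NCSeries k n} (hf : D f ∈ K) : ev hD (phiSeries k) f - f ∈ K := by
  obtain ⟨q, hq⟩ : PowerSeries.X ∣ phiSeries k - 1 := by
    rw [PowerSeries.X_dvd_iff]; simp [phiSeries]
  have e : phiSeries k = q * PowerSeries.X + 1 := by rw [mul_comm, ← hq]; ring
  rw [e, map_add, map_mul, ev_X, map_one (ev hD), LinearMap.add_apply, Module.End.mul_apply,
    Module.End.one_apply, add_sub_cancel_right]
  exact hK.evalOp_mem hD hDK _ hf

/-- One has ∂_i⁅u_i, x_i⁆ = ∂_i(u_i) x_i - u_i. The first term is cyclically x_i ∂_i(u_i), and u_i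
reduces to its linear part. This discrepancy with the divergence is what `linCocycle` repairs. -/
theorem sum_partialD_tanDer_sub_mem (u : Fin n → LieSeries k n) :
    ∑ i, partialD i (tanDer u (X i)) - (divergence u - ∑ i, linPart k n (u i : NCSeries k n)) ∈
      commutators k n := by
  rw [divergence, ← Finset.sum_sub_distrib, ← Finset.sum_sub_distrib]
  refine sum_mem fun i _ => ?_
  have hu : (u i : NCSeries k n).coeff [] = 0 := mem_filt_one.mp (LieSeries.mem_filt_one (u i))
  rw [tanDer_X, LieRing.of_associative_ring_bracket, partialD_sub, partialD_mul, partialD_mul,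
    hu, partialD_X, if_pos rfl, zero_smul, zero_add, one_mul]
  have hX : (X i : NCSeries k n).coeff [] = 0 := by simp [X, coeff_word]
  rw [hX, zero_smul, zero_add]
  have h1 := mul_sub_mul_mem_commutators (partialD i (u i : NCSeries k n)) (X i)
  have h2 := sub_linPart_mem_commutators (u i).2
  convert sub_mem h1 h2 using 1
  abel

end PartialDerivatives

/-! ### The Jacobian as a corrected Tr log of the Jacobian matrix -/

section Cocycle

variable {k : Type*} [Field k] [CharZero k] {n : ℕ}

theorem jacMat_sub_one_mem {α : LieAut k n} (hα : α ∈ tangential k n) (j i : Fin n) :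
    (jacMat α - 1) j i ∈ filt k n 1 := by
  have : (jacMat α - 1) j i = partialD j (LieAut.hat α (X i) - X i) := by
    rw [Matrix.sub_apply, jacMat_apply, partialD_sub, partialD_X, Matrix.one_apply]
  rw [this]
  exact partialD_mem_filt j (hat_X_sub_X_mem hα i)

theorem trLog_jacMat_mul {α β : LieAut k n} (hα : α ∈ tangential k n) (hβ : β ∈ tangential k n) :
    trLog (jacMat (α * β) - 1) - trLog (jacMat α - 1) - LieAut.hat α (trLog (jacMat β - 1)) ∈
      commutators k n := by
  have hΦ := LieAut.isContHom_hat α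
  have e : (jacMat β - 1).map (LieAut.hat α) = (jacMat β).map (LieAut.hat α) - 1 := by
    rw [Matrix.map_sub _ (map_sub _), hΦ.map_matrix_one]
  have h := trLog_mul (A := jacMat α - 1) (B := (jacMat β - 1).map (LieAut.hat α))
    (Y := (jacMat α⁻¹).map (LieAut.hat α))
    (Z := ((jacMat β⁻¹).map (LieAut.hat β)).map (LieAut.hat α))
    (jacMat_sub_one_mem hα) (fun i j => hΦ.filtered 1 _ (jacMat_sub_one_mem hβ i j))
    (by rw [add_sub_cancel, jacMat_inv_mul])
    (by rw [e, add_sub_cancel, ← hΦ.map_matrix_mul, jacMat_inv_mul, hΦ.map_matrix_one])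
    (by rw [e, add_sub_cancel, ← hΦ.map_matrix_mul, jacMat_mul_inv, hΦ.map_matrix_one])
  rw [← hΦ.map_trLog (jacMat_sub_one_mem hβ), e, add_sub_cancel, add_sub_cancel,
    ← jacMat_mul] at h
  exact h

/-- The linear part `∑ i, ∑ j ≠ i, (u_i)_j x_j` of the logarithm `⟦u_1, …, u_n⟧` of `α`. -/
def linCocycle (α : LieAut k n) : NCSeries k n :=
  ∑ i, ∑ j, if j = i then 0 else (LieAut.hat α (X i)).coeff [j, i] • X j

/-- As α - 1 raises degree and f - x_i starts in degree 2, α does not change the quadratic part of f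
- x_i. -/
theorem hat_coeff_two {α : LieAut k n} (hα : α ∈ tangential k n) {i : Fin n} {f : NCSeries k n}
    (hf : f - X i ∈ filt k n 2) {j : Fin n} :
    (LieAut.hat α f).coeff [j, i] = f.coeff [j, i] + (LieAut.hat α (X i)).coeff [j, i] := by
  have h := hat_sub_one_raising hα 2 _ hf [j, i] (by simp)
  rw [LinearMap.sub_apply, Module.End.one_apply, map_sub] at h
  simp only [coeff_sub] at h
  have h0 : (X i : NCSeries k n).coeff [j, i] = 0 := by simp [X, coeff_word]
  rw [h0] at h
  linear_combination h

theorem linCocycle_mul {α β : LieAut k n} (hα : α ∈ tangential k n) (hβ : β ∈ tangential k n) :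
    linCocycle (α * β) = linCocycle α + linCocycle β := by
  simp only [linCocycle, ← Finset.sum_add_distrib]
  refine Finset.sum_congr rfl fun i _ => Finset.sum_congr rfl fun j _ => ?_
  split_ifs
  · rw [add_zero]
  · rw [LieAut.hat_mul, Module.End.mul_apply, hat_coeff_two hα (hat_X_sub_X_mem hβ i), add_smul,
      add_comm]

theorem hat_X_sub_X_mem_commutators {α : LieAut k n} (hα : α ∈ tangential k n) (i : Fin n) :
    LieAut.hat α (X i) - X i ∈ commutators k n := by
  obtain ⟨u, hu⟩ := hα i
  rw [LieAut.hat_X, hu]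
  exact conj_sub_mem_commutators (exp_neg_mul_exp (LieSeries.mem_filt_one u)) _

/-- Each α x_j is conjugate to x_j, so α fixes linear cyclic series; an additive map with such
values is therefore a cocycle. -/
theorem hat_linCocycle_sub_mem {α β : LieAut k n} (hα : α ∈ tangential k n) :
    LieAut.hat α (linCocycle β) - linCocycle β ∈ commutators k n := by
  rw [linCocycle, map_sum, ← Finset.sum_sub_distrib]
  refine sum_mem fun i _ => ?_
  rw [map_sum, ← Finset.sum_sub_distrib]
  refine sum_mem fun j _ => ?_
  split_ifs
  · rw [map_zero, sub_zero]; exact zero_mem _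
  · rw [map_smul, ← smul_sub]
    exact Submodule.smul_mem _ _ (hat_X_sub_X_mem_commutators hα j)

/-- A series representing the Jacobian of a tangential automorphism. -/
def jacRep (α : LieAut k n) : NCSeries k n := trLog (jacMat α - 1) + linCocycle α

theorem jacRep_mul {α β : LieAut k n} (hα : α ∈ tangential k n) (hβ : β ∈ tangential k n) :
    jacRep (α * β) - jacRep α - LieAut.hat α (jacRep β) ∈ commutators k n := by
  have h := sub_mem (trLog_jacMat_mul hα hβ) (hat_linCocycle_sub_mem (β := β) hα)
  rw [jacRep, jacRep, jacRep, map_add, linCocycle_mul hα hβ]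
  convert h using 1
  abel

theorem tanLog_mem_commutators {α : LieAut k n} (hα : α ∈ tangential k n) {f : NCSeries k n}
    (hf : f ∈ commutators k n) : tanLog hα f ∈ commutators k n :=
  isGraded_commutators.jet_mem (hasJet_hat_pow hα f) fun _ =>
    (LieAut.isContHom_hat _).map_commutators hf

/-- Along the powers of α, Tr log of the Jacobian matrix satisfies the cocycle relation, and its
derivative at N = 0 is the trace of the matrix (∂_j(D x_i)), with D = log α. -/
theorem trLog_jacMat_sub_mem {α : LieAut k n} (hα : α ∈ tangential k n) :
    trLog (jacMat α - 1) - ev (tanLog_raising hα) (phiSeries k)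
      (∑ i, partialD i (tanLog hα (X i))) ∈ commutators k n := by
  have hjet : ∀ j i, HasJet (fun N => (jacMat (α ^ N) - 1) j i) 0
      (Matrix.of (fun j i => partialD j (tanLog hα (X i))) j i) := by
    intro j i
    have h := ((hasJet_hat_pow hα (X i)).partialD j).sub
      (hasJet_const ((1 : Matrix (Fin n) (Fin n) (NCSeries k n)) j i))
    have e : partialD j (X i : NCSeries k n) = (1 : Matrix (Fin n) (Fin n) (NCSeries k n)) j i := by
      rw [partialD_X, Matrix.one_apply]
    rw [e, sub_self, sub_zero] at h
    exact h
  have hB : ∀ j i, (Matrix.of (fun j i => partialD j (tanLog hα (X i)))) j i ∈ filt k n 1 :=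
    fun j i => partialD_mem_filt j (tanLog_raising hα 1 _ (X_mem_filt i))
  have h := isGraded_commutators.cocycle_mem (tanLog_raising hα)
    (fun f hf => tanLog_mem_commutators hα hf)
    (by rw [jacMat_eq_one (LieAut.hat_pow_zero α), sub_self, trLog_zero]; exact zero_mem _)
    (fun N => by
      rw [pow_succ', pow_one, ev_exp_tanLog hα]
      exact trLog_jacMat_mul hα (pow_mem hα N))
    (hasJet_trLog hjet hB)
  rwa [pow_one] at h

/-- The quadratic part of α x_i is that of ⁅u_i, x_i⁆, where x_j x_i for j ≠ i has the coefficient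
of x_j in u_i. Normalization disposes of j = i. -/
theorem linCocycle_eq {α : LieAut k n} {u : Fin n → LieSeries k n}
    (hn : Normalized u) (hu : IsExpOf α u) :
    linCocycle α = ∑ i, linPart k n (u i : NCSeries k n) := by
  refine Finset.sum_congr rfl fun i _ => ?_
  rw [linPart_apply]
  refine Finset.sum_congr rfl fun j _ => ?_
  split_ifs with hji
  · rw [hji, hn i, zero_smul]
  · congr 1
    have h := evalOp_sub_sum_mem (tanDer_raising u) (fun m => ((m.factorial : k))⁻¹) (X i) 3
    have e := hu (gen k i)
    rw [← LieAut.hat_coe] at e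
    change LieAut.hat α (X i) = evalOp _ _ (X i) at e
    rw [← e, Finset.sum_range_succ, Finset.sum_range_succ, Finset.sum_range_one] at h
    have h2 := (tanDer_raising u).pow_mem 2 1 (X_mem_filt (k := k) i)
    have h3 := add_mem h ((filt k n 3).smul_mem (((2).factorial : k))⁻¹ h2) [j, i] (by simp)
    rw [pow_zero, pow_one, Module.End.one_apply, tanDer_X] at h3
    have hu0 : (u i : NCSeries k n).coeff [] = 0 := mem_filt_one.mp (LieSeries.mem_filt_one (u i))
    have h4 : (⁅(u i : NCSeries k n), X i⁆).coeff [j, i] = (u i : NCSeries k n).coeff [j] := by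
      rw [LieRing.of_associative_ring_bracket, coeff_sub, coeff_X_mul, if_neg hji, mul_cons,
        mul_cons, hu0, mul_nil]
      simp [partialD, X, coeff_word]
    simp only [coeff_add, coeff_sub, coeff_smul, h4] at h3
    have h5 : (X i : NCSeries k n).coeff [j, i] = 0 := by simp [X, coeff_word]
    rw [h5] at h3
    simp only [Nat.factorial_zero, Nat.factorial_one, Nat.cast_one, inv_one, mul_zero,
      one_mul, zero_add] at h3
    linear_combination h3

/-- Tr log contributes φ(D) applied to the divergence minus the linear parts of the u_i, and φ(D)
fixes those linear parts modulo commutators because D x_j = ⁅u_j, x_j⁆. Adding them back leaves φ(D)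
of the divergence. -/
theorem jacobian_eq_cyc_jacRep {α : LieAut k n} (hα : α ∈ tangential k n) :
    jacobian α = cyc (jacRep α) := by
  have hex := exists_isExpOf hα
  rw [jacobian, dif_pos hex]
  obtain ⟨hn, hu⟩ := hex.choose_spec
  set u := hex.choose
  have hlog := tanLog_eq_of_isExpOf hα hu
  have hD := tanDer_raising u
  have hDK : ∀ f ∈ commutators k n, tanDer u f ∈ commutators k n := fun f hf => by
    rw [← hlog]; exact tanLog_mem_commutators hα hf
  have h1 := trLog_jacMat_sub_mem hα
  rw [ev_congr hlog _ hD] at h1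
  simp only [hlog] at h1
  have h2 : ev hD (phiSeries k) (∑ i, partialD i (tanDer u (X i))) - ev hD (phiSeries k)
      (divergence u - ∑ i, linPart k n (u i : NCSeries k n)) ∈ commutators k n := by
    rw [← map_sub]
    exact isGraded_commutators.evalOp_mem hD hDK _ (sum_partialD_tanDer_sub_mem u)
  have h3 : ev hD (phiSeries k) (linCocycle α) - linCocycle α ∈ commutators k n := by
    refine ev_phi_sub_mem isGraded_commutators hD hDK ?_
    rw [linCocycle, map_sum]
    refine sum_mem fun i _ => ?_
    rw [map_sum]
    refine sum_mem fun j _ => ?_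
    split_ifs
    · rw [map_zero]; exact zero_mem _
    · rw [map_smul, tanDer_X]
      exact Submodule.smul_mem _ _ (lie_mem_commutators _ _)
  rw [cyc_eq_iff, evalOp_eq_ev hD, jacRep]
  rw [← linCocycle_eq hn hu, map_sub] at h2
  have h4 := neg_mem (add_mem (add_mem h1 h2) (neg_mem h3))
  convert h4 using 1
  rw [phiSeries]
  abel

end Cocycle

/-! ### Duflo series -/

section Duflo

variable {k : Type*} [Field k]

/-- The sum of the coefficients of the words of length `m` with exactly one letter `y`. -/
def linearInY (k : Type*) [Field k] (m : ℕ) : NCSeries k 2 →ₗ[k] k where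
  toFun f := ∑ v : Fin m → Fin 2, if (List.ofFn v).count 1 = 1 then f.coeff (List.ofFn v) else 0
  map_add' f g := by
    rw [← Finset.sum_add_distrib]
    refine Finset.sum_congr rfl fun v _ => ?_
    split_ifs <;> simp
  map_smul' c f := by
    simp [Finset.mul_sum]

theorem linearInY_apply (m : ℕ) (f : NCSeries k 2) : linearInY k m f =
    ∑ v : Fin m → Fin 2, if (List.ofFn v).count 1 = 1 then f.coeff (List.ofFn v) else 0 := rfl

theorem linearInY_eq_zero_of_mem_filt {m : ℕ} {f : NCSeries k 2} (hf : f ∈ filt k 2 (m + 1)) :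
    linearInY k m f = 0 := by
  rw [linearInY_apply]
  refine Finset.sum_eq_zero fun v _ => ?_
  rw [hf _ (by simp), ite_self]

theorem linearInY_word (m : ℕ) (v : List (Fin 2)) :
    linearInY k m (word v) = if v.length = m ∧ v.count 1 = 1 then 1 else 0 := by
  rw [linearInY_apply]
  split_ifs with h
  · obtain ⟨rfl, h⟩ := h
    rw [Finset.sum_eq_single v.get]
    · simp [coeff_word, h]
    · intro u _ hu
      have hw : List.ofFn u ≠ v := fun hw => hu (List.ofFn_injective (by rw [hw, List.ofFn_get]))
      rw [coeff_word, if_neg hw, ite_self]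
    · simp
  · refine Finset.sum_eq_zero fun u _ => ?_
    split_ifs with hc
    · rw [coeff_word, if_neg]
      rintro rfl
      exact h ⟨by simp, hc⟩
    · rfl

/-- Rotating a word changes neither its length nor its number of letters y. -/
theorem linearInY_eq_zero_of_mem_commutators (m : ℕ) {f : NCSeries k 2}
    (hf : f ∈ commutators k 2) : linearInY k m f = 0 := by
  have h1 : linearInY k m f = linearInY k m (comp m f) := by
    rw [linearInY_apply, linearInY_apply]
    refine Finset.sum_congr rfl fun v _ => ?_
    rw [coeff_comp, if_pos List.length_ofFn]
  have hle : Submodule.span k (Set.range fun p : List (Fin 2) × List (Fin 2) =>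
      (word (p.1 ++ p.2) - word (p.2 ++ p.1) : NCSeries k 2)) ≤
        LinearMap.ker (linearInY k m) := by
    rw [Submodule.span_le]
    rintro _ ⟨⟨v, w⟩, rfl⟩
    rw [SetLike.mem_coe, LinearMap.mem_ker, map_sub, linearInY_word, linearInY_word, sub_eq_zero]
    simp only [List.length_append, List.count_append, add_comm]
  rw [h1]
  exact hle (hf m)

theorem X_pow_eq_word {n : ℕ} (i : Fin n) (m : ℕ) :
    (X i : NCSeries k n) ^ m = word (List.replicate m i) := by
  induction m with
  | zero => rfl
  | succ m ih => rw [pow_succ', ih, List.replicate_succ, word_cons]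

theorem coeff_X_add_X_pow (w : List (Fin 2)) :
    ((X 0 + X 1 : NCSeries k 2) ^ w.length).coeff w = 1 := by
  induction w with
  | nil => simp [coeff_one]
  | cons j w ih =>
    rw [List.length_cons, pow_succ', add_mul, coeff_add, coeff_X_mul, coeff_X_mul, ih]
    fin_cases j <;> simp

/-- A series representing `⟨r(f) - r(x) - r(y)⟩`. -/
def deltaRep (r : PowerSeries k) (f : NCSeries k 2) : NCSeries k 2 :=
  evalSeries r f - evalSeries r (X 0) - evalSeries r (X 1)

theorem deltaRep_add (r s : PowerSeries k) (f : NCSeries k 2) :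
    deltaRep (r + s) f = deltaRep r f + deltaRep s f := by
  simp only [deltaRep, evalSeries_add]; abel

theorem deltaRep_sub (r s : PowerSeries k) (f : NCSeries k 2) :
    deltaRep (r - s) f = deltaRep r f - deltaRep s f := by
  simp only [deltaRep, evalSeries_sub]; abel

theorem evalSeries_sub_smul_pow_mem {n : ℕ} {f : NCSeries k n} (hf : f ∈ filt k n 1)
    {r : PowerSeries k} {m : ℕ} (hr : ∀ j < m, PowerSeries.coeff j r = 0) :
    evalSeries r f - PowerSeries.coeff m r • f ^ m ∈ filt k n (m + 1) := by
  have h := evalOp_sub_sum_mem (raising_mulLeft hf) (fun m => PowerSeries.coeff m r) 1 (m + 1)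
  rw [Finset.sum_range_succ, Finset.sum_eq_zero (fun j hj => by
    simp only [hr j (Finset.mem_range.mp hj), zero_smul]), zero_add, ← evalSeries_eq_evalOp,
    LinearMap.pow_mulLeft, LinearMap.mulLeft_apply, mul_one] at h
  exact h

theorem pow_sub_pow_mem_filt {n : ℕ} {f g : NCSeries k n} (hf : f ∈ filt k n 1)
    (hg : g ∈ filt k n 1) (hfg : f - g ∈ filt k n 2) (m : ℕ) :
    f ^ m - g ^ m ∈ filt k n (m + 1) := by
  induction m with
  | zero => simp
  | succ m ih =>
    have e : f ^ (m + 1) - g ^ (m + 1) = f ^ m * (f - g) + (f ^ m - g ^ m) * g := by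
      rw [pow_succ, pow_succ, mul_sub, sub_mul]; abel
    rw [e]
    have h1 : f ^ m * (f - g) ∈ filt k n (m + 2) := mul_mem_filt (pow_mem_filt hf m) hfg
    have h2 : (f ^ m - g ^ m) * g ∈ filt k n (m + 1 + 1) := mul_mem_filt ih hg
    exact add_mem h1 h2

/-- `x + y`. -/
def sumXY (k : Type*) [Field k] : NCSeries k 2 := X 0 + X 1

theorem sumXY_mem : sumXY k ∈ filt k 2 1 := add_mem (X_mem_filt 0) (X_mem_filt 1)

theorem sumXY_sub_mem : sumXY k - (X 0 + X 1) ∈ filt k 2 2 := by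
  rw [sumXY, sub_self]; exact zero_mem _

variable [CharZero k]

/-- Every word of length m has coefficient 1 in (x + y)^m, so the value counts words with one y; y
x^(m-1) is one, and the characteristic is 0. -/
theorem linearInY_X_add_X_pow_ne_zero {m : ℕ} (hm : 1 ≤ m) :
    linearInY k m ((X 0 + X 1) ^ m) ≠ 0 := by
  have e : linearInY k m ((X 0 + X 1) ^ m) =
      ((Finset.univ.filter fun v : Fin m → Fin 2 => (List.ofFn v).count 1 = 1).card : k) := by
    rw [linearInY_apply, Finset.card_filter, Nat.cast_sum]
    refine Finset.sum_congr rfl fun v _ => ?_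
    have := coeff_X_add_X_pow (k := k) (List.ofFn v)
    rw [List.length_ofFn] at this
    rw [this]
    split_ifs <;> simp
  rw [e, Nat.cast_ne_zero, Finset.card_ne_zero]
  obtain ⟨l, rfl⟩ := Nat.exists_eq_add_of_le' hm
  refine ⟨Fin.cons 1 fun _ => 0, ?_⟩
  rw [Finset.mem_filter]
  refine ⟨Finset.mem_univ _, ?_⟩
  rw [List.ofFn_cons, List.ofFn_const]
  simp [List.count_replicate]

/-- The Duflo series is determined by the corresponding series of cyclic words. -/
theorem eq_zero_of_deltaRep_mem {r : PowerSeries k} (hr : PowerSeries.X ^ 2 ∣ r)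
    {f : NCSeries k 2} (hf : f - (X 0 + X 1) ∈ filt k 2 2) (h : deltaRep r f ∈ commutators k 2) :
    r = 0 := by
  have hX : (X 0 + X 1 : NCSeries k 2) ∈ filt k 2 1 := add_mem (X_mem_filt 0) (X_mem_filt 1)
  have hf1 : f ∈ filt k 2 1 := by
    have := add_mem (filt_anti (by norm_num : 1 ≤ 2) hf) hX
    rwa [sub_add_cancel] at this
  ext m
  rw [map_zero]
  induction m using Nat.strong_induction_on with
  | _ m ih =>
  rcases Nat.lt_or_ge m 2 with hm | hm
  · exact PowerSeries.X_pow_dvd_iff.mp hr m hm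
  -- With the lower coefficients of r gone, the degree m part is r_m((x + y)^m - x^m - y^m), since f
  -- agrees with x + y to first order. As m ≥ 2, neither x^m nor y^m has exactly one y.
  have hr' := fun g (hg : g ∈ filt k 2 1) => linearInY_eq_zero_of_mem_filt
    (evalSeries_sub_smul_pow_mem hg ih)
  simp only [map_sub, map_smul, sub_eq_zero] at hr'
  have h1 := linearInY_eq_zero_of_mem_commutators m h
  rw [deltaRep, map_sub, map_sub, hr' _ hf1, hr' _ (X_mem_filt 0), hr' _ (X_mem_filt 1),
    X_pow_eq_word, X_pow_eq_word, linearInY_word, linearInY_word] at h1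
  have h2 := linearInY_eq_zero_of_mem_filt (pow_sub_pow_mem_filt hf1 hX hf m)
  rw [map_sub, sub_eq_zero] at h2
  rw [h2, if_neg (by simp [List.count_replicate]), if_neg (by
    rintro ⟨-, h⟩; rw [List.count_replicate_self] at h; omega), smul_zero, sub_zero,
    sub_zero, smul_eq_mul] at h1
  exact (mul_eq_zero.mp h1).resolve_right (linearInY_X_add_X_pow_ne_zero (by omega))

theorem hat_evalSeries_X_sub_mem {n : ℕ} {α : LieAut k n} (hα : α ∈ tangential k n)
    (r : PowerSeries k) (i : Fin n) :
    LieAut.hat α (evalSeries r (X i)) - evalSeries r (X i) ∈ commutators k n := by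
  obtain ⟨u, hu⟩ := hα i
  have hu1 := LieSeries.mem_filt_one u
  rw [(LieAut.isContHom_hat α).map_evalSeries r (X_mem_filt i), LieAut.hat_X, hu]
  change evalSeries r (exp (u : NCSeries k n) * X i * exp (-u : NCSeries k n)) - _ ∈ _
  rw [evalSeries_conj (X_mem_filt i) (exp_mul_exp_neg hu1) (exp_neg_mul_exp hu1)]
  exact conj_sub_mem_commutators (exp_neg_mul_exp hu1) _

/-- Substitution commutes with α, and the terms r(x), r(y) are moved only within their conjugacy
classes. -/
theorem hat_deltaRep_sub_mem {α : LieAut k 2} (hα : α ∈ tangential k 2) (r : PowerSeries k)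
    {f : NCSeries k 2} (hf : f ∈ filt k 2 1) :
    LieAut.hat α (deltaRep r f) - deltaRep r (LieAut.hat α f) ∈ commutators k 2 := by
  rw [deltaRep, deltaRep, map_sub, map_sub, (LieAut.isContHom_hat α).map_evalSeries r hf]
  have h := add_mem (hat_evalSeries_X_sub_mem hα r 0) (hat_evalSeries_X_sub_mem hα r 1)
  convert neg_mem h using 1
  abel

/-! ### The groupoid of solutions -/

/-- `α` is a tangential automorphism with `α f = g` and with Jacobian `⟨r(g) - r(x) - r(y)⟩`. -/
structure IsSolution (f g : NCSeries k 2) (α : LieAut k 2) (r : PowerSeries k) : Prop where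
  tangential : α ∈ tangential k 2
  map_eq : LieAut.hat α f = g
  dvd : PowerSeries.X ^ 2 ∣ r
  jac : jacobian α = cyc (deltaRep r g)

theorem IsSolution.jacRep_sub_mem {f g : NCSeries k 2} {α : LieAut k 2} {r : PowerSeries k}
    (h : IsSolution f g α r) : jacRep α - deltaRep r g ∈ commutators k 2 := by
  rw [← cyc_eq_iff, ← jacobian_eq_cyc_jacRep h.tangential, h.jac]

/-- In J(αβ) = J(α) + α·J(β), the action of α carries the term based at f to the one based at g = α
f, so the two Duflo terms add. -/
theorem IsSolution.mul {e f g : NCSeries k 2} {α β : LieAut k 2} {r s : PowerSeries k}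
    (hf : f ∈ filt k 2 1) (hα : IsSolution f g α r) (hβ : IsSolution e f β s) :
    IsSolution e g (α * β) (r + s) where
  tangential := mul_mem hα.tangential hβ.tangential
  map_eq := by rw [LieAut.hat_mul, Module.End.mul_apply, hβ.map_eq, hα.map_eq]
  dvd := dvd_add hα.dvd hβ.dvd
  jac := by
    rw [jacobian_eq_cyc_jacRep (mul_mem hα.tangential hβ.tangential), cyc_eq_iff, deltaRep_add]
    have h1 := jacRep_mul hα.tangential hβ.tangential
    have h2 := (LieAut.isContHom_hat α).map_commutators hβ.jacRep_sub_mem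
    rw [map_sub] at h2
    have h3 := hat_deltaRep_sub_mem hα.tangential s hf
    rw [hα.map_eq] at h3
    convert add_mem (add_mem (add_mem h1 h2) h3) hα.jacRep_sub_mem using 1
    abel

theorem jacRep_one_mem {n : ℕ} : jacRep ((1 : tangential k n) : LieAut k n) ∈ commutators k n := by
  set α := ((1 : tangential k n) : LieAut k n) with hα
  have h := jacRep_mul (SetLike.coe_mem (1 : tangential k n)) (SetLike.coe_mem (1 : tangential k n))
  rw [← hα] at h
  have e : LieAut.hat α (jacRep α) = jacRep α := LinearMap.congr_fun LieAut.hat_refl _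
  have e' : α * α = α := rfl
  rwa [e', e, sub_self, zero_sub, neg_mem_iff] at h

theorem isSolution_one (f : NCSeries k 2) :
    IsSolution f f ((1 : tangential k 2) : LieAut k 2) 0 where
  tangential := one_mem _
  map_eq := LinearMap.congr_fun LieAut.hat_refl f
  dvd := dvd_zero _
  jac := by
    rw [jacobian_eq_cyc_jacRep (SetLike.coe_mem (1 : tangential k 2)), cyc_eq_iff]
    have e : deltaRep (0 : PowerSeries k) f = 0 := by
      have := deltaRep_sub (0 : PowerSeries k) 0 f
      rwa [sub_self, sub_self] at this
    rw [e, sub_zero]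
    exact jacRep_one_mem

theorem IsSolution.inv {f g : NCSeries k 2} {α : LieAut k 2} {r : PowerSeries k}
    (hg : g ∈ filt k 2 1) (h : IsSolution f g α r) : IsSolution g f α⁻¹ (-r) where
  tangential := inv_mem h.tangential
  map_eq := by rw [← h.map_eq, LieAut.hat_inv_hat]
  dvd := (dvd_neg).mpr h.dvd
  jac := by
    have hα := h.tangential
    rw [jacobian_eq_cyc_jacRep (inv_mem hα), cyc_eq_iff, ← zero_sub r, deltaRep_sub]
    -- The cocycle identity for α⁻¹ α = 1 expresses J(α⁻¹) as -α⁻¹·J(α).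
    have h1 := jacRep_mul (inv_mem hα) hα
    rw [inv_mul_cancel] at h1
    have h2 := (LieAut.isContHom_hat α⁻¹).map_commutators h.jacRep_sub_mem
    rw [map_sub] at h2
    have h3 := hat_deltaRep_sub_mem (inv_mem hα) r hg
    rw [← h.map_eq, LieAut.hat_inv_hat, h.map_eq] at h3
    have h4 := (isSolution_one f).jacRep_sub_mem
    convert sub_mem h4 (add_mem (add_mem h1 h2) h3) using 1
    rw [OneMemClass.coe_one]
    abel

theorem IsSolution.unique {f g : NCSeries k 2} {α : LieAut k 2} {r s : PowerSeries k}
    (hg : g - (X 0 + X 1) ∈ filt k 2 2) (h : IsSolution f g α r) (h' : IsSolution f g α s) :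
    r = s := by
  refine sub_eq_zero.mp (eq_zero_of_deltaRep_mem (dvd_sub h.dvd h'.dvd) hg ?_)
  rw [deltaRep_sub]
  have := sub_mem h'.jacRep_sub_mem h.jacRep_sub_mem
  rwa [sub_sub_sub_cancel_left] at this

/-- `log (e ^ x e ^ y)`. -/
def bchXY (k : Type*) [Field k] : NCSeries k 2 := log (exp (X 0) * exp (X 1))

theorem exp_X_mul_exp_X_sub_mem : exp (X 0 : NCSeries k 2) * exp (X 1) - 1 - (X 0 + X 1) ∈
    filt k 2 2 := by
  have h : ∀ i : Fin 2, exp (X i : NCSeries k 2) - 1 - X i ∈ filt k 2 2 := by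
    intro i
    have hX := X_mem_filt (k := k) i
    rw [exp_sub_one_eq hX]
    have h1 := evalSeries_sub_smul_pow_mem hX (r := PowerSeries.exp k - 1) (m := 1) (by
      intro j hj
      rw [Nat.lt_one_iff.mp hj]
      simp)
    have h2 : PowerSeries.coeff 1 (PowerSeries.exp k - 1) = 1 := by
      simp [PowerSeries.coeff_exp, PowerSeries.coeff_one]
    rwa [h2, one_smul, pow_one] at h1
  have h0 := exp_sub_one_mem (X_mem_filt (k := k) (0 : Fin 2))
  have h1 := exp_sub_one_mem (X_mem_filt (k := k) (1 : Fin 2))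
  convert add_mem (add_mem (h 0) (h 1)) (mul_mem_filt h0 h1) using 1
  noncomm_ring

theorem exp_X_mul_exp_X_sub_one_mem : exp (X 0 : NCSeries k 2) * exp (X 1) - 1 ∈ filt k 2 1 := by
  have h := add_mem (filt_anti (by norm_num : 1 ≤ 2) (exp_X_mul_exp_X_sub_mem (k := k)))
    (add_mem (X_mem_filt 0) (X_mem_filt 1))
  rwa [sub_add_cancel] at h

theorem exp_bchXY : exp (bchXY k) = exp (X 0) * exp (X 1) := exp_log exp_X_mul_exp_X_sub_one_mem

theorem bchXY_mem : bchXY k ∈ filt k 2 1 := log_mem_filt exp_X_mul_exp_X_sub_one_mem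

theorem bchXY_sub_mem : bchXY k - (X 0 + X 1) ∈ filt k 2 2 := by
  have h := evalSeries_sub_smul_pow_mem exp_X_mul_exp_X_sub_one_mem
    (r := PowerSeries.log k) (m := 1) (by
      intro j hj
      rw [Nat.lt_one_iff.mp hj]
      simp)
  rw [PowerSeries.coeff_one_log, one_smul, pow_one, ← log_eq] at h
  have := add_mem h exp_X_mul_exp_X_sub_mem
  rwa [sub_add_sub_cancel] at this

/-- Translates the group condition on α(XY) into a condition on the logarithm of XY, by injectivity
of the exponential. -/
theorem hat_bchXY_eq_iff (α : LieAut k 2) {g : NCSeries k 2} (hg : g ∈ filt k 2 1) :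
    LieAut.hat α (bchXY k) = g ↔
      exp (α (x k) : NCSeries k 2) * exp (α (y k) : NCSeries k 2) = exp g := by
  have hα := LieAut.isContHom_hat α
  have h1 : exp (LieAut.hat α (bchXY k)) =
      exp (α (x k) : NCSeries k 2) * exp (α (y k) : NCSeries k 2) := by
    rw [exp_eq, ← hα.map_evalSeries _ bchXY_mem, ← exp_eq, exp_bchXY, hα.map_mul]
    exact congrArg₂ (· * ·) (LieAut.hat_exp α (x k)) (LieAut.hat_exp α (y k))
  rw [← h1]
  exact ⟨fun h => by rw [h], exp_injOn (hα.filtered 1 _ bchXY_mem) hg⟩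

theorem mem_tangential_two {α : LieAut k 2} : α ∈ tangential k 2 ↔
    LieConj (α (x k)) (x k) ∧ LieConj (α (y k)) (y k) := by
  rw [mem_tangential, Fin.forall_fin_two]

theorem isSolution_iff_isDuf {f : NCSeries k 2} {α : LieAut k 2} (hα : α ∈ tangential k 2)
    (h : LieAut.hat α f = sumXY k) (r : PowerSeries k) :
    IsSolution f (sumXY k) α r ↔ IsDuf α r :=
  ⟨fun h => ⟨h.dvd, h.jac⟩, fun h' => ⟨hα, h, h'.1, h'.2⟩⟩

theorem isSolution_iff_isDufTilde {f : NCSeries k 2} {α : LieAut k 2} (hα : α ∈ tangential k 2)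
    (h : LieAut.hat α f = bchXY k) (r : PowerSeries k) :
    IsSolution f (bchXY k) α r ↔ IsDufTilde α r :=
  ⟨fun h => ⟨h.dvd, h.jac⟩, fun h' => ⟨hα, h, h'.1, h'.2⟩⟩

theorem mem_SolKV_iff {μ : LieAut k 2} :
    μ ∈ SolKV k ↔ ∃ r, IsSolution (bchXY k) (sumXY k) μ r := by
  constructor
  · rintro ⟨hx, hy, hxy, r, hr⟩
    rw [groupConj_iff_lieConj] at hx hy
    exact ⟨r, (isSolution_iff_isDuf (mem_tangential_two.mpr ⟨hx, hy⟩)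
      ((hat_bchXY_eq_iff μ sumXY_mem).mpr hxy) r).mpr hr⟩
  · rintro ⟨r, h⟩
    obtain ⟨hx, hy⟩ := mem_tangential_two.mp h.tangential
    exact ⟨groupConj_iff_lieConj.mpr hx, groupConj_iff_lieConj.mpr hy,
      (hat_bchXY_eq_iff μ sumXY_mem).mp h.map_eq, r, h.dvd, h.jac⟩

theorem mem_KV_iff {α : LieAut k 2} :
    α ∈ KV k ↔ ∃ r, IsSolution (bchXY k) (bchXY k) α r := by
  have e := hat_bchXY_eq_iff α (bchXY_mem (k := k))
  rw [exp_bchXY] at e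
  constructor
  · rintro ⟨hx, hy, hxy, r, hr⟩
    rw [groupConj_iff_lieConj] at hx hy
    exact ⟨r, (isSolution_iff_isDufTilde (mem_tangential_two.mpr ⟨hx, hy⟩) (e.mpr hxy) r).mpr hr⟩
  · rintro ⟨r, h⟩
    obtain ⟨hx, hy⟩ := mem_tangential_two.mp h.tangential
    exact ⟨groupConj_iff_lieConj.mpr hx, groupConj_iff_lieConj.mpr hy, e.mp h.map_eq,
      r, h.dvd, h.jac⟩

theorem mem_KRV_iff {a : LieAut k 2} :
    a ∈ KRV k ↔ ∃ r, IsSolution (sumXY k) (sumXY k) a r := by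
  have e : LieAut.hat a (sumXY k) = sumXY k ↔ a (x k + y k) = x k + y k := by
    have h := LieAut.hat_coe a (x k + y k)
    have h' : ((x k + y k : LieSeries k 2) : NCSeries k 2) = sumXY k := rfl
    rw [h'] at h
    rw [h, ← h', Subtype.coe_inj]
  constructor
  · rintro ⟨hx, hy, hxy, r, hr⟩
    exact ⟨r, (isSolution_iff_isDuf (mem_tangential_two.mpr ⟨hx, hy⟩) (e.mpr hxy) r).mpr hr⟩
  · rintro ⟨r, h⟩
    obtain ⟨hx, hy⟩ := mem_tangential_two.mp h.tangential
    exact ⟨hx, hy, e.mp h.map_eq, r, h.dvd, h.jac⟩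

/-- By uniqueness, the series chosen in `Duf` is the one attached to the arrow. -/
theorem IsSolution.duf_eq {f : NCSeries k 2} {α : LieAut k 2} {r : PowerSeries k}
    (h : IsSolution f (sumXY k) α r) : Duf α = r := by
  have hex : ∃ r, IsDuf α r := ⟨r, h.dvd, h.jac⟩
  rw [Duf, dif_pos hex]
  exact ((isSolution_iff_isDuf h.tangential h.map_eq _).mpr hex.choose_spec).unique
    sumXY_sub_mem h

theorem IsSolution.dufTilde_eq {f : NCSeries k 2} {α : LieAut k 2} {r : PowerSeries k}
    (h : IsSolution f (bchXY k) α r) : DufTilde α = r := by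
  have hex : ∃ r, IsDufTilde α r := ⟨r, h.dvd, h.jac⟩
  rw [DufTilde, dif_pos hex]
  exact ((isSolution_iff_isDufTilde h.tangential h.map_eq _).mpr hex.choose_spec).unique
    bchXY_sub_mem h

/-- The group of the solutions that fix `f`. -/
def solutionGroup {f : NCSeries k 2} (hf : f ∈ filt k 2 1) : Subgroup (LieAut k 2) where
  carrier := {α | ∃ r, IsSolution f f α r}
  mul_mem' := by
    rintro α β ⟨r, hr⟩ ⟨s, hs⟩
    exact ⟨r + s, hr.mul hf hs⟩
  one_mem' := ⟨0, isSolution_one f⟩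
  inv_mem' := by
    rintro α ⟨r, hr⟩
    exact ⟨-r, hr.inv hf⟩

end Duflo

end

end KashiwaraVergne

/-! ### The proposition, from the groupoid of solutions -/

open KashiwaraVergne in
theorem proposition2p3 (k : Type*) [Field k] [CharZero k] :
    -- the Duflo series is well defined on each of the three sets
    (∀ μ ∈ SolKV k, ∃! r, IsDuf μ r) ∧
    (∀ α ∈ KV k, ∃! σ, IsDufTilde α σ) ∧
    (∀ a ∈ KRV k, ∃! s, IsDuf a s) ∧
    -- `KV k` and `KRV k` are groups under composition
    ∃ (G H : Subgroup (LieAut k 2)), (G : Set (LieAut k 2)) = KV k ∧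
      (H : Set (LieAut k 2)) = KRV k ∧
      -- a left action of `KV k` and a right action of `KRV k` on `SolKV k`, given by the formulas
      ∃ (_ : MulAction G (SolKV k)) (_ : MulAction Hᵐᵒᵖ (SolKV k)),
        (∀ (α : G) (μ : SolKV k),
          ((α • μ : SolKV k) : LieAut k 2) = (μ : LieAut k 2) * (α : LieAut k 2)⁻¹) ∧
        (∀ (a : H) (μ : SolKV k),
          ((MulOpposite.op a • μ : SolKV k) : LieAut k 2) =
            (a : LieAut k 2)⁻¹ * (μ : LieAut k 2)) ∧
        -- the actions commute
        SMulCommClass G Hᵐᵒᵖ (SolKV k) ∧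
        -- each of the actions is free and transitive
        (∀ μ μ' : SolKV k, ∃! α : G, α • μ = μ') ∧
        (∀ μ μ' : SolKV k, ∃! a : H, MulOpposite.op a • μ = μ') ∧
        -- the Duflo map is additive on the groups
        (∀ α β : G, DufTilde ((α : LieAut k 2) * (β : LieAut k 2)) =
          DufTilde (α : LieAut k 2) + DufTilde (β : LieAut k 2)) ∧
        (∀ a b : H, Duf ((a : LieAut k 2) * (b : LieAut k 2)) =
          Duf (a : LieAut k 2) + Duf (b : LieAut k 2)) ∧
        -- and compatible with the actions
        (∀ (α : G) (μ : SolKV k), Duf ((α • μ : SolKV k) : LieAut k 2) =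
          Duf (μ : LieAut k 2) - DufTilde (α : LieAut k 2)) ∧
        (∀ (a : H) (μ : SolKV k), Duf ((MulOpposite.op a • μ : SolKV k) : LieAut k 2) =
          Duf (μ : LieAut k 2) - Duf (a : LieAut k 2)) := by
  have hs := sumXY_mem (k := k)
  have hb := bchXY_mem (k := k)
  have hG : ∀ α : solutionGroup hb, ∃ r, IsSolution (bchXY k) (bchXY k) (α : LieAut k 2) r :=
    fun α => α.2
  have hH : ∀ a : solutionGroup hs, ∃ r, IsSolution (sumXY k) (sumXY k) (a : LieAut k 2) r :=
    fun a => a.2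
  have hS : ∀ μ : SolKV k, ∃ r, IsSolution (bchXY k) (sumXY k) (μ : LieAut k 2) r :=
    fun μ => mem_SolKV_iff.mp μ.2
  have hact : ∀ {μ α : LieAut k 2} {r s : PowerSeries k}, IsSolution (bchXY k) (sumXY k) μ r →
      IsSolution (bchXY k) (bchXY k) α s → IsSolution (bchXY k) (sumXY k) (μ * α⁻¹) (r - s) :=
    fun hμ hα => by rw [sub_eq_add_neg]; exact hμ.mul hb (hα.inv hb)
  have hact' : ∀ {μ a : LieAut k 2} {r s : PowerSeries k}, IsSolution (bchXY k) (sumXY k) μ r →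
      IsSolution (sumXY k) (sumXY k) a s → IsSolution (bchXY k) (sumXY k) (a⁻¹ * μ) (r - s) :=
    fun hμ ha => by rw [sub_eq_neg_add]; exact (ha.inv hs).mul hs hμ
  refine ⟨fun μ hμ => ?_, fun α hα => ?_, fun a ha => ?_, solutionGroup hb, solutionGroup hs,
    Set.ext fun α => mem_KV_iff.symm, Set.ext fun a => mem_KRV_iff.symm, ?_⟩
  · obtain ⟨r, hr⟩ := mem_SolKV_iff.mp hμ
    have h := isSolution_iff_isDuf hr.tangential hr.map_eq
    exact ⟨r, (h r).mp hr, fun s h' => ((h s).mpr h').unique sumXY_sub_mem hr⟩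
  · obtain ⟨r, hr⟩ := mem_KV_iff.mp hα
    have h := isSolution_iff_isDufTilde hr.tangential hr.map_eq
    exact ⟨r, (h r).mp hr, fun s h' => ((h s).mpr h').unique bchXY_sub_mem hr⟩
  · obtain ⟨r, hr⟩ := mem_KRV_iff.mp ha
    have h := isSolution_iff_isDuf hr.tangential hr.map_eq
    exact ⟨r, (h r).mp hr, fun s h' => ((h s).mpr h').unique sumXY_sub_mem hr⟩
  · let A : MulAction (solutionGroup hb) (SolKV k) :=
      { smul := fun α μ => ⟨(μ : LieAut k 2) * (α : LieAut k 2)⁻¹, by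
          obtain ⟨r, hr⟩ := hS μ
          obtain ⟨s, hs⟩ := hG α
          exact mem_SolKV_iff.mpr ⟨_, hact hr hs⟩⟩
        one_smul := fun μ => Subtype.ext (by
          change (μ : LieAut k 2) * ((1 : solutionGroup hb) : LieAut k 2)⁻¹ = μ
          rw [OneMemClass.coe_one, inv_one, mul_one])
        mul_smul := fun α β μ => Subtype.ext (by
          change (μ : LieAut k 2) * ((α * β : solutionGroup hb) : LieAut k 2)⁻¹ =
            (μ : LieAut k 2) * (β : LieAut k 2)⁻¹ * (α : LieAut k 2)⁻¹
          rw [MulMemClass.coe_mul, mul_inv_rev, mul_assoc]) }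
    let B : MulAction (solutionGroup hs)ᵐᵒᵖ (SolKV k) :=
      { smul := fun a μ => ⟨(a.unop : LieAut k 2)⁻¹ * (μ : LieAut k 2), by
          obtain ⟨r, hr⟩ := hS μ
          obtain ⟨s, hs⟩ := hH a.unop
          exact mem_SolKV_iff.mpr ⟨_, hact' hr hs⟩⟩
        one_smul := fun μ => Subtype.ext (by
          change ((1 : solutionGroup hs) : LieAut k 2)⁻¹ * (μ : LieAut k 2) = μ
          rw [OneMemClass.coe_one, inv_one, one_mul])
        mul_smul := fun a b μ => Subtype.ext (by
          change ((b.unop * a.unop : solutionGroup hs) : LieAut k 2)⁻¹ * (μ : LieAut k 2) =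
            (a.unop : LieAut k 2)⁻¹ * ((b.unop : LieAut k 2)⁻¹ * (μ : LieAut k 2))
          rw [MulMemClass.coe_mul, mul_inv_rev, mul_assoc]) }
    have hA : ∀ (α : solutionGroup hb) (μ : SolKV k),
      ((α • μ : SolKV k) : LieAut k 2) = (μ : LieAut k 2) * (α : LieAut k 2)⁻¹ := fun _ _ => rfl
    have hB : ∀ (a : solutionGroup hs) (μ : SolKV k), ((MulOpposite.op a • μ : SolKV k) :
      LieAut k 2) = (a : LieAut k 2)⁻¹ * (μ : LieAut k 2) := fun _ _ => rfl
    refine ⟨A, B, hA, hB, ⟨fun α a μ => Subtype.ext ?_⟩, fun μ μ' => ?_, fun μ μ' => ?_,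
      fun α β => ?_, fun a b => ?_, fun α μ => ?_, fun a μ => ?_⟩
    · change (a.unop : LieAut k 2)⁻¹ * (μ : LieAut k 2) * (α : LieAut k 2)⁻¹ =
        (a.unop : LieAut k 2)⁻¹ * ((μ : LieAut k 2) * (α : LieAut k 2)⁻¹)
      rw [mul_assoc]
    · obtain ⟨r, hr⟩ := hS μ
      obtain ⟨s, hs'⟩ := hS μ'
      -- Solving μ α⁻¹ = μ' gives α = μ'⁻¹ μ, a composite of arrows from log(e^x e^y) to x + y and
      -- back.
      refine ⟨⟨(μ' : LieAut k 2)⁻¹ * (μ : LieAut k 2), _, (hs'.inv hs).mul hs hr⟩,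
        Subtype.ext ?_, fun α h => Subtype.ext ?_⟩
      · rw [hA]
        change (μ : LieAut k 2) * ((μ' : LieAut k 2)⁻¹ * (μ : LieAut k 2))⁻¹ = μ'
        group
      · change (α : LieAut k 2) = (μ' : LieAut k 2)⁻¹ * (μ : LieAut k 2)
        rw [← h, hA]
        group
    · obtain ⟨r, hr⟩ := hS μ
      obtain ⟨s, hs'⟩ := hS μ'
      -- Solving a⁻¹ μ = μ' gives a = μ μ'⁻¹, which passes from x + y through log(e^x e^y).
      refine ⟨⟨(μ : LieAut k 2) * (μ' : LieAut k 2)⁻¹, _, hr.mul hb (hs'.inv hs)⟩,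
        Subtype.ext ?_, fun a h => Subtype.ext ?_⟩
      · rw [hB]
        change ((μ : LieAut k 2) * (μ' : LieAut k 2)⁻¹)⁻¹ * (μ : LieAut k 2) = μ'
        group
      · change (a : LieAut k 2) = (μ : LieAut k 2) * (μ' : LieAut k 2)⁻¹
        rw [← h, hB]
        group
    · obtain ⟨r, hr⟩ := hG α
      obtain ⟨s, hs'⟩ := hG β
      rw [hr.dufTilde_eq, hs'.dufTilde_eq, (hr.mul hb hs').dufTilde_eq]
    · obtain ⟨r, hr⟩ := hH a
      obtain ⟨s, hs'⟩ := hH b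
      rw [hr.duf_eq, hs'.duf_eq, (hr.mul hs hs').duf_eq]
    · obtain ⟨r, hr⟩ := hS μ
      obtain ⟨s, hs'⟩ := hG α
      rw [hA, hr.duf_eq, hs'.dufTilde_eq, (hact hr hs').duf_eq]
    · obtain ⟨r, hr⟩ := hS μ
      obtain ⟨s, hs'⟩ := hH a
      rw [hB, hr.duf_eq, hs'.duf_eq, (hact' hr hs').duf_eq]
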